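/- **Admission control in a single-server queue.** Fix a horizon $T>0$, a capacity $C\in\mathbb N$, rate functions $\lambda,\mu:[0,T]\to[0,\infty)$ that are integrable on $[0,T]$, constants $K_1,K_2,K_3>0$ and $\gamma\ge 0$. On a probability space let $N^\lambda$ (all customer arrivals) and $N^\mu$ (service completions) be non-homogeneous Poisson processes on $[0,T]$ with rates $\lambda(t)$ and $\mu(t)$, and let $U_0,U_1,\dots$ be i.i.d. uniform on $[0,1]$, where $N^\lambda$, $N^\mu$ and $(U_i)$ are independent. States are $x\in\{0,\dots,C\}$, actions are $0$ (reject) and $1$ (admit); the available actions are $\mathcal A(x)=\{0,1\}$ for $x<C$ and $\mathcal A(C)=\{0\}$. An admissible policy $\pi$ assigns to each $(t,x)\in[0,T]\times\{0,\dots,C\}$ a probability distribution $\pi(\cdot\mid t,x)$ on $\{0,1\}$ with $\pi(a\mid t,x)=0$ for $a\notin\mathcal A(x)$, such that $t\mapsto\pi(a\mid t,x)$ is continuous. Its entropy is $\mathcal H(\pi(\cdot\mid t,x))=-\sum_{a\in\mathcal A(x)}\pi(a\mid t,x)\log\pi(a\mid t,x)$ (with $0\log 0=0$). Under $\pi$,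 started at time $s$ with $x$ customers, the queue length is $X_t=x+A_t-D_t$, where the $i$-th customer ($i=0,1,\dots$), arriving at time $\tau$, is admitted ($A$ jumps by $1$) if and only if $U_i<\pi(1\mid\tau,X_{\tau-})$, and each event of $N^\mu$ removes one customer ($D$ jumps by $1$) if the system is not empty. The value function is $$J(s,x;\pi)=\mathbb E\Big[K_1\int_{(s,T]}dA_t-K_2\int_s^T X_{t-}\,dt-K_3X_T+\gamma\int_s^T\mathcal H(\pi(\cdot\mid t,X_{t-}))\,dt\,\Big|\,X_s=x\Big],$$ the expectation for the queue started at time $s$ in state $x$. Let $\Phi\subseteq\mathbb R^d$ be open and let $\{\pi^\phi:\phi\in\Phi\}$ be admissible policies such that $\phi\mapsto\pi^\phi(a\mid t,x)$ is smooth on $\Phi$ for all $(t,x,a)$, $t\mapsto\nabla_\phi\pi^\phi(a\mid t,x)$ is continuous on $[0,T]$ for all $(x,a,\phi)$, and the second derivatives $\nabla_\phi^2\pi^\phi(a\mid t,x)$ are bounded, uniformly in $(t,x,a)$, for $\phi$ in a neighbourhood of each point of $\Phi$. **Theorem.** For every $\phi\in\Phi$ and every initial queue length $c\in\{0,\dots,C\}$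 (in particular $c=0$, the initially empty system), the function $\psi\mapsto J(0,c;\pi^{\psi})$ is differentiable at $\phi$ and, with $X$ and $A$ the queue length and the admitted-arrival process under $\pi^\phi$ started at time $0$ with $c$ customers, $$\nabla_\phi J(0,c;\pi^\phi)=\mathbb E\Big[\int_{(0,T]}\nabla_\phi\log\pi^\phi(1\mid t,X_{t-})\,\big[J(t,X_{t-}+1;\pi^\phi)-J(t,X_{t-};\pi^\phi)+K_1\big]\,dA_t+\gamma\int_0^T\nabla_\phi\mathcal H(\pi^\phi(\cdot\mid t,X_{t-}))\,dt\Big].$$ All quantities are well defined: the rewards defining $J$ are integrable, $\phi\mapsto\mathcal H(\pi^\phi(\cdot\mid t,x))$ is differentiable for all $(t,x)$, almost surely $\pi^\phi(1\mid t,X_{t-})>0$ at every jump time $t$ of $A$ and $t\mapsto\nabla_\phi\mathcal H(\pi^\phi(\cdot\mid t,X_{t-}))$ is integrable on $[0,T]$, and the two terms inside the expectation are integrable. -/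

import Mathlib

open Set Filter Topology MeasureTheory ProbabilityTheory
open scoped NNReal

namespace QueueControl

noncomputable section

/-- Data of the admission-control problem on the horizon `[0, T]`: capacity `C`, arrival rate
`lam` and service rate `mu` (functions of time), reward `K1` per admitted customer, holding cost
`K2` per customer and unit of time, penalty `K3` per customer left at time `T`, and temperature
`gam` of the entropy bonus. -/
structure Model where
  T : ℝ
  C : ℕ
  lam : ℝ → ℝ
  mu : ℝ → ℝ
  K1 : ℝ
  K2 : ℝ
  K3 : ℝ
  gam : ℝ
  T_pos : 0 < T
  lam_nonneg : ∀ t ∈ Icc 0 T, 0 ≤ lam t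
  mu_nonneg : ∀ t ∈ Icc 0 T, 0 ≤ mu t
  lam_integrable : IntervalIntegrable lam volume 0 T
  mu_integrable : IntervalIntegrable mu volume 0 T
  K1_pos : 0 < K1
  K2_pos : 0 < K2
  K3_pos : 0 < K3
  gam_nonneg : 0 ≤ gam

/-! ### The random primitives -/

/-- `N` is a non-homogeneous Poisson process on `[0, T]` with rate function `rate`. -/
structure IsPoissonProcess {Ω : Type*} [MeasurableSpace Ω] (P : Measure Ω) (T : ℝ)
    (rate : ℝ → ℝ) (N : ℝ → Ω → ℕ) : Prop where
  measurable : ∀ t ∈ Icc 0 T, Measurable (N t)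
  zero : ∀ ω, N 0 ω = 0
  mono : ∀ ω, MonotoneOn (fun t => N t ω) (Icc 0 T)
  right_cont : ∀ ω, ∀ t ∈ Ico 0 T, ContinuousWithinAt (fun r => N r ω) (Ici t) t
  indep_incr : HasIndepIncrements (fun (t : Icc (0 : ℝ) T) => N t) P
  law_incr : ∀ s t, 0 ≤ s → s ≤ t → t ≤ T →
    P.map (fun ω => N t ω - N s ω) = poissonMeasure (∫ r in s..t, rate r).toNNReal

/-- The random primitives: the Poisson process `Narr` of all customer arrivals (rate `lam`), the
Poisson service process `Nsrv` (rate `mu`), and i.i.d. uniform random variables `U i` used to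
sample the admission decision for the `i`-th arriving customer (`i = 0, 1, …`); the three are
independent. -/
structure IsPrimitives {Ω : Type*} [MeasurableSpace Ω] (M : Model) (P : Measure Ω)
    (Narr Nsrv : ℝ → Ω → ℕ) (U : ℕ → Ω → ℝ) : Prop where
  arrivals : IsPoissonProcess P M.T M.lam Narr
  services : IsPoissonProcess P M.T M.mu Nsrv
  measurable_U : ∀ i, Measurable (U i)
  uniform_U : ∀ i, P.map (U i) = volume.restrict (Icc (0 : ℝ) 1)
  indep_U : iIndepFun U P
  indep_arrivals_services : IndepFun
    (fun ω (t : Icc (0 : ℝ) M.T) => Narr t ω) (fun ω (t : Icc (0 : ℝ) M.T) => Nsrv t ω) P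
  indep_processes_U : IndepFun
    (fun ω => ((fun t : Icc (0 : ℝ) M.T => Narr t ω), (fun t : Icc (0 : ℝ) M.T => Nsrv t ω)))
    (fun ω i => U i ω) P

/-! ### Policies -/

/-- `pol t x a` is the probability of action `a` at time `t` in state `x`, for the actions
`0` (reject) and `1` (admit). -/
abbrev Policy := ℝ → ℕ → Fin 2 → ℝ

/-- The available actions in state `x`: a full system must reject. -/
def available (C x : ℕ) : Finset (Fin 2) := if x < C then Finset.univ else {0}

/-- Admissible randomized Markov policies. -/
structure IsAdmissible (M : Model) (pol : Policy) : Prop where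
  nonneg : ∀ t ∈ Icc 0 M.T, ∀ x ≤ M.C, ∀ a, 0 ≤ pol t x a
  sum_one : ∀ t ∈ Icc 0 M.T, ∀ x ≤ M.C, ∑ a, pol t x a = 1
  unavailable : ∀ t ∈ Icc 0 M.T, ∀ x ≤ M.C, ∀ a ∉ available M.C x, pol t x a = 0
  cont : ∀ x ≤ M.C, ∀ a, ContinuousOn (fun t => pol t x a) (Icc 0 M.T)

/-- Entropy of the action distribution; `Real.negMulLog p = -p * log p`, with value `0` at `0`. -/
def entropy (M : Model) (pol : Policy) (t : ℝ) (x : ℕ) : ℝ :=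
  ∑ a ∈ available M.C x, Real.negMulLog (pol t x a)

/-- A parametric family of admissible policies, smooth in the parameter `φ ∈ Φ`, whose
`φ`-gradient is continuous in time and whose second `φ`-derivative is bounded near every
parameter, uniformly in time. -/
structure IsSmoothFamily {d : ℕ} (M : Model) (Φ : Set (EuclideanSpace ℝ (Fin d)))
    (pol : EuclideanSpace ℝ (Fin d) → Policy) : Prop where
  admissible : ∀ φ ∈ Φ, IsAdmissible M (pol φ)
  smooth : ∀ t ∈ Icc 0 M.T, ∀ x ≤ M.C, ∀ a, ContDiffOn ℝ ((⊤ : ℕ∞) : WithTop ℕ∞) (fun φ => pol φ t x a) Φ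
  grad_cont : ∀ φ ∈ Φ, ∀ x ≤ M.C, ∀ a,
    ContinuousOn (fun t => gradient (fun ψ => pol ψ t x a) φ) (Icc 0 M.T)
  hess_bdd : ∀ φ₀ ∈ Φ, ∃ B : ℝ, ∀ᶠ φ in 𝓝 φ₀, ∀ t ∈ Icc 0 M.T, ∀ x ≤ M.C, ∀ a,
    ‖iteratedFDeriv ℝ 2 (fun ψ => pol ψ t x a) φ‖ ≤ B

/-! ### The controlled queue, path by path

Here `n` and `m` are paths of the arrival and of the service process and `u` is a sequence of
values of the uniform variables. The queue is started at time `s` with `x₀` customers. -/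

/-- Time of event number `k` (from `0`), an event being an arrival or a service completion. -/
def eventTime (n m : ℝ → ℕ) (k : ℕ) : ℝ := sInf {r | 0 ≤ r ∧ k < n r + m r}

/-- Effect of an event at time `r` on the pair (number of admissions, number of departures).
At an arrival, the action is sampled with the uniform variable of that customer, whose index is
the number of earlier arrivals; a service event removes a customer if there is one. -/
def step (pol : Policy) (n : ℝ → ℕ) (u : ℕ → ℝ) (x₀ : ℕ) (r : ℝ) (c : ℕ × ℕ) : ℕ × ℕ :=
  if Function.leftLim n r < n r then
    if u (Function.leftLim n r) < pol r (x₀ + c.1 - c.2) 1 then (c.1 + 1, c.2) else c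
  else if 0 < x₀ + c.1 - c.2 then (c.1, c.2 + 1) else c

/-- Numbers of admissions and departures after the `j` events number `k₀, …, k₀ + j - 1`. -/
def counts (pol : Policy) (n m : ℝ → ℕ) (u : ℕ → ℝ) (x₀ k₀ : ℕ) : ℕ → ℕ × ℕ
  | 0 => (0, 0)
  | j + 1 => step pol n u x₀ (eventTime n m (k₀ + j)) (counts pol n m u x₀ k₀ j)

/-- Number of customers admitted during `(s, t]`. -/
def admitted (pol : Policy) (n m : ℝ → ℕ) (u : ℕ → ℝ) (s : ℝ) (x₀ : ℕ) (t : ℝ) : ℕ :=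
  (counts pol n m u x₀ (n s + m s) (n t + m t - (n s + m s))).1

/-- Number of customers departed during `(s, t]`. -/
def departed (pol : Policy) (n m : ℝ → ℕ) (u : ℕ → ℝ) (s : ℝ) (x₀ : ℕ) (t : ℝ) : ℕ :=
  (counts pol n m u x₀ (n s + m s) (n t + m t - (n s + m s))).2

/-- Queue length at time `t`. -/
def queueLength (pol : Policy) (n m : ℝ → ℕ) (u : ℕ → ℝ) (s : ℝ) (x₀ : ℕ) (t : ℝ) : ℕ :=
  x₀ + admitted pol n m u s x₀ t - departed pol n m u s x₀ t

/-- The integral `∫_{(s,t]} f dA` against a counting path `A`. -/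
def jumpIntegral {E : Type*} [AddCommGroup E] [Module ℝ E] (f : ℝ → E) (A : ℝ → ℕ)
    (s t : ℝ) : E :=
  ∑ᶠ r ∈ Ioc s t, ((A r : ℝ) - ((Function.leftLim A r : ℕ) : ℝ)) • f r

/-- Entropy-regularized reward collected on `(s, T]` by the queue started at `(s, x₀)`. -/
def reward (M : Model) (pol : Policy) (n m : ℝ → ℕ) (u : ℕ → ℝ) (s : ℝ) (x₀ : ℕ) : ℝ :=
  M.K1 * ((admitted pol n m u s x₀ M.T : ℝ) - (admitted pol n m u s x₀ s : ℝ))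
    - M.K2 * (∫ r in s..M.T, ((Function.leftLim (queueLength pol n m u s x₀) r : ℕ) : ℝ))
    - M.K3 * (queueLength pol n m u s x₀ M.T : ℝ)
    + M.gam * (∫ r in s..M.T, entropy M pol r (Function.leftLim (queueLength pol n m u s x₀) r))

/-! ### Value function and the two terms of the policy gradient -/

/-- The value function `J(s, x; pol)`: expected reward of the queue in state `x` at time `s`. -/
def value {Ω : Type*} [MeasurableSpace Ω] (M : Model) (P : Measure Ω) (Narr Nsrv : ℝ → Ω → ℕ)
    (U : ℕ → Ω → ℝ) (pol : Policy) (s : ℝ) (x : ℕ) : ℝ :=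
  ∫ ω, reward M pol (fun t => Narr t ω) (fun t => Nsrv t ω) (fun i => U i ω) s x ∂P

/-- `∫_{(0,T]} ∇_φ log π^φ(1 | t, X_{t-}) [J(t, X_{t-} + 1) - J(t, X_{t-}) + K₁] dA_t`, along one
path of the queue started at time `0` with `c` customers, for a given function `J`. -/
def scoreIntegral {d : ℕ} (M : Model) (pol : EuclideanSpace ℝ (Fin d) → Policy)
    (φ : EuclideanSpace ℝ (Fin d)) (J : ℝ → ℕ → ℝ) (n m : ℝ → ℕ) (u : ℕ → ℝ) (c : ℕ) :
    EuclideanSpace ℝ (Fin d) :=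
  jumpIntegral
    (fun t =>
      (J t (Function.leftLim (queueLength (pol φ) n m u 0 c) t + 1)
          - J t (Function.leftLim (queueLength (pol φ) n m u 0 c) t) + M.K1) •
        gradient (fun ψ => Real.log
          (pol ψ t (Function.leftLim (queueLength (pol φ) n m u 0 c) t) 1)) φ)
    (admitted (pol φ) n m u 0 c) 0 M.T

/-- The integrand `∇_φ H(π^φ(· | t, X_{t-}))` along one path of the queue started at time `0`
with `c` customers. -/
def entropyGrad {d : ℕ} (M : Model) (pol : EuclideanSpace ℝ (Fin d) → Policy)
    (φ : EuclideanSpace ℝ (Fin d)) (n m : ℝ → ℕ) (u : ℕ → ℝ) (c : ℕ) (t : ℝ) :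
    EuclideanSpace ℝ (Fin d) :=
  gradient (fun ψ => entropy M (pol ψ) t
    (Function.leftLim (queueLength (pol φ) n m u 0 c) t)) φ

end

end QueueControl

/-!
The queue is a functional of two Poisson processes and of the decision variables, and nothing is
assumed about its law. The argument therefore first computes its law, and then differentiates the
value function as a functional of the admission probabilities.

*The law of the queue.* On a fine time grid, the probability that some cell contains two events, or
an arrival whose decision variable separates two admission probabilities of its cell, is small
(`IsPrimitives.tendsto_measureReal_not_goodGrid`). Off this event the queue agrees at the grid
points with an Euler scheme (`GoodGrid.queueLength_eq`), whose state at the left end of a cell is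
independent of the increments and of the decision variable used in that cell
(`IsPrimitives.measure_gridPast_inter`). Passing to the limit along a sequence of grids that
resolve almost every path gives the compensator of the admissions
(`IsPrimitives.integral_jumpIntegral`), the expectations of time integrals along the queue
(`IsPrimitives.integral_comp_leftLim`), and the forward equation of the transition probabilities
(`IsPrimitives.sum_stateProb_smul`). The Markov property is never used: the forward equations
determine the law.

*Performance difference.* The rates are only integrable in time, so the forward equations are
linear integral equations. Uniqueness and Fubini's theorem give a variation of constants formula
(`IsPropagator.variation_of_constants`), and with it the difference of the values of two policies
as a time integral along the law of the queue under the second policy, with the value function of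
the first one (`IsPrimitives.value_sub_value`).

*Differentiation.* The law of the queue is Lipschitz in the admission probabilities
(`IsPrimitives.abs_stateProb_sub_le_of_policy`), and so is the integrand of the difference formula
in the parameter, where it vanishes at the base point. Replacing the law by that at the base point
costs an error of second order, and what remains is differentiated under the integral
(`IsPrimitives.hasGradientAt_value`). Probabilities may vanish, where the entropy and the score
are singular: a function with values in `[0, 1]` and with bounded second derivative satisfies
`‖∇f‖ ≤ K √f` (`norm_fderiv_le_mul_sqrt`), which makes `-f log f` differentiable with a bounded
gradient.

*Back to paths.* The time integrals are turned into expectations along the paths. The score divides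
by the admission probability, which may be arbitrarily small; the rate of the admissions contains
the same factor, so that the quotient remains integrable
(`IsPrimitives.integral_jumpIntegral_inv_smul`). Almost surely every customer is admitted with a
positive probability (`IsPrimitives.ae_pol_pos_of_jump`), and hence below capacity.
-/

namespace QueueControl

/-! ### Counting paths and the queue along one path -/

/-- A path of a counting process on `[0, T]`. Nothing is required outside `[0, T]`. -/
structure IsCountingPath (T : ℝ) (n : ℝ → ℕ) : Prop where
  zero : n 0 = 0
  mono : MonotoneOn n (Icc 0 T)
  right_cont : ∀ t ∈ Ico 0 T, ContinuousWithinAt n (Ici t) t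

theorem leftLim_eq_of_forall_Ico {f : ℝ → ℕ} {a r : ℝ} {v : ℕ} (har : a < r)
    (h : ∀ r' ∈ Ico a r, f r' = v) : Function.leftLim f r = v := by
  apply leftLim_eq_of_tendsto
  refine tendsto_const_nhds.congr' ?_
  filter_upwards [Ico_mem_nhdsLT har] with r' hr' using (h r' hr').symm

/-- There are at most as many departures as customers, so that the subtraction of natural numbers in
the queue length is not truncated. -/
theorem counts_snd_le (pol : Policy) (n m : ℝ → ℕ) (u : ℕ → ℝ) (x₀ k₀ j : ℕ) :
    (counts pol n m u x₀ k₀ j).2 ≤ x₀ + (counts pol n m u x₀ k₀ j).1 := by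
  induction j with
  | zero => simp [counts]
  | succ j ih =>
    simp only [counts, step]
    split_ifs <;> omega

section Path

variable {T : ℝ} {n m : ℝ → ℕ} (hn : IsCountingPath T n) (hm : IsCountingPath T m)

include hn hm

/-- Both paths are constant on a time interval without events. -/
theorem IsCountingPath.eq_of_total_eq {a b : ℝ} (ha : 0 ≤ a) (hb : b ≤ T)
    (h : n a + m a = n b + m b) {r : ℝ} (hr : r ∈ Icc a b) : n r = n a ∧ m r = m a := by
  have haI : a ∈ Icc 0 T := ⟨ha, by linarith [hr.1, hr.2]⟩
  have hbI : b ∈ Icc 0 T := ⟨by linarith [hr.1, hr.2], hb⟩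
  have hrI : r ∈ Icc 0 T := ⟨by linarith [hr.1], by linarith [hr.2]⟩
  have h1 := hn.mono haI hrI hr.1
  have h2 := hm.mono haI hrI hr.1
  have h3 := hn.mono hrI hbI hr.2
  have h4 := hm.mono hrI hbI hr.2
  omega

/-- A time interval with exactly one event: the event time splits it into two intervals on which
both paths are constant. -/
theorem IsCountingPath.eventTime_of_total_eq_succ {a b : ℝ} (ha : 0 ≤ a) (hab : a ≤ b)
    (hb : b ≤ T) (h : n b + m b = n a + m a + 1) :
    eventTime n m (n a + m a) ∈ Ioc a b ∧
    (∀ r ∈ Ico a (eventTime n m (n a + m a)), n r = n a ∧ m r = m a) ∧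
    (∀ r ∈ Icc (eventTime n m (n a + m a)) b, n r = n b ∧ m r = m b) := by
  set τ := eventTime n m (n a + m a) with hτ
  set S : Set ℝ := {r | 0 ≤ r ∧ n a + m a < n r + m r} with hS
  have hτS : τ = sInf S := rfl
  have haI : a ∈ Icc 0 T := ⟨ha, hab.trans hb⟩
  have hbI : b ∈ Icc 0 T := ⟨ha.trans hab, hb⟩
  have hbdd : BddBelow S := ⟨0, fun r hr => hr.1⟩
  have hbS : b ∈ S := ⟨hbI.1, by omega⟩
  have haS : ∀ r ∈ S, a ≤ r := by
    intro r hr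
    by_contra! hlt
    have hrI : r ∈ Icc 0 T := ⟨hr.1, by linarith [haI.2]⟩
    have h1 := hn.mono hrI haI hlt.le
    have h2 := hm.mono hrI haI hlt.le
    have := hr.2
    omega
  have hτa : a ≤ τ := le_csInf ⟨b, hbS⟩ haS
  have hτb : τ ≤ b := csInf_le hbdd hbS
  have hτI : τ ∈ Icc 0 T := ⟨ha.trans hτa, hτb.trans hb⟩
  have hbefore : ∀ r ∈ Ico a τ, n r = n a ∧ m r = m a := by
    intro r hr
    have hrI : r ∈ Icc 0 T := ⟨ha.trans hr.1, by linarith [hτI.2, hr.2]⟩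
    have h1 := hn.mono haI hrI hr.1
    have h2 := hm.mono haI hrI hr.1
    have h3 : ¬ (n a + m a < n r + m r) := fun hlt =>
      absurd (csInf_le hbdd (show r ∈ S from ⟨hrI.1, hlt⟩)) (not_le.2 hr.2)
    omega
  have hatτ : n a + m a < n τ + m τ := by
    rcases hτb.eq_or_lt with hEq | hlt
    · rw [hEq]; omega
    · have hτ' : τ ∈ Ico 0 T := ⟨hτI.1, hlt.trans_le hb⟩
      have e1 : ∀ᶠ r in 𝓝[≥] τ, n r = n τ :=
        (hn.right_cont τ hτ').tendsto (by simp [nhds_discrete] : {n τ} ∈ 𝓝 (n τ))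
      have e2 : ∀ᶠ r in 𝓝[≥] τ, m r = m τ :=
        (hm.right_cont τ hτ').tendsto (by simp [nhds_discrete] : {m τ} ∈ 𝓝 (m τ))
      obtain ⟨c, hc, hcsub⟩ := (mem_nhdsGE_iff_exists_Ico_subset' hlt).1 (e1.and e2)
      obtain ⟨r, hrS, hrc⟩ := exists_lt_of_csInf_lt ⟨b, hbS⟩ (show sInf S < c from hc)
      have := hcsub ⟨csInf_le hbdd hrS, hrc⟩
      have h2 := hrS.2
      simp only [mem_ofPred_eq] at this
      omega
  have hne : a ≠ τ := by
    intro hEq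
    rw [← hEq] at hatτ
    omega
  refine ⟨⟨lt_of_le_of_ne hτa hne, hτb⟩, hbefore, fun r hr => ?_⟩
  have hrI : r ∈ Icc 0 T := ⟨hτI.1.trans hr.1, hr.2.trans hb⟩
  have h1 := hn.mono haI hτI hτa
  have h2 := hm.mono haI hτI hτa
  have h3 := hn.mono hτI hrI hr.1
  have h4 := hm.mono hτI hrI hr.1
  have h5 := hn.mono hrI hbI hr.2
  have h6 := hm.mono hrI hbI hr.2
  omega

variable (pol : Policy) (u : ℕ → ℝ) {s a b : ℝ} (x₀ : ℕ)

omit hn hm in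
theorem queueLength_self : queueLength pol n m u s x₀ s = x₀ ∧
    admitted pol n m u s x₀ s = 0 := by
  simp [queueLength, admitted, departed, counts]

omit hn hm in
/-- The counts depend on the starting time and on the current time only through the numbers of
events up to them. -/
theorem queueLength_congr {s s' t t' : ℝ} (hs : n s + m s = n s' + m s')
    (ht : n t + m t = n t' + m t') :
    queueLength pol n m u s x₀ t = queueLength pol n m u s' x₀ t' := by
  simp [queueLength, admitted, departed, hs, ht]

omit hn hm in
theorem admitted_congr {s s' t t' : ℝ} (hs : n s + m s = n s' + m s')
    (ht : n t + m t = n t' + m t') :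
    admitted pol n m u s x₀ t = admitted pol n m u s' x₀ t' := by
  simp [admitted, hs, ht]

/-- The effect of a single event on the queue length and the number of admissions. -/
theorem IsCountingPath.queueLength_succ (hs : 0 ≤ s) (hsa : s ≤ a) (hab : a ≤ b) (hb : b ≤ T)
    (h : n b + m b = n a + m a + 1) :
    (queueLength pol n m u s x₀ b, admitted pol n m u s x₀ b) =
      if n a < n b then
        if u (n a) < pol (eventTime n m (n a + m a)) (queueLength pol n m u s x₀ a) 1 then
          (queueLength pol n m u s x₀ a + 1, admitted pol n m u s x₀ a + 1)
        else (queueLength pol n m u s x₀ a, admitted pol n m u s x₀ a)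
      else (queueLength pol n m u s x₀ a - 1, admitted pol n m u s x₀ a) := by
  obtain ⟨hτ, hbef, haft⟩ := hn.eventTime_of_total_eq_succ hm (hs.trans hsa) hab hb h
  set τ := eventTime n m (n a + m a) with hτdef
  have hsI : s ∈ Icc 0 T := ⟨hs, by linarith⟩
  have haI : a ∈ Icc 0 T := ⟨hs.trans hsa, by linarith⟩
  have h1 := hn.mono hsI haI hsa
  have h2 := hm.mono hsI haI hsa
  have hj : n b + m b - (n s + m s) = (n a + m a - (n s + m s)) + 1 := by omega
  have hk : n s + m s + (n a + m a - (n s + m s)) = n a + m a := by omega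
  have hl : Function.leftLim n τ = n a :=
    leftLim_eq_of_forall_Ico hτ.1 fun r hr => (hbef r hr).1
  have hr : n τ = n b := (haft τ ⟨le_rfl, hτ.2⟩).1
  have hle := counts_snd_le pol n m u x₀ (n s + m s) (n a + m a - (n s + m s))
  simp only [queueLength, admitted, departed, hj, counts, hk, step, ← hτdef, hl, hr]
  by_cases c1 : n a < n b
  · by_cases c2 : u (n a) < pol τ (x₀ + (counts pol n m u x₀ (n s + m s)
        (n a + m a - (n s + m s))).1 - (counts pol n m u x₀ (n s + m s)
        (n a + m a - (n s + m s))).2) 1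
    · simp only [c1, c2, if_true, Prod.mk.injEq, and_true]
      omega
    · simp [c1, c2]
  · by_cases c2 : 0 < x₀ + (counts pol n m u x₀ (n s + m s)
        (n a + m a - (n s + m s))).1 - (counts pol n m u x₀ (n s + m s)
        (n a + m a - (n s + m s))).2
    · simp only [c1, c2, if_true, if_false, Prod.mk.injEq, and_true]
      omega
    · simp only [c1, c2, if_false, Prod.mk.injEq, and_true]
      omega

omit hn hm in
/-- Left limits of the queue length and of the number of admissions at a time `r` before which
both counting paths are constant. -/
theorem leftLim_queueLength_of_forall_Ico {r : ℝ} (har : a < r)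
    (h : ∀ r' ∈ Ico a r, n r' = n a ∧ m r' = m a) :
    Function.leftLim (queueLength pol n m u s x₀) r = queueLength pol n m u s x₀ a ∧
    Function.leftLim (admitted pol n m u s x₀) r = admitted pol n m u s x₀ a := by
  constructor <;> refine leftLim_eq_of_forall_Ico har fun r' hr' => ?_
  · exact queueLength_congr pol u x₀ rfl (by rw [(h r' hr').1, (h r' hr').2])
  · exact admitted_congr pol u x₀ rfl (by rw [(h r' hr').1, (h r' hr').2])

end Path

/-! ### The queue observed on a time grid -/

/-- Euler scheme for the queue: at each step, an arrival is admitted according to the policy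
frozen at the left end of the cell, and a service completion is taken into account if there is no
arrival. Here `n i`, `m i` are the values of the counting paths at the grid point `t i`. -/
noncomputable def gridChain (pol : Policy) (n m : ℕ → ℕ) (u : ℕ → ℝ) (t : ℕ → ℝ) (x₀ : ℕ) : ℕ → ℕ
  | 0 => x₀
  | i + 1 =>
    if n i < n (i + 1) then
      if u (n i) < pol (t i) (gridChain pol n m u t x₀ i) 1 then gridChain pol n m u t x₀ i + 1
      else gridChain pol n m u t x₀ i
    else if m i < m (i + 1) then gridChain pol n m u t x₀ i - 1
    else gridChain pol n m u t x₀ i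

/-- The Euler scheme driven by two counting paths sampled on the grid. -/
noncomputable abbrev gridQueue (pol : Policy) (n m : ℝ → ℕ) (u : ℕ → ℝ) (t : ℕ → ℝ) (x₀ i : ℕ) :
    ℕ :=
  gridChain pol (fun j => n (t j)) (fun j => m (t j)) u t x₀ i

/-- The acceptance indicator of the cell number `i` of the Euler scheme, if it has an arrival. -/
noncomputable def gridAccept (pol : Policy) (n m : ℝ → ℕ) (u : ℕ → ℝ) (t : ℕ → ℝ) (x₀ i : ℕ) : ℝ :=
  (Iio (pol (t i) (gridQueue pol n m u t x₀ i) 1)).indicator 1 (u (n (t i)))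

/-- The grid resolves the events: each of the first `k` cells has at most one event, and the
decision about an arrival is the same for all times of its cell. -/
def GoodGrid (pol : Policy) (C : ℕ) (n m : ℝ → ℕ) (u : ℕ → ℝ) (t : ℕ → ℝ) (k : ℕ) : Prop :=
  ∀ i < k, n (t (i + 1)) + m (t (i + 1)) ≤ n (t i) + m (t i) + 1 ∧
    (n (t i) < n (t (i + 1)) → ∀ x ≤ C, ∀ r ∈ Icc (t i) (t (i + 1)),
      (u (n (t i)) < pol r x 1 ↔ u (n (t i)) < pol (t i) x 1))

/-- The Euler scheme depends only on the past of the driving paths, and on the decision variables of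
the customers that have arrived. -/
theorem gridChain_congr (pol : Policy) {n n' m m' : ℕ → ℕ} {u u' : ℕ → ℝ} (t : ℕ → ℝ) (x₀ : ℕ)
    {i : ℕ} (hn : ∀ j ≤ i, n j = n' j) (hm : ∀ j ≤ i, m j = m' j)
    (hu : ∀ j < i, n j < n (j + 1) → u (n j) = u' (n j)) :
    gridChain pol n m u t x₀ i = gridChain pol n' m' u' t x₀ i := by
  induction i with
  | zero => rfl
  | succ i ih =>
    have ih' := ih (fun j hj => hn j (by omega)) (fun j hj => hm j (by omega))
      (fun j hj => hu j (by omega))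
    simp only [gridChain, ih', ← hn i (by omega), ← hn (i + 1) le_rfl, ← hm i (by omega),
      ← hm (i + 1) le_rfl]
    by_cases h : n i < n (i + 1)
    · simp [h, hu i (by omega) h]
    · simp [h]

/-- The Euler scheme stays below the capacity, since a full system rejects. -/
theorem gridChain_le {pol : Policy} {n m : ℕ → ℕ} {u : ℕ → ℝ} {t : ℕ → ℝ} {x₀ C : ℕ}
    (hx : x₀ ≤ C) (hu : ∀ i, 0 ≤ u i) {i : ℕ} (hpol : ∀ j < i, pol (t j) C 1 = 0) :
    gridChain pol n m u t x₀ i ≤ C := by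
  induction i with
  | zero => exact hx
  | succ i ih =>
    have ih' := ih fun j hj => hpol j (by omega)
    simp only [gridChain]
    split_ifs with h1 h2 h3
    · rcases ih'.eq_or_lt with h | h
      · rw [h, hpol i (by omega)] at h2
        exact absurd h2 (not_lt.2 (hu _))
      · exact h
    all_goals omega

section Good

variable {T : ℝ} {C : ℕ} {n m : ℝ → ℕ} {pol : Policy} {u : ℕ → ℝ} {t : ℕ → ℝ} {x₀ k : ℕ}

/-- A function of the queue changes along a good grid by its increments at admissions and
services. -/
theorem GoodGrid.map_gridQueue_sub {E : Type*} [AddCommGroup E] [Module ℝ E]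
    (hg : GoodGrid pol C n m u t k) (hnt : Monotone fun j => n (t j))
    (hmt : Monotone fun j => m (t j)) (f : ℕ → E) {i : ℕ} (hi : i ≤ k) :
    f (gridQueue pol n m u t x₀ i) - f x₀ = ∑ j ∈ Finset.range i,
      ((((n (t (j + 1)) : ℝ) - n (t j)) * gridAccept pol n m u t x₀ j) •
        (f (gridQueue pol n m u t x₀ j + 1) - f (gridQueue pol n m u t x₀ j)) +
      ((m (t (j + 1)) : ℝ) - m (t j)) •
        (f (gridQueue pol n m u t x₀ j - 1) - f (gridQueue pol n m u t x₀ j))) := by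
  induction i with
  | zero => simp [gridQueue, gridChain]
  | succ i ih =>
    rw [Finset.sum_range_succ, ← ih (by omega)]
    have hc := (hg i (by omega)).1
    have h1 : n (t i) ≤ n (t (i + 1)) := hnt (Nat.le_add_right i 1)
    have h2 : m (t i) ≤ m (t (i + 1)) := hmt (Nat.le_add_right i 1)
    have : gridQueue pol n m u t x₀ (i + 1) = if n (t i) < n (t (i + 1)) then
        if u (n (t i)) < pol (t i) (gridQueue pol n m u t x₀ i) 1
          then gridQueue pol n m u t x₀ i + 1 else gridQueue pol n m u t x₀ i
        else if m (t i) < m (t (i + 1)) then gridQueue pol n m u t x₀ i - 1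
        else gridQueue pol n m u t x₀ i := by
      simp only [gridQueue, gridChain]
    rw [this, gridAccept]
    split_ifs with c1 c2 c3
    · have e1 : n (t (i + 1)) = n (t i) + 1 := by omega
      have e2 : m (t (i + 1)) = m (t i) := by omega
      simp [e1, e2, c2]
    · have e1 : n (t (i + 1)) = n (t i) + 1 := by omega
      have e2 : m (t (i + 1)) = m (t i) := by omega
      simp [e1, e2, c2]
    · have e1 : n (t (i + 1)) = n (t i) := by omega
      have e2 : m (t (i + 1)) = m (t i) + 1 := by omega
      simp [e1, e2]
    · have e1 : n (t (i + 1)) = n (t i) := by omega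
      have e2 : m (t (i + 1)) = m (t i) := by omega
      simp [e1, e2]

variable (hn : IsCountingPath T n) (hm : IsCountingPath T m) (ht : Monotone t)
  (ht0 : 0 ≤ t 0) (htT : ∀ i, t i ≤ T) (hg : GoodGrid pol C n m u t k)
  (hle : ∀ i ≤ k, gridQueue pol n m u t x₀ i ≤ C)

include hn hm ht ht0 htT hg hle

/-- On a good grid the Euler scheme is exact, for the queue and for the number of admissions. -/
theorem GoodGrid.queueLength_eq {i : ℕ} (hi : i ≤ k) :
    queueLength pol n m u (t 0) x₀ (t i) = gridQueue pol n m u t x₀ i ∧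
    (admitted pol n m u (t 0) x₀ (t i) : ℝ) = ∑ j ∈ Finset.range i,
      ((n (t (j + 1)) : ℝ) - n (t j)) * gridAccept pol n m u t x₀ j := by
  have htI : ∀ i, t i ∈ Icc 0 T := fun i => ⟨ht0.trans (ht (Nat.zero_le i)), htT i⟩
  induction i with
  | zero => simp [queueLength_self, gridQueue, gridChain]
  | succ i ih =>
    obtain ⟨ihq, iha⟩ := ih (by omega)
    obtain ⟨hc, hacc⟩ := hg i (by omega)
    have h1 : n (t i) ≤ n (t (i + 1)) := hn.mono (htI i) (htI _) (ht (Nat.le_add_right i 1))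
    have h2 : m (t i) ≤ m (t (i + 1)) := hm.mono (htI i) (htI _) (ht (Nat.le_add_right i 1))
    rw [Finset.sum_range_succ, ← iha]
    have hchain : gridQueue pol n m u t x₀ (i + 1) = if n (t i) < n (t (i + 1)) then
        if u (n (t i)) < pol (t i) (gridQueue pol n m u t x₀ i) 1
          then gridQueue pol n m u t x₀ i + 1 else gridQueue pol n m u t x₀ i
        else if m (t i) < m (t (i + 1)) then gridQueue pol n m u t x₀ i - 1
        else gridQueue pol n m u t x₀ i := by
      simp only [gridQueue, gridChain]
    rcases (show n (t (i + 1)) + m (t (i + 1)) = n (t i) + m (t i) ∨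
        n (t (i + 1)) + m (t (i + 1)) = n (t i) + m (t i) + 1 by omega) with h0 | h0
    · rw [queueLength_congr pol u x₀ rfl h0, admitted_congr pol u x₀ rfl h0, hchain, ihq]
      have e1 : n (t (i + 1)) = n (t i) := by omega
      have e2 : m (t (i + 1)) = m (t i) := by omega
      simp [e1, e2]
    · have hs := hn.queueLength_succ hm pol u x₀ ht0 (ht (Nat.zero_le i))
        (ht (Nat.le_add_right i 1)) (htT _) h0
      have hτ :=
        (hn.eventTime_of_total_eq_succ hm (htI i).1 (ht (Nat.le_add_right i 1)) (htT _) h0).1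
      obtain ⟨hs1, hs2⟩ := Prod.ext_iff.1 hs
      simp only at hs1 hs2
      rw [hs1, hs2, hchain, ihq, gridAccept]
      by_cases c1 : n (t i) < n (t (i + 1))
      · have e1 : n (t (i + 1)) = n (t i) + 1 := by omega
        have := hacc c1 _ (hle i (by omega)) _ ⟨hτ.1.le, hτ.2⟩
        by_cases c2 : u (n (t i)) < pol (t i) (gridQueue pol n m u t x₀ i) 1
        · simp [e1, c2, this]
        · simp [e1, c2, this]
      · have e1 : n (t (i + 1)) = n (t i) := by omega
        have e2 : m (t i) < m (t (i + 1)) := by omega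
        simp [e1, e2]

/-- The left limits of the queue on a cell of a good grid. -/
theorem GoodGrid.leftLim_queueLength {i : ℕ} (hi : i < k) :
    ∃ τ ∈ Icc (t i) (t (i + 1)),
      (∀ r ∈ Ioc (t i) τ, Function.leftLim (queueLength pol n m u (t 0) x₀) r
        = gridQueue pol n m u t x₀ i) ∧
      (∀ r ∈ Ioc τ (t (i + 1)), Function.leftLim (queueLength pol n m u (t 0) x₀) r
        = gridQueue pol n m u t x₀ (i + 1)) ∧
      (n (t (i + 1)) + m (t (i + 1)) = n (t i) + m (t i) → τ = t (i + 1)) := by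
  have htI : ∀ i, t i ∈ Icc 0 T := fun i => ⟨ht0.trans (ht (Nat.zero_le i)), htT i⟩
  have hq := (hg.queueLength_eq hn hm ht ht0 htT hle hi.le).1
  have hq' := (hg.queueLength_eq hn hm ht ht0 htT hle (Nat.succ_le_of_lt hi)).1
  have h1 : n (t i) ≤ n (t (i + 1)) := hn.mono (htI i) (htI _) (ht (Nat.le_add_right i 1))
  have h2 : m (t i) ≤ m (t (i + 1)) := hm.mono (htI i) (htI _) (ht (Nat.le_add_right i 1))
  obtain ⟨hc, -⟩ := hg i hi
  rcases (show n (t (i + 1)) + m (t (i + 1)) = n (t i) + m (t i) ∨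
        n (t (i + 1)) + m (t (i + 1)) = n (t i) + m (t i) + 1 by omega) with h0 | h0
  · refine ⟨t (i + 1), ⟨ht (Nat.le_add_right i 1), le_rfl⟩, fun r hr => ?_, by simp, fun _ => rfl⟩
    have hcst : ∀ r' ∈ Ico (t i) r, n r' = n (t i) ∧ m r' = m (t i) := fun r' hr' =>
      hn.eq_of_total_eq hm (htI i).1 (htT (i + 1)) h0.symm ⟨hr'.1, hr'.2.le.trans hr.2⟩
    rw [← hq]
    exact (leftLim_queueLength_of_forall_Ico pol u x₀ hr.1 hcst).1
  · obtain ⟨hτ, hbef, haft⟩ := hn.eventTime_of_total_eq_succ hm (htI i).1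
      (ht (Nat.le_add_right i 1)) (htT _) h0
    refine ⟨_, ⟨hτ.1.le, hτ.2⟩, fun r hr => ?_, fun r hr => ?_, fun h => by omega⟩
    · rw [← hq]
      exact (leftLim_queueLength_of_forall_Ico (a := t i) pol u x₀ hr.1 fun r' hr' =>
        hbef r' ⟨hr'.1, hr'.2.trans_le hr.2⟩).1
    · have hτ1 := haft _ ⟨le_rfl, hτ.2⟩
      rw [← hq', ← queueLength_congr pol u x₀ rfl (congrArg₂ (· + ·) hτ1.1 hτ1.2)]
      refine (leftLim_queueLength_of_forall_Ico pol u x₀ hr.1 fun r' hr' => ?_).1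
      have := haft r' ⟨hr'.1, hr'.2.le.trans hr.2⟩
      exact ⟨this.1.trans hτ1.1.symm, this.2.trans hτ1.2.symm⟩

/-- The jumps of the admission process on a cell of a good grid. An integrand given by the left
limit of the queue is evaluated at the only event of the cell. -/
theorem GoodGrid.jump_admitted {i : ℕ} (hi : i < k) :
    ∃ τ ∈ Icc (t i) (t (i + 1)),
      (n (t i) < n (t (i + 1)) →
        τ ∈ Ioc (t i) (t (i + 1)) ∧
        Function.leftLim (queueLength pol n m u (t 0) x₀) τ = gridQueue pol n m u t x₀ i) ∧
      (∀ r ∈ Ioc (t i) (t (i + 1)), r ≠ τ →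
        ((admitted pol n m u (t 0) x₀ r : ℝ)
          - (Function.leftLim (admitted pol n m u (t 0) x₀) r : ℕ)) = 0) ∧
      (τ ∈ Ioc (t i) (t (i + 1)) → (admitted pol n m u (t 0) x₀ τ : ℝ)
        - (Function.leftLim (admitted pol n m u (t 0) x₀) τ : ℕ)
        = ((n (t (i + 1)) : ℝ) - n (t i)) * gridAccept pol n m u t x₀ i) := by
  have htI : ∀ i, t i ∈ Icc 0 T := fun i => ⟨ht0.trans (ht (Nat.zero_le i)), htT i⟩
  obtain ⟨hq, haq⟩ := hg.queueLength_eq hn hm ht ht0 htT hle hi.le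
  have hq' := (hg.queueLength_eq hn hm ht ht0 htT hle (Nat.succ_le_of_lt hi)).2
  rw [Finset.sum_range_succ, ← haq] at hq'
  have h1 : n (t i) ≤ n (t (i + 1)) := hn.mono (htI i) (htI _) (ht (Nat.le_add_right i 1))
  have h2 : m (t i) ≤ m (t (i + 1)) := hm.mono (htI i) (htI _) (ht (Nat.le_add_right i 1))
  obtain ⟨hc, -⟩ := hg i hi
  rcases (show n (t (i + 1)) + m (t (i + 1)) = n (t i) + m (t i) ∨
        n (t (i + 1)) + m (t (i + 1)) = n (t i) + m (t i) + 1 by omega) with h0 | h0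
  · have key : ∀ r ∈ Ioc (t i) (t (i + 1)), ((admitted pol n m u (t 0) x₀ r : ℝ)
          - (Function.leftLim (admitted pol n m u (t 0) x₀) r : ℕ)) = 0 := by
      intro r hr
      have hcst : ∀ r' ∈ Icc (t i) (t (i + 1)), n r' = n (t i) ∧ m r' = m (t i) := fun r' hr' =>
        hn.eq_of_total_eq hm (htI i).1 (htT (i + 1)) h0.symm hr'
      rw [(leftLim_queueLength_of_forall_Ico pol u x₀ hr.1 fun r' hr' =>
        hcst r' ⟨hr'.1, hr'.2.le.trans hr.2⟩).2,
        admitted_congr pol u x₀ rfl (congrArg₂ (· + ·) (hcst r ⟨hr.1.le, hr.2⟩).1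
          (hcst r ⟨hr.1.le, hr.2⟩).2)]
      simp
    refine ⟨t i, ⟨le_rfl, ht (Nat.le_add_right i 1)⟩, fun h => by omega, fun r hr _ => key r hr,
      fun h => by simp at h⟩
  · obtain ⟨hτ, hbef, haft⟩ := hn.eventTime_of_total_eq_succ hm (htI i).1
      (ht (Nat.le_add_right i 1)) (htT _) h0
    have hτ1 := haft _ ⟨le_rfl, hτ.2⟩
    have hlim := leftLim_queueLength_of_forall_Ico pol u (s := t 0) x₀ hτ.1 hbef
    refine ⟨_, ⟨hτ.1.le, hτ.2⟩, fun _ => ⟨hτ, by rw [hlim.1, hq]⟩, fun r hr hne => ?_, fun _ => ?_⟩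
    · rcases lt_or_gt_of_ne hne with hlt | hgt
      · rw [(leftLim_queueLength_of_forall_Ico pol u x₀ hr.1 fun r' hr' =>
          hbef r' ⟨hr'.1, hr'.2.trans hlt⟩).2,
          admitted_congr pol u x₀ rfl (congrArg₂ (· + ·) (hbef r ⟨hr.1.le, hlt⟩).1
            (hbef r ⟨hr.1.le, hlt⟩).2)]
        simp
      · rw [(leftLim_queueLength_of_forall_Ico pol u x₀ hgt fun r' hr' => by
          have := haft r' ⟨hr'.1, hr'.2.le.trans hr.2⟩
          exact ⟨this.1.trans hτ1.1.symm, this.2.trans hτ1.2.symm⟩).2,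
          admitted_congr pol u x₀ rfl (congrArg₂ (· + ·)
            ((haft r ⟨hgt.le, hr.2⟩).1.trans hτ1.1.symm)
            ((haft r ⟨hgt.le, hr.2⟩).2.trans hτ1.2.symm))]
        simp
    · rw [hlim.2, admitted_congr pol u x₀ rfl (congrArg₂ (· + ·) hτ1.1 hτ1.2), hq']
      ring

/-- An integral against the admission process is a finite sum over the cells of a good grid. -/
theorem GoodGrid.jumpIntegral_eq : ∃ τ : ℕ → ℝ, (∀ i < k, τ i ∈ Icc (t i) (t (i + 1)) ∧
      (n (t i) < n (t (i + 1)) → τ i ∈ Ioc (t i) (t (i + 1)) ∧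
        Function.leftLim (queueLength pol n m u (t 0) x₀) (τ i) = gridQueue pol n m u t x₀ i) ∧
      (∀ r ∈ Ioc (t i) (t (i + 1)),
        ((admitted pol n m u (t 0) x₀ r : ℝ)
          - (Function.leftLim (admitted pol n m u (t 0) x₀) r : ℕ)) ≠ 0 →
          r = τ i ∧ n (t i) < n (t (i + 1)) ∧
            u (n (t i)) < pol (t i) (gridQueue pol n m u t x₀ i) 1)) ∧
    ∀ {E : Type*} [AddCommGroup E] [Module ℝ E] (f : ℝ → E),
      jumpIntegral f (admitted pol n m u (t 0) x₀) (t 0) (t k) =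
        ∑ i ∈ Finset.range k,
          (((n (t (i + 1)) : ℝ) - n (t i)) * gridAccept pol n m u t x₀ i) • f (τ i) := by
  choose! τ hτmem hτ hne hval using
    fun i (hi : i < k) => hg.jump_admitted hn hm ht ht0 htT hle hi
  refine ⟨τ, fun i hi => ⟨hτmem i hi, hτ i hi, fun r hr hr0 => ?_⟩, fun {E} _ _ f => ?_⟩
  · have hrτ : r = τ i := by
      by_contra h
      exact hr0 (hne i hi r hr h)
    subst hrτ
    rw [hval i hi hr] at hr0
    have h1 := left_ne_zero_of_mul hr0
    have h2 := right_ne_zero_of_mul hr0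
    refine ⟨rfl, ?_, ?_⟩
    · have : n (t i) ≤ n (t (i + 1)) :=
        hn.mono ⟨ht0.trans (ht (Nat.zero_le i)), htT _⟩ ⟨ht0.trans (ht (Nat.zero_le _)), htT _⟩
          (ht (Nat.le_add_right i 1))
      refine lt_of_le_of_ne this fun h => h1 ?_
      rw [h, sub_self]
    · by_contra h
      exact h2 (by simp [gridAccept, not_lt.1 h])
  · set g : ℝ → E := fun r => ((admitted pol n m u (t 0) x₀ r : ℝ)
          - (Function.leftLim (admitted pol n m u (t 0) x₀) r : ℕ)) • f r with hgdef
    have hsupp : ∀ i < k, Ioc (t i) (t (i + 1)) ∩ Function.support g ⊆ {τ i} := by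
      rintro i hi r ⟨hr, hr0⟩
      by_contra h
      exact hr0 (by simp [hgdef, hne i hi r hr h])
    have hcell : ∀ i < k, ∑ᶠ r ∈ Ioc (t i) (t (i + 1)), g r =
        (((n (t (i + 1)) : ℝ) - n (t i)) * gridAccept pol n m u t x₀ i) • f (τ i) := by
      intro i hi
      rw [finsum_eq_single _ (τ i)]
      · by_cases hmem : τ i ∈ Ioc (t i) (t (i + 1))
        · rw [finsum_eq_if, if_pos hmem]
          simp only [hgdef, hval i hi hmem]
        · have h0 : n (t (i + 1)) = n (t i) := by
            have h1 : ¬ n (t i) < n (t (i + 1)) := fun h => hmem (hτ i hi h).1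
            have : n (t i) ≤ n (t (i + 1)) :=
              hn.mono ⟨ht0.trans (ht (Nat.zero_le i)), htT _⟩
                ⟨ht0.trans (ht (Nat.zero_le _)), htT _⟩ (ht (Nat.le_add_right i 1))
            omega
          rw [finsum_eq_if, if_neg hmem, h0]
          simp
      · intro r hr
        by_cases hmem : r ∈ Ioc (t i) (t (i + 1))
        · rw [finsum_eq_if, if_pos hmem]
          simp only [hgdef, hne i hi r hmem hr, zero_smul]
        · rw [finsum_eq_if, if_neg hmem]
    have main : ∀ i ≤ k, (Ioc (t 0) (t i) ∩ Function.support g).Finite ∧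
        ∑ᶠ r ∈ Ioc (t 0) (t i), g r = ∑ j ∈ Finset.range i,
          (((n (t (j + 1)) : ℝ) - n (t j)) * gridAccept pol n m u t x₀ j) • f (τ j) := by
      intro i
      induction i with
      | zero => intro _; simp
      | succ i ih =>
        intro hi
        obtain ⟨hfin, hsum⟩ := ih (by omega)
        have hfin' := (finite_singleton (τ i)).subset (hsupp i hi)
        rw [← Ioc_union_Ioc_eq_Ioc (ht (Nat.zero_le i)) (ht (Nat.le_add_right i 1)),
          union_inter_distrib_right]
        refine ⟨hfin.union hfin', ?_⟩
        rw [finsum_mem_union' (Ioc_disjoint_Ioc_of_le le_rfl) hfin hfin', hsum, hcell i hi,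
          Finset.sum_range_succ]
    exact (main k le_rfl).2

end Good

/-! ### Independence of the past and of the next cell -/

theorem comap_prod_eq_generateFrom {Ω γ δ : Type*} [MeasurableSpace γ] [MeasurableSpace δ]
    (Z : Ω → γ × δ) : MeasurableSpace.comap Z inferInstance = MeasurableSpace.generateFrom
      (preimage Z '' image2 (· ×ˢ ·) {s | MeasurableSet s} {t | MeasurableSet t}) := by
  rw [← MeasurableSpace.comap_generateFrom, generateFrom_prod]

theorem isPiSystem_comap_prod {Ω γ δ : Type*} [MeasurableSpace γ] [MeasurableSpace δ]
    (Z : Ω → γ × δ) :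
    IsPiSystem (preimage Z '' image2 (· ×ˢ ·) {s | MeasurableSet s} {t | MeasurableSet t}) :=
  isPiSystem_prod.comap Z

/-- Two independent pairs, each with independent components, can be regrouped. -/
theorem indepFun_prodMk_swap {Ω α α' β β' : Type*} [MeasurableSpace Ω] [MeasurableSpace α]
    [MeasurableSpace α'] [MeasurableSpace β] [MeasurableSpace β'] {P : Measure Ω}
    [IsProbabilityMeasure P] {X : Ω → α} {X' : Ω → α'} {Y : Ω → β} {Y' : Ω → β'}
    (hX : Measurable X) (hX' : Measurable X') (hY : Measurable Y) (hY' : Measurable Y')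
    (h1 : IndepFun X X' P) (h2 : IndepFun Y Y' P)
    (h : IndepFun (fun ω => (X ω, X' ω)) (fun ω => (Y ω, Y' ω)) P) :
    IndepFun (fun ω => (X ω, Y ω)) (fun ω => (X' ω, Y' ω)) P := by
  have key : ∀ A A' B B', MeasurableSet A → MeasurableSet A' → MeasurableSet B →
      MeasurableSet B' → P ((X ⁻¹' A ∩ X' ⁻¹' A') ∩ (Y ⁻¹' B ∩ Y' ⁻¹' B')) =
        P (X ⁻¹' A) * P (X' ⁻¹' A') * (P (Y ⁻¹' B) * P (Y' ⁻¹' B')) := by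
    intro A A' B B' hA hA' hB hB'
    rw [← h1.measure_inter_preimage_eq_mul _ _ hA hA',
      ← h2.measure_inter_preimage_eq_mul _ _ hB hB']
    exact h.measure_inter_preimage_eq_mul (A ×ˢ A') (B ×ˢ B') (hA.prod hA') (hB.prod hB')
  have hkey2 : ∀ A B, MeasurableSet A → MeasurableSet B →
      P (X ⁻¹' A ∩ Y ⁻¹' B) = P (X ⁻¹' A) * P (Y ⁻¹' B) := by
    intro A B hA hB
    simpa using key A univ B univ hA .univ hB .univ
  have hkey3 : ∀ A B, MeasurableSet A → MeasurableSet B →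
      P (X' ⁻¹' A ∩ Y' ⁻¹' B) = P (X' ⁻¹' A) * P (Y' ⁻¹' B) := by
    intro A B hA hB
    simpa using key univ A univ B .univ hA .univ hB
  refine IndepSets.indep (hX.prodMk hY).comap_le (hX'.prodMk hY').comap_le (isPiSystem_comap_prod _)
    (isPiSystem_comap_prod _) (comap_prod_eq_generateFrom _) (comap_prod_eq_generateFrom _) ?_
  rw [IndepSets_iff]
  rintro _ _ ⟨_, ⟨A, hA, B, hB, rfl⟩, rfl⟩ ⟨_, ⟨A', hA', B', hB', rfl⟩, rfl⟩
  simp only [mk_preimage_prod]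
  rw [inter_inter_inter_comm, key A A' B B' hA hA' hB hB', hkey2 A B hA hB, hkey3 A' B' hA' hB']
  ring

section Primitives

variable {Ω : Type*} [MeasurableSpace Ω] {P : Measure Ω} [IsProbabilityMeasure P]

omit [IsProbabilityMeasure P] in
/-- The values of a Poisson process on a grid up to `t i` are independent of its next
increment. -/
theorem IsPoissonProcess.indepFun_past {T : ℝ} {rate : ℝ → ℝ} {N : ℝ → Ω → ℕ}
    (h : IsPoissonProcess P T rate N) {t : ℕ → ℝ} (ht : Monotone t) (htI : ∀ i, t i ∈ Icc 0 T)
    (i : ℕ) :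
    IndepFun (fun ω (j : Fin (i + 1)) => N (t j) ω) (fun ω => N (t (i + 1)) ω - N (t i) ω) P := by
  have hT : 0 ≤ T := (htI 0).1.trans (htI 0).2
  -- prepend the time `0`, so that the values are sums of increments
  set τ : ℕ → Icc (0 : ℝ) T := fun j => Nat.casesOn j ⟨0, le_rfl, hT⟩ fun j => ⟨t j, htI j⟩ with hτ
  have hτmono : Monotone τ := by
    refine monotone_nat_of_le_succ fun j => ?_
    cases j with
    | zero => exact (htI 0).1
    | succ j => exact ht (Nat.le_add_right j 1)
  have hmono : ∀ ω, Monotone fun j => N (τ j) ω := fun ω j j' hjj =>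
    h.mono ω (τ j).2 (τ j').2 (hτmono hjj)
  set D : ℕ → Ω → ℕ := fun j ω => N (τ (j + 1)) ω - N (τ j) ω with hD
  have hind : iIndepFun D P := h.indep_incr.nat hτmono
  have hDm : ∀ j, Measurable (D j) := fun j =>
    (h.measurable _ (τ (j + 1)).2).sub (h.measurable _ (τ j).2)
  have hsum : ∀ j ω, N (t j) ω = ∑ l ∈ Finset.range (j + 1), D l ω := by
    intro j ω
    have := Finset.sum_range_tsub (hmono ω) (j + 1)
    rw [hD, this]
    simp [hτ, h.zero]
  have hfin := hind.indepFun_finset (Finset.range (i + 1)) {i + 1} (by simp) hDm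
  have hφ : Measurable fun (d : Finset.range (i + 1) → ℕ) (j : Fin (i + 1)) =>
      ∑ l : Finset.range (i + 1), if (l : ℕ) ≤ j then d l else 0 :=
    measurable_pi_lambda _ fun j => Finset.measurable_sum _ fun l _ => by
      split_ifs <;> fun_prop
  have hψ : Measurable fun d : ({i + 1} : Finset ℕ) → ℕ => d ⟨i + 1, by simp⟩ :=
    measurable_pi_apply _
  have := hfin.comp hφ hψ
  convert this using 1
  swap
  · rfl
  funext ω j
  simp only [Function.comp, hsum]
  rw [Finset.sum_coe_sort (Finset.range (i + 1)) fun l => if l ≤ (j : ℕ) then D l ω else 0,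
    ← Finset.sum_filter]
  refine Finset.sum_congr ?_ fun _ _ => rfl
  ext l
  simp only [Finset.mem_range, Finset.mem_filter]
  omega

variable {M : Model} {Narr Nsrv : ℝ → Ω → ℕ} {U : ℕ → Ω → ℝ}
  (hprim : IsPrimitives M P Narr Nsrv U) {t : ℕ → ℝ} (ht : Monotone t)
  (htI : ∀ i, t i ∈ Icc 0 M.T)

/-- The information on the primitives available at the grid time `t i` if `k` customers have
arrived. -/
def gridPast (Narr Nsrv : ℝ → Ω → ℕ) (U : ℕ → Ω → ℝ) (t : ℕ → ℝ) (i k : ℕ) (ω : Ω) :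
    ((Fin (i + 1) → ℕ) × (Fin (i + 1) → ℕ)) × (Finset.range k → ℝ) :=
  ((fun j => Narr (t j) ω, fun j => Nsrv (t j) ω), fun j => U j ω)

/-- An event that, for each number `k` of customers that have arrived by `t i`, is decided by
the information available at `t i`. -/
def IsGridPast (Narr Nsrv : ℝ → Ω → ℕ) (U : ℕ → Ω → ℝ) (t : ℕ → ℝ) (i : ℕ) (A : Set Ω) : Prop :=
  ∀ k, ∃ S, MeasurableSet S ∧
    A ∩ Narr (t i) ⁻¹' {k} = gridPast Narr Nsrv U t i k ⁻¹' S

include hprim ht htI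

/-- The information available at `t i` if `k` customers have arrived is independent of the
increments over the next cell together with the decision variable of customer number `k`. -/
theorem IsPrimitives.indepFun_gridPast (i k : ℕ) :
    IndepFun (gridPast Narr Nsrv U t i k)
      (fun ω => ((Narr (t (i + 1)) ω - Narr (t i) ω, Nsrv (t (i + 1)) ω - Nsrv (t i) ω), U k ω))
      P := by
  have mN : ∀ j, Measurable (Narr (t j)) := fun j => hprim.arrivals.measurable _ (htI j)
  have mM : ∀ j, Measurable (Nsrv (t j)) := fun j => hprim.services.measurable _ (htI j)
  have h1 := hprim.arrivals.indepFun_past ht htI i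
  have h2 := hprim.services.indepFun_past ht htI i
  have h3 : IndepFun
      (fun ω => ((fun j : Fin (i + 1) => Narr (t j) ω), Narr (t (i + 1)) ω - Narr (t i) ω))
      (fun ω => ((fun j : Fin (i + 1) => Nsrv (t j) ω), Nsrv (t (i + 1)) ω - Nsrv (t i) ω)) P := by
    have hφ : Measurable fun p : Icc (0 : ℝ) M.T → ℕ =>
        ((fun j : Fin (i + 1) => p ⟨t j, htI j⟩), p ⟨t (i + 1), htI _⟩ - p ⟨t i, htI _⟩) := by
      fun_prop
    exact hprim.indep_arrivals_services.comp hφ hφ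
  have h4 := indepFun_prodMk_swap (by fun_prop) ((mN _).sub (mN _)) (by fun_prop)
    ((mM _).sub (mM _)) h1 h2 h3
  have h5 : IndepFun (fun ω (j : Finset.range k) => U j ω) (U k) P :=
    (hprim.indep_U.indepFun_finset (Finset.range k) {k} (by simp) hprim.measurable_U).comp
      (φ := id) (ψ := fun d : ({k} : Finset ℕ) → ℝ => d ⟨k, by simp⟩) measurable_id (by fun_prop)
  refine indepFun_prodMk_swap (X := fun ω =>
    ((fun j : Fin (i + 1) => Narr (t j) ω), (fun j : Fin (i + 1) => Nsrv (t j) ω)))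
    (by fun_prop) (((mN _).sub (mN _)).prodMk ((mM _).sub (mM _)))
    (measurable_pi_lambda _ fun j => hprim.measurable_U j) (hprim.measurable_U k) h4 h5 ?_
  have hφ : Measurable fun p : (Icc (0 : ℝ) M.T → ℕ) × (Icc (0 : ℝ) M.T → ℕ) =>
        (((fun j : Fin (i + 1) => p.1 ⟨t j, htI j⟩), (fun j : Fin (i + 1) => p.2 ⟨t j, htI j⟩)),
        ((p.1 ⟨t (i + 1), htI _⟩ - p.1 ⟨t i, htI _⟩),
          (p.2 ⟨t (i + 1), htI _⟩ - p.2 ⟨t i, htI _⟩))) := by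
      fun_prop
  have hψ : Measurable fun p : ℕ → ℝ => ((fun j : Finset.range k => p j), p k) := by fun_prop
  exact hprim.indep_processes_U.comp hφ hψ

/-- The past, the decision variable of the next customer, and the increments over the next cell
are independent. -/
theorem IsPrimitives.measure_gridPast_inter {i : ℕ} {A : Set Ω}
    (hA : IsGridPast Narr Nsrv U t i A) {S : Set ℝ} (hS : MeasurableSet S) (B : Set (ℕ × ℕ)) :
    P ((A ∩ {ω | U (Narr (t i) ω) ω ∈ S}) ∩
        (fun ω => (Narr (t (i + 1)) ω - Narr (t i) ω, Nsrv (t (i + 1)) ω - Nsrv (t i) ω)) ⁻¹' B)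
      = P A * volume (S ∩ Icc 0 1) *
        P ((fun ω => (Narr (t (i + 1)) ω - Narr (t i) ω,
          Nsrv (t (i + 1)) ω - Nsrv (t i) ω)) ⁻¹' B) := by
  set Δ : Ω → ℕ × ℕ := fun ω =>
    (Narr (t (i + 1)) ω - Narr (t i) ω, Nsrv (t (i + 1)) ω - Nsrv (t i) ω) with hΔ
  have mN : ∀ j, Measurable (Narr (t j)) := fun j => hprim.arrivals.measurable _ (htI j)
  have mM : ∀ j, Measurable (Nsrv (t j)) := fun j => hprim.services.measurable _ (htI j)
  have mΔ : Measurable Δ := ((mN _).sub (mN _)).prodMk ((mM _).sub (mM _))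
  have hdecomp : ∀ F : Set Ω, P F = ∑' k, P (F ∩ Narr (t i) ⁻¹' {k}) := by
    intro F
    have := tsum_measure_preimage_singleton (μ := P.restrict F) (f := Narr (t i))
      (countable_univ) (fun y _ => mN i (measurableSet_singleton y))
    rw [preimage_univ, Measure.restrict_apply_univ] at this
    rw [← this, tsum_univ (fun b => (P.restrict F) (Narr (t i) ⁻¹' {b}))]
    exact tsum_congr fun k => by
      rw [Measure.restrict_apply (mN i (measurableSet_singleton k)), inter_comm]
  have hU : ∀ k, P (Δ ⁻¹' B ∩ U k ⁻¹' S) = volume (S ∩ Icc 0 1) * P (Δ ⁻¹' B) := by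
    intro k
    have hφ : Measurable fun p : (Icc (0 : ℝ) M.T → ℕ) × (Icc (0 : ℝ) M.T → ℕ) =>
        ((p.1 ⟨t (i + 1), htI _⟩ - p.1 ⟨t i, htI _⟩),
          (p.2 ⟨t (i + 1), htI _⟩ - p.2 ⟨t i, htI _⟩)) := by fun_prop
    have hi : IndepFun Δ (U k) P := hprim.indep_processes_U.comp hφ (measurable_pi_apply k)
    rw [hi.measure_inter_preimage_eq_mul _ _ (MeasurableSet.of_discrete) hS, mul_comm,
      ← Measure.map_apply (hprim.measurable_U k) hS, hprim.uniform_U, Measure.restrict_apply hS]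
  rw [hdecomp, hdecomp A, ENNReal.tsum_mul_right.symm, ENNReal.tsum_mul_right.symm]
  refine tsum_congr fun k => ?_
  obtain ⟨Sk, hSk, hAk⟩ := hA k
  have hset : A ∩ {ω | U (Narr (t i) ω) ω ∈ S} ∩ Δ ⁻¹' B ∩ Narr (t i) ⁻¹' {k} =
      gridPast Narr Nsrv U t i k ⁻¹' Sk ∩ (fun ω => (Δ ω, U k ω)) ⁻¹' (B ×ˢ S) := by
    rw [← hAk]
    ext ω
    simp only [mem_inter_iff, mem_preimage, mem_singleton_iff, mem_prod, mem_ofPred_eq]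
    constructor
    · rintro ⟨⟨⟨h1, h2⟩, h3⟩, h4⟩
      rw [h4] at h2
      exact ⟨⟨h1, h4⟩, h3, h2⟩
    · rintro ⟨⟨h1, h4⟩, h3, h2⟩
      rw [← h4] at h2
      exact ⟨⟨⟨h1, h2⟩, h3⟩, h4⟩
  rw [hset, hAk, (hprim.indepFun_gridPast ht htI i k).measure_inter_preimage_eq_mul _ _ hSk
    (MeasurableSet.of_discrete.prod hS), mk_preimage_prod, hU, mul_assoc]

/-- Factorization of the expectation of a function of the increments over the next cell, on an event
of the past and on an event about the decision variable of the next customer. -/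
theorem IsPrimitives.setIntegral_gridPast {i : ℕ} {A : Set Ω}
    (hA : IsGridPast Narr Nsrv U t i A) {S : Set ℝ} (hS : MeasurableSet S) (g : ℕ × ℕ → ℝ) :
    ∫ ω in A ∩ {ω | U (Narr (t i) ω) ω ∈ S},
        g (Narr (t (i + 1)) ω - Narr (t i) ω, Nsrv (t (i + 1)) ω - Nsrv (t i) ω) ∂P
      = P.real A * volume.real (S ∩ Icc 0 1) *
        ∫ ω, g (Narr (t (i + 1)) ω - Narr (t i) ω, Nsrv (t (i + 1)) ω - Nsrv (t i) ω) ∂P := by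
  set Δ : Ω → ℕ × ℕ := fun ω =>
    (Narr (t (i + 1)) ω - Narr (t i) ω, Nsrv (t (i + 1)) ω - Nsrv (t i) ω) with hΔ
  have mN : ∀ j, Measurable (Narr (t j)) := fun j => hprim.arrivals.measurable _ (htI j)
  have mM : ∀ j, Measurable (Nsrv (t j)) := fun j => hprim.services.measurable _ (htI j)
  have mΔ : Measurable Δ := ((mN _).sub (mN _)).prodMk ((mM _).sub (mM _))
  have hmap : (P.restrict (A ∩ {ω | U (Narr (t i) ω) ω ∈ S})).map Δ
      = (P A * volume (S ∩ Icc 0 1)) • P.map Δ := by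
    ext B hB
    rw [Measure.map_apply mΔ hB, Measure.restrict_apply (mΔ hB), inter_comm, Measure.smul_apply,
      Measure.map_apply mΔ hB, smul_eq_mul]
    exact hprim.measure_gridPast_inter ht htI hA hS B
  rw [← integral_map mΔ.aemeasurable (f := g) (by fun_prop),
    ← integral_map mΔ.aemeasurable (f := g) (by fun_prop), hmap, integral_smul_measure,
    ENNReal.toReal_mul, smul_eq_mul]
  rfl

end Primitives

/-! ### Poisson increments -/

theorem hasSum_poisson_mean (r : ℝ≥0) :
    HasSum (fun n : ℕ => Real.exp (-r) * (r : ℝ) ^ n / (n.factorial : ℝ) * n) r := by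
  rw [← hasSum_nat_add_iff' 1]
  have h := (hasSum_one_poissonMeasure r).mul_left (r : ℝ)
  simp only [Finset.range_one, Finset.sum_singleton, Nat.cast_zero, mul_zero, sub_zero]
  rw [mul_one] at h
  refine h.congr_fun fun n => ?_
  rw [Nat.factorial_succ]
  have : (n.factorial : ℝ) ≠ 0 := by positivity
  push_cast
  field_simp
  ring

theorem integrable_poissonMeasure_id (r : ℝ≥0) :
    Integrable (fun n : ℕ => (n : ℝ)) (poissonMeasure r) := by
  rw [integrable_poissonMeasure_iff]
  simpa using (hasSum_poisson_mean r).summable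

theorem integral_poissonMeasure_id (r : ℝ≥0) : ∫ n : ℕ, (n : ℝ) ∂poissonMeasure r = r := by
  rw [integral_poissonMeasure]
  simpa using (hasSum_poisson_mean r).tsum_eq

/-- Two or more events have a probability of second order in the mean. -/
theorem poissonMeasure_real_two_le (r : ℝ≥0) :
    (poissonMeasure r).real {n | 2 ≤ n} ≤ (r : ℝ) ^ 2 := by
  have h : {n : ℕ | 2 ≤ n} = ({0, 1} : Set ℕ)ᶜ := by
    ext n
    simp
    omega
  have h2 : (poissonMeasure r).real {0, 1} = Real.exp (-r) + Real.exp (-r) * r := by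
    rw [show ({0, 1} : Set ℕ) = {0} ∪ {1} from rfl, measureReal_union (by simp) (by simp),
      poissonMeasure_real_singleton, poissonMeasure_real_singleton]
    simp
  rw [h, probReal_compl_eq_one_sub (by measurability), h2]
  have := Real.add_one_le_exp (-(r : ℝ))
  have hr : (0 : ℝ) ≤ r := r.2
  nlinarith

section Poisson

variable {Ω : Type*} [MeasurableSpace Ω] {P : Measure Ω} [IsProbabilityMeasure P]
  {T : ℝ} {rate : ℝ → ℝ} {N : ℝ → Ω → ℕ}

omit [IsProbabilityMeasure P] in
theorem IsPoissonProcess.isCountingPath (h : IsPoissonProcess P T rate N) (ω : Ω) :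
    IsCountingPath T fun t => N t ω :=
  ⟨h.zero ω, h.mono ω, h.right_cont ω⟩

variable (h : IsPoissonProcess P T rate N) (hrate : ∀ t ∈ Icc 0 T, 0 ≤ rate t) {a b : ℝ}
  (ha : 0 ≤ a) (hab : a ≤ b) (hb : b ≤ T)

include h ha hab hb

omit [IsProbabilityMeasure P] in
theorem IsPoissonProcess.measurable_incr : Measurable fun ω => N b ω - N a ω :=
  (h.measurable b ⟨ha.trans hab, hb⟩).sub (h.measurable a ⟨ha, hab.trans hb⟩)

omit [IsProbabilityMeasure P] in
theorem IsPoissonProcess.cast_incr (ω : Ω) :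
    ((N b ω - N a ω : ℕ) : ℝ) = (N b ω : ℝ) - N a ω :=
  Nat.cast_sub (h.mono ω ⟨ha, hab.trans hb⟩ ⟨ha.trans hab, hb⟩ hab)

omit [IsProbabilityMeasure P] in
theorem IsPoissonProcess.integrable_incr : Integrable (fun ω => (N b ω : ℝ) - N a ω) P := by
  have h1 := integrable_poissonMeasure_id (∫ r in a..b, rate r).toNNReal
  rw [← h.law_incr a b ha hab hb, integrable_map_measure (by fun_prop)
    (h.measurable_incr ha hab hb).aemeasurable] at h1
  refine h1.congr (.of_forall fun ω => h.cast_incr ha hab hb ω)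

include hrate

omit [IsProbabilityMeasure P] in
theorem IsPoissonProcess.integral_incr :
    ∫ ω, ((N b ω : ℝ) - N a ω) ∂P = ∫ r in a..b, rate r := by
  have h1 := integral_poissonMeasure_id (∫ r in a..b, rate r).toNNReal
  rw [← h.law_incr a b ha hab hb, integral_map (h.measurable_incr ha hab hb).aemeasurable
    (by fun_prop), Real.coe_toNNReal _ (intervalIntegral.integral_nonneg hab fun u hu =>
      hrate u ⟨ha.trans hu.1, hu.2.trans hb⟩)] at h1
  rw [← h1]
  exact integral_congr_ae (.of_forall fun ω => (h.cast_incr ha hab hb ω).symm)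

theorem IsPoissonProcess.measureReal_incr_pos :
    P.real {ω | 1 ≤ N b ω - N a ω} ≤ ∫ r in a..b, rate r := by
  rw [← h.integral_incr hrate ha hab hb]
  have := mul_meas_ge_le_integral_of_nonneg (μ := P) (f := fun ω => (N b ω : ℝ) - N a ω)
    (.of_forall fun ω => ?_) (h.integrable_incr ha hab hb) 1
  · rw [one_mul] at this
    refine le_trans (measureReal_mono fun ω hω => ?_) this
    simp only [mem_ofPred_eq] at hω ⊢
    rw [← h.cast_incr ha hab hb]
    exact_mod_cast hω
  · simp only [Pi.zero_apply]
    rw [← h.cast_incr ha hab hb]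
    positivity

omit [IsProbabilityMeasure P] in
theorem IsPoissonProcess.measureReal_two_le_incr :
    P.real {ω | 2 ≤ N b ω - N a ω} ≤ (∫ r in a..b, rate r) ^ 2 := by
  have h1 := poissonMeasure_real_two_le (∫ r in a..b, rate r).toNNReal
  rw [Real.coe_toNNReal _ (intervalIntegral.integral_nonneg hab fun u hu =>
      hrate u ⟨ha.trans hu.1, hu.2.trans hb⟩), ← h.law_incr a b ha hab hb,
      map_measureReal_apply (h.measurable_incr ha hab hb) .of_discrete] at h1
  exact h1

end Poisson

/-! ### Uniform grids -/

/-- The grid with `k` equal cells on `[s, e]`, constant from its index `k` on. -/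
noncomputable def unifGrid (s e : ℝ) (k i : ℕ) : ℝ := s + (e - s) * ((min i k : ℕ) / (k : ℝ))

section Grid

variable {s e : ℝ} (hse : s ≤ e) (k : ℕ)

theorem unifGrid_zero : unifGrid s e k 0 = s := by simp [unifGrid]

theorem unifGrid_self {k : ℕ} (hk : k ≠ 0) : unifGrid s e k k = e := by
  have : (k : ℝ) ≠ 0 := by exact_mod_cast hk
  simp [unifGrid, this]

include hse

theorem unifGrid_mono : Monotone (unifGrid s e k) := by
  intro i j hij
  unfold unifGrid
  have : min i k ≤ min j k := min_le_min_right k hij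
  have h2 : (0 : ℝ) ≤ e - s := sub_nonneg.2 hse
  gcongr

theorem unifGrid_mem (i : ℕ) : unifGrid s e k i ∈ Icc s e := by
  unfold unifGrid
  have h2 : (0 : ℝ) ≤ e - s := sub_nonneg.2 hse
  have h0 : (0 : ℝ) ≤ (min i k : ℕ) / (k : ℝ) := by positivity
  have h1 : ((min i k : ℕ) : ℝ) / (k : ℝ) ≤ 1 :=
    div_le_one_of_le₀ (by exact_mod_cast min_le_right i k) (by positivity)
  constructor <;> nlinarith

theorem unifGrid_succ_sub_le (i : ℕ) :
    unifGrid s e k (i + 1) - unifGrid s e k i ≤ (e - s) / k := by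
  unfold unifGrid
  have h2 : (0 : ℝ) ≤ e - s := sub_nonneg.2 hse
  have h3 : ((min (i + 1) k : ℕ) : ℝ) ≤ (min i k : ℕ) + 1 := by
    have : min (i + 1) k ≤ min i k + 1 := by omega
    exact_mod_cast this
  calc s + (e - s) * (((min (i + 1) k : ℕ) : ℝ) / k) - (s + (e - s) * (((min i k : ℕ) : ℝ) / k))
      = (e - s) * (((min (i + 1) k : ℕ) : ℝ) - (min i k : ℕ)) / k := by ring
    _ ≤ (e - s) * 1 / k := by gcongr; linarith
    _ = (e - s) / k := by ring

/-- A continuous function oscillates little on the cells of fine uniform grids. -/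
theorem eventually_unifGrid_dist_le {T : ℝ} (hs : 0 ≤ s) (he : e ≤ T) {X : Type*}
    [PseudoMetricSpace X] {f : ℝ → X} (hf : ContinuousOn f (Icc 0 T)) {ε : ℝ} (hε : 0 < ε) :
    ∀ᶠ k in atTop, ∀ i, ∀ r ∈ Icc (unifGrid s e k i) (unifGrid s e k (i + 1)),
      dist (f r) (f (unifGrid s e k i)) ≤ ε := by
  have huc := isCompact_Icc.uniformContinuousOn_of_continuous hf
  obtain ⟨δ, hδ, hfδ⟩ := Metric.uniformContinuousOn_iff.1 huc ε hε
  have hlim : Tendsto (fun k : ℕ => (e - s) / k) atTop (𝓝 0) :=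
    tendsto_const_div_atTop_nhds_zero_nat _
  filter_upwards [hlim.eventually (gt_mem_nhds hδ)] with k hk i r hr
  have h1 := unifGrid_mem hse k i
  have h2 := unifGrid_mem hse k (i + 1)
  refine (hfδ r ⟨by linarith [h1.1, hr.1], by linarith [h2.2, hr.2]⟩ _
    ⟨by linarith [h1.1], by linarith [h1.2]⟩ ?_).le
  rw [Real.dist_eq, abs_of_nonneg (by linarith [hr.1])]
  linarith [unifGrid_succ_sub_le hse k i, hr.2]

end Grid

/-- The expected number of events (arrivals and services) in `(a, b]`. -/
noncomputable def Model.load (M : Model) (a b : ℝ) : ℝ := ∫ r in a..b, (M.lam r + M.mu r)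

section Model

variable (M : Model)

theorem Model.lam_intervalIntegrable {a b : ℝ} (ha : a ∈ Icc 0 M.T) (hb : b ∈ Icc 0 M.T) :
    IntervalIntegrable M.lam volume a b :=
  M.lam_integrable.mono_set (by
    rw [uIcc_of_le M.T_pos.le]; exact (ordConnected_Icc.uIcc_subset ha hb))

theorem Model.mu_intervalIntegrable {a b : ℝ} (ha : a ∈ Icc 0 M.T) (hb : b ∈ Icc 0 M.T) :
    IntervalIntegrable M.mu volume a b :=
  M.mu_integrable.mono_set (by
    rw [uIcc_of_le M.T_pos.le]; exact (ordConnected_Icc.uIcc_subset ha hb))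

theorem Model.load_eq {a b : ℝ} (ha : a ∈ Icc 0 M.T) (hb : b ∈ Icc 0 M.T) :
    M.load a b = (∫ r in a..b, M.lam r) + ∫ r in a..b, M.mu r :=
  intervalIntegral.integral_add (M.lam_intervalIntegrable ha hb) (M.mu_intervalIntegrable ha hb)

theorem Model.load_add {a b c : ℝ} (ha : a ∈ Icc 0 M.T) (hb : b ∈ Icc 0 M.T)
    (hc : c ∈ Icc 0 M.T) : M.load a b + M.load b c = M.load a c :=
  intervalIntegral.integral_add_adjacent_intervals
    ((M.lam_intervalIntegrable ha hb).add (M.mu_intervalIntegrable ha hb))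
    ((M.lam_intervalIntegrable hb hc).add (M.mu_intervalIntegrable hb hc))

theorem Model.integral_lam_nonneg {a b : ℝ} (ha : a ∈ Icc 0 M.T) (hb : b ∈ Icc 0 M.T)
    (hab : a ≤ b) : 0 ≤ ∫ r in a..b, M.lam r :=
  intervalIntegral.integral_nonneg hab fun u hu =>
    M.lam_nonneg u ⟨ha.1.trans hu.1, hu.2.trans hb.2⟩

theorem Model.integral_mu_nonneg {a b : ℝ} (ha : a ∈ Icc 0 M.T) (hb : b ∈ Icc 0 M.T)
    (hab : a ≤ b) : 0 ≤ ∫ r in a..b, M.mu r :=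
  intervalIntegral.integral_nonneg hab fun u hu =>
    M.mu_nonneg u ⟨ha.1.trans hu.1, hu.2.trans hb.2⟩

theorem Model.load_nonneg {a b : ℝ} (ha : a ∈ Icc 0 M.T) (hb : b ∈ Icc 0 M.T)
    (hab : a ≤ b) : 0 ≤ M.load a b := by
  rw [M.load_eq ha hb]
  exact add_nonneg (M.integral_lam_nonneg ha hb hab) (M.integral_mu_nonneg ha hb hab)

theorem Model.load_continuousOn : ContinuousOn (fun t => M.load 0 t) (Icc 0 M.T) := by
  have := intervalIntegral.continuousOn_primitive_interval (μ := volume)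
    (f := fun r => M.lam r + M.mu r) (a := 0) (b := M.T) (by
      rw [uIcc_of_le M.T_pos.le, ← intervalIntegrable_iff_integrableOn_Icc_of_le M.T_pos.le]
      exact M.lam_integrable.add M.mu_integrable)
  rwa [uIcc_of_le M.T_pos.le] at this

end Model

/-! ### Fine grids resolve the events -/

section Bad

variable {Ω : Type*} [MeasurableSpace Ω] {P : Measure Ω} [IsProbabilityMeasure P] {M : Model}
  {Narr Nsrv : ℝ → Ω → ℕ} {U : ℕ → Ω → ℝ} (hprim : IsPrimitives M P Narr Nsrv U)
  {pol : Policy}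

include hprim

/-- A cell fails to be resolved with probability of second order: it has two events, or an arrival
whose decision variable is within `δ` of an admission probability. -/
theorem IsPrimitives.measureReal_cell_le {t : ℕ → ℝ} (ht : Monotone t)
    (htI : ∀ i, t i ∈ Icc 0 M.T) (i : ℕ) {δ : ℝ} (hδ : 0 ≤ δ) :
    P.real {ω | 2 ≤ (Narr (t (i + 1)) ω - Narr (t i) ω) + (Nsrv (t (i + 1)) ω - Nsrv (t i) ω) ∨
        (1 ≤ Narr (t (i + 1)) ω - Narr (t i) ω ∧
          ∃ x ≤ M.C, |U (Narr (t i) ω) ω - pol (t i) x 1| ≤ δ)}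
      ≤ M.load (t i) (t (i + 1)) ^ 2 + (M.C + 1) * (2 * δ) * M.load (t i) (t (i + 1)) := by
  have hle := ht (Nat.le_add_right i 1)
  set A := ∫ r in t i..t (i + 1), M.lam r with hA
  set B := ∫ r in t i..t (i + 1), M.mu r with hB
  have hA0 : 0 ≤ A := M.integral_lam_nonneg (htI i) (htI _) hle
  have hB0 : 0 ≤ B := M.integral_mu_nonneg (htI i) (htI _) hle
  set EN := {ω | 1 ≤ Narr (t (i + 1)) ω - Narr (t i) ω} with hEN
  set EM := {ω | 1 ≤ Nsrv (t (i + 1)) ω - Nsrv (t i) ω} with hEM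
  have p1 : P.real EN ≤ A :=
    hprim.arrivals.measureReal_incr_pos M.lam_nonneg (htI i).1 hle (htI _).2
  have p2 : P.real EM ≤ B := hprim.services.measureReal_incr_pos M.mu_nonneg (htI i).1 hle (htI _).2
  have p3 : P.real {ω | 2 ≤ Narr (t (i + 1)) ω - Narr (t i) ω} ≤ A ^ 2 :=
    hprim.arrivals.measureReal_two_le_incr M.lam_nonneg (htI i).1 hle (htI _).2
  have p4 : P.real {ω | 2 ≤ Nsrv (t (i + 1)) ω - Nsrv (t i) ω} ≤ B ^ 2 :=
    hprim.services.measureReal_two_le_incr M.mu_nonneg (htI i).1 hle (htI _).2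
  have p5 : P.real (EN ∩ EM) ≤ A * B := by
    have hφ : Measurable fun p : Icc (0 : ℝ) M.T → ℕ => p ⟨t (i + 1), htI _⟩ - p ⟨t i, htI _⟩ := by
      fun_prop
    have hi := hprim.indep_arrivals_services.comp hφ hφ
    have := hi.measure_inter_preimage_eq_mul {n | 1 ≤ n} {n | 1 ≤ n} .of_discrete .of_discrete
    have h2 : P.real (EN ∩ EM) = P.real EN * P.real EM := by
      simp only [measureReal_def, ← ENNReal.toReal_mul]
      exact congrArg ENNReal.toReal this
    rw [h2]
    gcongr
  have p6 : ∀ x ∈ Finset.range (M.C + 1),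
      P.real (EN ∩ {ω | |U (Narr (t i) ω) ω - pol (t i) x 1| ≤ δ}) ≤ 2 * δ * A := by
    intro x _
    have hpast : IsGridPast Narr Nsrv U t i univ := fun k =>
      ⟨{w | w.1.1 (Fin.last i) = k}, measurableSet_eq_fun (by fun_prop) (by fun_prop), by
        ext ω; simp [gridPast]⟩
    have := hprim.measure_gridPast_inter ht htI hpast
      (Metric.isClosed_closedBall (x := pol (t i) x 1) (ε := δ)).measurableSet {p | 1 ≤ p.1}
    have h2 : P.real (EN ∩ {ω | |U (Narr (t i) ω) ω - pol (t i) x 1| ≤ δ}) =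
        volume.real (Metric.closedBall (pol (t i) x 1) δ ∩ Icc 0 1) * P.real EN := by
      simp only [measureReal_def, ← ENNReal.toReal_mul]
      rw [univ_inter, measure_univ, one_mul, inter_comm] at this
      exact congrArg ENNReal.toReal this
    have h3 : volume.real (Metric.closedBall (pol (t i) x 1) δ ∩ Icc 0 1) ≤ 2 * δ := by
      refine (measureReal_mono inter_subset_left
        (by rw [Real.volume_closedBall]; exact ENNReal.ofReal_ne_top)).trans ?_
      rw [measureReal_def, Real.volume_closedBall, ENNReal.toReal_ofReal (by positivity)]
    rw [h2]
    gcongr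
  have hsub : {ω | 2 ≤ (Narr (t (i + 1)) ω - Narr (t i) ω) +
        (Nsrv (t (i + 1)) ω - Nsrv (t i) ω) ∨ (1 ≤ Narr (t (i + 1)) ω - Narr (t i) ω ∧
          ∃ x ≤ M.C, |U (Narr (t i) ω) ω - pol (t i) x 1| ≤ δ)} ⊆
      (({ω | 2 ≤ Narr (t (i + 1)) ω - Narr (t i) ω} ∪
        {ω | 2 ≤ Nsrv (t (i + 1)) ω - Nsrv (t i) ω}) ∪ (EN ∩ EM)) ∪
      ⋃ x ∈ Finset.range (M.C + 1), EN ∩ {ω | |U (Narr (t i) ω) ω - pol (t i) x 1| ≤ δ} := by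
    rintro ω (hω | ⟨h1, x, hx, h2⟩)
    · left
      simp only [mem_union, mem_inter_iff, hEN, hEM, mem_ofPred_eq]
      omega
    · right
      simp only [mem_iUnion, Finset.mem_range]
      exact ⟨x, by omega, h1, h2⟩
  have hsum := (measureReal_mono (μ := P) hsub).trans ((measureReal_union_le _ _).trans
    (add_le_add ((measureReal_union_le _ _).trans (add_le_add ((measureReal_union_le _ _).trans
      (add_le_add p3 p4)) p5)) ((measureReal_biUnion_finset_le _ _).trans
        (Finset.sum_le_sum p6))))
  refine hsum.trans ?_
  rw [M.load_eq (htI i) (htI _), Finset.sum_const, Finset.card_range, nsmul_eq_mul]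
  push_cast
  have : 0 ≤ (M.C + 1) * (2 * δ) * B := by positivity
  nlinarith [mul_nonneg hA0 hB0]

/-- Union bound over the cells of a grid on which the policy oscillates by at most `δ`. -/
theorem IsPrimitives.measureReal_not_goodGrid_le {t : ℕ → ℝ} (ht : Monotone t)
    (htI : ∀ i, t i ∈ Icc 0 M.T) (k : ℕ) {δ : ℝ} (hδ : 0 ≤ δ)
    (hmod : ∀ i < k, ∀ x ≤ M.C, ∀ r ∈ Icc (t i) (t (i + 1)), |pol r x 1 - pol (t i) x 1| ≤ δ) :
    P.real {ω | ¬ GoodGrid pol M.C (fun r => Narr r ω) (fun r => Nsrv r ω) (fun j => U j ω) t k}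
      ≤ ∑ i ∈ Finset.range k, (M.load (t i) (t (i + 1)) ^ 2 +
          (M.C + 1) * (2 * δ) * M.load (t i) (t (i + 1))) := by
  refine le_trans (measureReal_mono (s₂ := ⋃ i ∈ Finset.range k, {ω |
    2 ≤ (Narr (t (i + 1)) ω - Narr (t i) ω) + (Nsrv (t (i + 1)) ω - Nsrv (t i) ω) ∨
        (1 ≤ Narr (t (i + 1)) ω - Narr (t i) ω ∧
          ∃ x ≤ M.C, |U (Narr (t i) ω) ω - pol (t i) x 1| ≤ δ)}) (fun ω hω => ?_)
    (measure_ne_top _ _))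
    ((measureReal_biUnion_finset_le _ _).trans
      (Finset.sum_le_sum fun i _ => hprim.measureReal_cell_le ht htI i hδ))
  simp only [mem_iUnion, Finset.mem_range, mem_ofPred_eq]
  by_contra! hcon
  refine hω fun i hi => ?_
  obtain ⟨h1, h2⟩ := hcon i hi
  have m1 := hprim.arrivals.mono ω (htI i) (htI _) (ht (Nat.le_add_right i 1))
  have m2 := hprim.services.mono ω (htI i) (htI _) (ht (Nat.le_add_right i 1))
  simp only at m1 m2
  refine ⟨by dsimp only; omega, fun hlt x hx r hr => ?_⟩
  simp only at hlt
  have h3 := h2 (by omega) x hx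
  have h4 := hmod i hi x hx r hr
  rw [abs_le] at h4
  rcases lt_abs.1 h3 with h5 | h5 <;> constructor <;> intro h6 <;> linarith

variable (hadm : IsAdmissible M pol) {s e : ℝ} (hs : 0 ≤ s) (hse : s ≤ e) (he : e ≤ M.T)

include hadm hs hse he

/-- The probability that the uniform grid with `k` cells is not good tends to zero, because the
squares of the loads of the cells have a small sum and the policy is uniformly continuous. -/
theorem IsPrimitives.tendsto_measureReal_not_goodGrid :
    Tendsto (fun k => P.real {ω | ¬ GoodGrid pol M.C (fun r => Narr r ω) (fun r => Nsrv r ω)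
      (fun j => U j ω) (unifGrid s e k) k}) atTop (𝓝 0) := by
  have hI : ∀ k i, unifGrid s e k i ∈ Icc 0 M.T := fun k i =>
    ⟨hs.trans (unifGrid_mem hse k i).1, (unifGrid_mem hse k i).2.trans he⟩
  have hsI : s ∈ Icc 0 M.T := ⟨hs, hse.trans he⟩
  have heI : e ∈ Icc 0 M.T := ⟨hs.trans hse, he⟩
  have h0I : (0 : ℝ) ∈ Icc 0 M.T := ⟨le_rfl, M.T_pos.le⟩
  have hload : 0 ≤ M.load s e := M.load_nonneg hsI heI hse
  refine Metric.tendsto_atTop.2 fun ε hε => ?_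
  set K := M.load s e + (M.C + 1) * 2 * M.load s e + 1 with hK
  have hK0 : 0 < K := by positivity
  set η := ε / (2 * K) with hη
  have hη0 : 0 < η := by positivity
  have e1 := eventually_unifGrid_dist_le hse hs he M.load_continuousOn hη0
  have e2 : ∀ᶠ k in atTop, ∀ x ∈ Finset.range (M.C + 1), ∀ i,
      ∀ r ∈ Icc (unifGrid s e k i) (unifGrid s e k (i + 1)),
      dist (pol r x 1) (pol (unifGrid s e k i) x 1) ≤ η := by
    rw [Filter.eventually_all_finset]
    intro x hx
    exact eventually_unifGrid_dist_le hse hs he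
      (hadm.cont x (Nat.lt_succ_iff.1 (Finset.mem_range.1 hx)) 1) hη0
  obtain ⟨k₀, hk₀⟩ := eventually_atTop.1 ((e1.and e2).and (eventually_ne_atTop 0))
  refine ⟨k₀, fun k hk => ?_⟩
  obtain ⟨⟨h1, h2⟩, h3⟩ := hk₀ k hk
  rw [Real.dist_eq, sub_zero, abs_of_nonneg measureReal_nonneg]
  have hb := hprim.measureReal_not_goodGrid_le (pol := pol) (unifGrid_mono hse k) (hI k) k hη0.le
    (fun i _ x hx r hr => h2 x (Finset.mem_range.2 (by omega)) i r hr)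
  have hl : ∀ i, M.load (unifGrid s e k i) (unifGrid s e k (i + 1)) ≤ η := by
    intro i
    have hmono := unifGrid_mono hse k (Nat.le_add_right i 1)
    have := h1 i _ ⟨hmono, le_rfl⟩
    rw [Real.dist_eq] at this
    have h5 := M.load_add h0I (hI k i) (hI k (i + 1))
    linarith [le_abs_self (M.load 0 (unifGrid s e k (i + 1)) - M.load 0 (unifGrid s e k i))]
  have hl0 : ∀ i, 0 ≤ M.load (unifGrid s e k i) (unifGrid s e k (i + 1)) := fun i =>
    M.load_nonneg (hI k i) (hI k _) (unifGrid_mono hse k (Nat.le_add_right i 1))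
  have hsum : ∑ i ∈ Finset.range k, M.load (unifGrid s e k i) (unifGrid s e k (i + 1))
      = M.load s e := by
    have : ∀ j, ∑ i ∈ Finset.range j, M.load (unifGrid s e k i) (unifGrid s e k (i + 1))
        = M.load s (unifGrid s e k j) := by
      intro j
      induction j with
      | zero => simp [unifGrid_zero, Model.load]
      | succ j ih => rw [Finset.sum_range_succ, ih, M.load_add hsI (hI k j) (hI k _)]
    rw [this k, unifGrid_self h3]
  calc _ ≤ _ := hb
    _ ≤ ∑ i ∈ Finset.range k, (η + (M.C + 1) * (2 * η)) *
        M.load (unifGrid s e k i) (unifGrid s e k (i + 1)) := by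
      refine Finset.sum_le_sum fun i _ => ?_
      nlinarith [hl i, hl0 i]
    _ = η * (M.load s e + (M.C + 1) * 2 * M.load s e) := by
      rw [← Finset.mul_sum, hsum]; ring
    _ ≤ η * K := by gcongr; linarith
    _ = ε / 2 := by rw [hη]; field_simp
    _ < ε := by linarith

omit [IsProbabilityMeasure P] hadm hs hse he in
theorem IsPrimitives.ae_U_nonneg : ∀ᵐ ω ∂P, ∀ i, 0 ≤ U i ω := by
  rw [ae_all_iff]
  intro i
  have : ∀ᵐ u ∂(P.map (U i)), 0 ≤ u := by
    rw [hprim.uniform_U]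
    filter_upwards [ae_restrict_mem measurableSet_Icc] with u hu using hu.1
  exact ae_of_ae_map (hprim.measurable_U i).aemeasurable this

/-- Along a subsequence of the uniform grids, almost every path is eventually resolved. -/
theorem IsPrimitives.exists_subseq_goodGrid : ∃ ns : ℕ → ℕ, StrictMono ns ∧
    ∀ᵐ ω ∂P, ∀ᶠ j in atTop, GoodGrid pol M.C (fun r => Narr r ω) (fun r => Nsrv r ω)
      (fun j => U j ω) (unifGrid s e (ns j)) (ns j) := by
  have hlim := hprim.tendsto_measureReal_not_goodGrid hadm hs hse he
  obtain ⟨ns, hns, hle⟩ := extraction_forall_of_eventually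
    (P := fun n k => P.real {ω | ¬ GoodGrid pol M.C (fun r => Narr r ω) (fun r => Nsrv r ω)
      (fun j => U j ω) (unifGrid s e k) k} ≤ (1 / 2) ^ n)
    (fun n => (hlim.eventually (ge_mem_nhds (by positivity : (0 : ℝ) < (1 / 2) ^ n))))
  refine ⟨ns, hns, ?_⟩
  have hsum : ∑' j, P {ω | ¬ GoodGrid pol M.C (fun r => Narr r ω) (fun r => Nsrv r ω)
      (fun j => U j ω) (unifGrid s e (ns j)) (ns j)} ≠ ⊤ := by
    refine ne_top_of_le_ne_top ?_ (ENNReal.tsum_le_tsum fun j => ?_)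
      (b := ∑' j : ℕ, ENNReal.ofReal ((1 / 2) ^ j))
    · rw [← ENNReal.ofReal_tsum_of_nonneg (fun _ => by positivity) summable_geometric_two]
      exact ENNReal.ofReal_ne_top
    · rw [← ofReal_measureReal]
      exact ENNReal.ofReal_le_ofReal (hle j)
  have h0 := measure_limsup_atTop_eq_zero hsum
  rw [limsup_eq_iInf_iSup_of_nat] at h0
  refine measure_mono_null (fun ω hω => ?_) h0
  simp only [mem_compl_iff, mem_ofPred_eq, not_eventually] at hω
  simp only [iInf_eq_iInter, iSup_eq_iUnion, mem_iInter, mem_iUnion]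
  intro n
  obtain ⟨j, hj, h⟩ := (hω.and_eventually (eventually_ge_atTop n)).exists
  exact ⟨j, h, hj⟩

end Bad

/-! ### The Euler scheme as a random process -/

theorem measurable_comp_nat {Ω : Type*} [MeasurableSpace Ω] {E : Type*} [MeasurableSpace E]
    {f : ℕ → Ω → E} {N : Ω → ℕ} (hf : ∀ i, Measurable (f i)) (hN : Measurable N) :
    Measurable fun ω => f (N ω) ω :=
  (measurable_from_prod_countable_right (f := fun p : ℕ × Ω => f p.1 p.2) hf).comp
    (hN.prodMk measurable_id)

theorem measurable_gridChain {α : Type*} [MeasurableSpace α] (pol : Policy) {n m : ℕ → α → ℕ}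
    {u : ℕ → α → ℝ} (hn : ∀ i, Measurable (n i)) (hm : ∀ i, Measurable (m i))
    (hu : ∀ i, Measurable (u i)) (t : ℕ → ℝ) (x₀ i : ℕ) :
    Measurable fun a =>
      gridChain pol (fun j => n j a) (fun j => m j a) (fun j => u j a) t x₀ i := by
  induction i with
  | zero => exact measurable_const
  | succ i ih =>
    simp only [gridChain]
    refine Measurable.ite (measurableSet_lt (hn _) (hn _)) (Measurable.ite (measurableSet_lt
      (measurable_comp_nat hu (hn i)) ?_) (by fun_prop) ih)
      (Measurable.ite (measurableSet_lt (hm _) (hm _)) (by fun_prop) ih)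
    exact (measurable_from_top (f := fun y => pol (t i) y 1)).comp ih

/-- The probability that the queue started at time `s` in state `x` is in state `y` at
time `t`. -/
noncomputable def stateProb {Ω : Type*} [MeasurableSpace Ω] (P : Measure Ω)
    (Narr Nsrv : ℝ → Ω → ℕ) (U : ℕ → Ω → ℝ) (pol : Policy) (s : ℝ) (x : ℕ) (t : ℝ) (y : ℕ) : ℝ :=
  P.real {ω | queueLength pol (fun r => Narr r ω) (fun r => Nsrv r ω) (fun i => U i ω) s x t = y}

section Cell

variable {Ω : Type*} [MeasurableSpace Ω] {P : Measure Ω} [IsProbabilityMeasure P] {M : Model}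
  {Narr Nsrv : ℝ → Ω → ℕ} {U : ℕ → Ω → ℝ} (hprim : IsPrimitives M P Narr Nsrv U)
  {pol : Policy} (hadm : IsAdmissible M pol) {t : ℕ → ℝ} (ht : Monotone t)
  (htI : ∀ i, t i ∈ Icc 0 M.T) {x : ℕ} (hx : x ≤ M.C)

include hprim

omit [IsProbabilityMeasure P] in
include htI in
theorem IsPrimitives.measurable_gridQueue (x i : ℕ) : Measurable fun ω =>
    gridQueue pol (fun r => Narr r ω) (fun r => Nsrv r ω) (fun j => U j ω) t x i :=
  measurable_gridChain pol (n := fun j ω => Narr (t j) ω) (m := fun j ω => Nsrv (t j) ω)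
    (u := fun j ω => U j ω)
    (fun j => hprim.arrivals.measurable _ (htI j)) (fun j => hprim.services.measurable _ (htI j))
    hprim.measurable_U t x i

omit [IsProbabilityMeasure P] in
include hadm htI hx in
theorem IsPrimitives.ae_gridQueue_le : ∀ᵐ ω ∂P, ∀ i,
    gridQueue pol (fun r => Narr r ω) (fun r => Nsrv r ω) (fun j => U j ω) t x i ≤ M.C := by
  filter_upwards [hprim.ae_U_nonneg] with ω hω i
  exact gridChain_le hx hω fun j _ =>
    hadm.unavailable _ (htI j) M.C le_rfl 1 (by simp [available])

omit [IsProbabilityMeasure P] in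
include ht htI in
/-- The state of the Euler scheme at `t i` is decided by the past. -/
theorem IsPrimitives.isGridPast_gridQueue (x i y : ℕ) : IsGridPast Narr Nsrv U t i
    {ω | gridQueue pol (fun r => Narr r ω) (fun r => Nsrv r ω) (fun j => U j ω) t x i = y} := by
  intro k
  -- the scheme computed from the available information alone
  set Z : ((Fin (i + 1) → ℕ) × (Fin (i + 1) → ℕ)) × (Finset.range k → ℝ) → ℕ := fun w =>
    gridChain pol (fun j => w.1.1 ⟨min j i, by omega⟩) (fun j => w.1.2 ⟨min j i, by omega⟩)
      (fun j => if h : j < k then w.2 ⟨j, Finset.mem_range.2 h⟩ else 0) t x i with hZ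
  have hZm : Measurable Z := by
    refine measurable_gridChain pol
      (n := fun j (w : ((Fin (i + 1) → ℕ) × (Fin (i + 1) → ℕ)) × (Finset.range k → ℝ)) =>
        w.1.1 ⟨min j i, by omega⟩)
      (m := fun j (w : ((Fin (i + 1) → ℕ) × (Fin (i + 1) → ℕ)) × (Finset.range k → ℝ)) =>
        w.1.2 ⟨min j i, by omega⟩)
      (u := fun j (w : ((Fin (i + 1) → ℕ) × (Fin (i + 1) → ℕ)) × (Finset.range k → ℝ)) =>
        if h : j < k then w.2 ⟨j, Finset.mem_range.2 h⟩ else 0)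
      (fun j => by fun_prop) (fun j => by fun_prop) (fun j => ?_) t x i
    by_cases h : j < k
    · simp only [h, dite_true]
      exact (measurable_pi_apply _).comp measurable_snd
    · simp only [h, dite_false]
      exact measurable_const
  refine ⟨{w | Z w = y} ∩ {w | w.1.1 (Fin.last i) = k},
    (measurableSet_eq_fun hZm measurable_const).inter
      (measurableSet_eq_fun (by fun_prop) measurable_const), ?_⟩
  have key : ∀ ω, Narr (t i) ω = k → Z (gridPast Narr Nsrv U t i k ω) =
      gridQueue pol (fun r => Narr r ω) (fun r => Nsrv r ω) (fun j => U j ω) t x i := by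
    intro ω hk
    refine gridChain_congr pol t x (fun j hj => ?_) (fun j hj => ?_) (fun j hj hlt => ?_)
    · simp [gridPast, min_eq_left hj]
    · simp [gridPast, min_eq_left hj]
    · have h1 : Narr (t (j + 1)) ω ≤ k := by
        rw [← hk]; exact hprim.arrivals.mono ω (htI _) (htI _) (ht hj)
      have h2 : Narr (t j) ω < Narr (t (j + 1)) ω := by
        simpa [gridPast, min_eq_left hj.le, min_eq_left (show j + 1 ≤ i from hj)] using hlt
      have h3 : Narr (t j) ω < k := by omega
      simp [gridPast, min_eq_left hj.le, h3]
  ext ω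
  simp only [mem_inter_iff, mem_preimage, mem_singleton_iff, mem_ofPred_eq]
  constructor
  · rintro ⟨h1, h2⟩
    exact ⟨by rw [key ω h2, h1], by simpa [gridPast] using h2⟩
  · rintro ⟨h1, h2⟩
    have h3 : Narr (t i) ω = k := by simpa [gridPast] using h2
    exact ⟨by rw [← key ω h3, h1], h3⟩

omit [IsProbabilityMeasure P] in
include htI in
theorem IsPrimitives.measurable_U_arrival (i : ℕ) : Measurable fun ω => U (Narr (t i) ω) ω :=
  measurable_comp_nat hprim.measurable_U (hprim.arrivals.measurable _ (htI i))

variable {E : Type*} [NormedAddCommGroup E] [NormedSpace ℝ E] [CompleteSpace E]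

include hadm ht htI hx

/-- Expected contribution of the admissions of one cell of the Euler scheme. -/
theorem IsPrimitives.integral_cell_admission (i : ℕ) (f : ℕ → E) :
    Integrable (fun ω => (((Narr (t (i + 1)) ω : ℝ) - Narr (t i) ω) *
      gridAccept pol (fun r => Narr r ω) (fun r => Nsrv r ω) (fun j => U j ω) t x i) •
      f (gridQueue pol (fun r => Narr r ω) (fun r => Nsrv r ω) (fun j => U j ω) t x i)) P ∧
    ∫ ω, (((Narr (t (i + 1)) ω : ℝ) - Narr (t i) ω) *
      gridAccept pol (fun r => Narr r ω) (fun r => Nsrv r ω) (fun j => U j ω) t x i) •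
      f (gridQueue pol (fun r => Narr r ω) (fun r => Nsrv r ω) (fun j => U j ω) t x i) ∂P =
    ∑ y ∈ Finset.range (M.C + 1), (∫ r in t i..t (i + 1), M.lam r) •
      ((P.real {ω | gridQueue pol (fun r => Narr r ω) (fun r => Nsrv r ω) (fun j => U j ω) t x i
        = y} * pol (t i) y 1) • f y) := by
  set Y : Ω → ℕ := fun ω =>
    gridQueue pol (fun r => Narr r ω) (fun r => Nsrv r ω) (fun j => U j ω) t x i with hY
  have hle := ht (Nat.le_add_right i 1)
  have hYm : Measurable Y := hprim.measurable_gridQueue htI x i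
  have hUm := hprim.measurable_U_arrival htI i
  have hΔ := hprim.arrivals.integrable_incr (htI i).1 hle (htI (i + 1)).2
  set A : ℕ → Set Ω := fun y => {ω | Y ω = y} ∩ {ω | U (Narr (t i) ω) ω ∈ Iio (pol (t i) y 1)}
    with hA
  have hAm : ∀ y, MeasurableSet (A y) := fun y =>
    (hYm (measurableSet_singleton y)).inter (hUm measurableSet_Iio)
  have hae : (fun ω => (((Narr (t (i + 1)) ω : ℝ) - Narr (t i) ω) *
      gridAccept pol (fun r => Narr r ω) (fun r => Nsrv r ω) (fun j => U j ω) t x i) • f (Y ω))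
      =ᵐ[P] fun ω => ∑ y ∈ Finset.range (M.C + 1),
        (A y).indicator (fun ω => (Narr (t (i + 1)) ω : ℝ) - Narr (t i) ω) ω • f y := by
    filter_upwards [hprim.ae_gridQueue_le hadm htI hx] with ω hω
    rw [Finset.sum_eq_single (Y ω)]
    · congr 1
      by_cases h : U (Narr (t i) ω) ω < pol (t i) (Y ω) 1
      · have : ω ∈ A (Y ω) := ⟨rfl, h⟩
        rw [indicator_of_mem this, gridAccept, indicator_of_mem (by exact h)]
        simp
      · have : ω ∉ A (Y ω) := fun h' => h h'.2
        rw [indicator_of_notMem this, gridAccept, indicator_of_notMem (by exact h)]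
        simp
    · intro y _ hy
      rw [indicator_of_notMem (fun h => hy h.1.symm), zero_smul]
    · intro h
      exact absurd (Finset.mem_range.2 (Nat.lt_succ_of_le (hω i))) h
  have hint : ∀ y ∈ Finset.range (M.C + 1), Integrable (fun ω =>
      (A y).indicator (fun ω => (Narr (t (i + 1)) ω : ℝ) - Narr (t i) ω) ω • f y) P :=
    fun y _ => (hΔ.indicator (hAm y)).smul_const _
  refine ⟨(integrable_finsetSum _ hint).congr hae.symm, ?_⟩
  rw [integral_congr_ae hae, integral_finsetSum _ hint]
  refine Finset.sum_congr rfl fun y hy => ?_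
  have hyC : y ≤ M.C := Nat.lt_succ_iff.1 (Finset.mem_range.1 hy)
  have hp0 := hadm.nonneg _ (htI i) y hyC 1
  have hp1 : pol (t i) y 1 ≤ 1 := by
    have := hadm.sum_one _ (htI i) y hyC
    have h0 := hadm.nonneg _ (htI i) y hyC 0
    rw [Fin.sum_univ_two] at this
    linarith
  have hvol : volume.real (Iio (pol (t i) y 1) ∩ Icc 0 1) = pol (t i) y 1 := by
    have : Iio (pol (t i) y 1) ∩ Icc 0 1 = Ico 0 (pol (t i) y 1) := by
      ext v; simp only [mem_inter_iff, mem_Iio, mem_Icc, mem_Ico]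
      constructor
      · rintro ⟨h1, h2, -⟩; exact ⟨h2, h1⟩
      · rintro ⟨h1, h2⟩; exact ⟨h2, h1, by linarith⟩
    rw [this, Real.volume_real_Ico_of_le hp0, sub_zero]
  have h1 := hprim.setIntegral_gridPast ht htI
    (hprim.isGridPast_gridQueue (pol := pol) ht htI x i y)
    (S := Iio (pol (t i) y 1)) measurableSet_Iio (fun p => (p.1 : ℝ))
  simp only [hprim.arrivals.cast_incr (htI i).1 hle (htI (i + 1)).2] at h1
  rw [hvol, hprim.arrivals.integral_incr M.lam_nonneg (htI i).1 hle (htI (i + 1)).2] at h1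
  rw [integral_smul_const, integral_indicator (hAm y), h1, smul_smul]
  congr 1
  ring

/-- Expected contribution of the services of one cell of the Euler scheme. -/
theorem IsPrimitives.integral_cell_service (i : ℕ) (f : ℕ → E) :
    Integrable (fun ω => ((Nsrv (t (i + 1)) ω : ℝ) - Nsrv (t i) ω) •
      f (gridQueue pol (fun r => Narr r ω) (fun r => Nsrv r ω) (fun j => U j ω) t x i)) P ∧
    ∫ ω, ((Nsrv (t (i + 1)) ω : ℝ) - Nsrv (t i) ω) •
      f (gridQueue pol (fun r => Narr r ω) (fun r => Nsrv r ω) (fun j => U j ω) t x i) ∂P =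
    ∑ y ∈ Finset.range (M.C + 1), (∫ r in t i..t (i + 1), M.mu r) •
      (P.real {ω | gridQueue pol (fun r => Narr r ω) (fun r => Nsrv r ω) (fun j => U j ω) t x i
        = y} • f y) := by
  set Y : Ω → ℕ := fun ω =>
    gridQueue pol (fun r => Narr r ω) (fun r => Nsrv r ω) (fun j => U j ω) t x i with hY
  have hle := ht (Nat.le_add_right i 1)
  have hYm : Measurable Y := hprim.measurable_gridQueue htI x i
  have hΔ := hprim.services.integrable_incr (htI i).1 hle (htI (i + 1)).2
  set A : ℕ → Set Ω := fun y => {ω | Y ω = y} with hA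
  have hAm : ∀ y, MeasurableSet (A y) := fun y => hYm (measurableSet_singleton y)
  have hae : (fun ω => ((Nsrv (t (i + 1)) ω : ℝ) - Nsrv (t i) ω) • f (Y ω))
      =ᵐ[P] fun ω => ∑ y ∈ Finset.range (M.C + 1),
        (A y).indicator (fun ω => (Nsrv (t (i + 1)) ω : ℝ) - Nsrv (t i) ω) ω • f y := by
    filter_upwards [hprim.ae_gridQueue_le hadm htI hx] with ω hω
    rw [Finset.sum_eq_single (Y ω)]
    · rw [indicator_of_mem (show ω ∈ A (Y ω) from rfl)]
    · intro y _ hy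
      rw [indicator_of_notMem (fun h => hy h.symm), zero_smul]
    · intro h
      exact absurd (Finset.mem_range.2 (Nat.lt_succ_of_le (hω i))) h
  have hint : ∀ y ∈ Finset.range (M.C + 1), Integrable (fun ω =>
      (A y).indicator (fun ω => (Nsrv (t (i + 1)) ω : ℝ) - Nsrv (t i) ω) ω • f y) P :=
    fun y _ => (hΔ.indicator (hAm y)).smul_const _
  refine ⟨(integrable_finsetSum _ hint).congr hae.symm, ?_⟩
  rw [integral_congr_ae hae, integral_finsetSum _ hint]
  refine Finset.sum_congr rfl fun y hy => ?_
  have h1 := hprim.setIntegral_gridPast ht htI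
    (hprim.isGridPast_gridQueue (pol := pol) ht htI x i y)
    (S := univ) .univ (fun p => (p.2 : ℝ))
  simp only [hprim.services.cast_incr (htI i).1 hle (htI (i + 1)).2, mem_univ, ofPred_true,
    inter_univ, univ_inter] at h1
  rw [Real.volume_real_Icc_of_le zero_le_one,
    hprim.services.integral_incr M.mu_nonneg (htI i).1 hle (htI (i + 1)).2] at h1
  rw [integral_smul_const, integral_indicator (hAm y), h1, smul_smul]
  congr 1
  ring

end Cell

/-! ### Limits along fine grids -/

/-- Two events that agree off `D` differ in probability by at most that of `D`. -/
theorem abs_measureReal_sub_le {Ω : Type*} [MeasurableSpace Ω] {P : Measure Ω} [IsFiniteMeasure P]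
    {A B D : Set Ω} (h : ∀ᵐ ω ∂P, ω ∉ D → (ω ∈ A ↔ ω ∈ B)) :
    |P.real A - P.real B| ≤ P.real D := by
  have key : ∀ A B : Set Ω, (∀ᵐ ω ∂P, ω ∉ D → (ω ∈ A ↔ ω ∈ B)) →
      P.real A ≤ P.real B + P.real D := by
    intro A B h
    refine le_trans ?_ (measureReal_union_le _ _)
    refine ENNReal.toReal_mono (measure_ne_top _ _) (measure_mono_ae ?_)
    filter_upwards [h] with ω hω hA
    by_cases hD : ω ∈ D
    · exact Or.inr hD
    · exact Or.inl ((hω hD).1 hA)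
  rw [abs_le]
  have h1 := key A B h
  have h2 := key B A (h.mono fun ω hω hD => (hω hD).symm)
  constructor <;> linarith

/-- Dominated convergence along a subsequence, when the expectations converge along the whole
sequence. -/
theorem integrable_and_integral_eq_of_subseq {Ω : Type*} [MeasurableSpace Ω] {P : Measure Ω}
    {E : Type*} [NormedAddCommGroup E] [NormedSpace ℝ E] {Z : Ω → E} {Zk : ℕ → Ω → E}
    {ns : ℕ → ℕ} (hns : StrictMono ns) (hm : ∀ k, AEStronglyMeasurable (Zk k) P) {b : Ω → ℝ}
    (hb : Integrable b P) (hbd : ∀ k, ∀ᵐ ω ∂P, ‖Zk k ω‖ ≤ b ω)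
    (hlim : ∀ᵐ ω ∂P, Tendsto (fun j => Zk (ns j) ω) atTop (𝓝 (Z ω))) {c : E}
    (hc : Tendsto (fun k => ∫ ω, Zk k ω ∂P) atTop (𝓝 c)) :
    Integrable Z P ∧ ∫ ω, Z ω ∂P = c := by
  refine ⟨⟨aestronglyMeasurable_of_tendsto_ae atTop (fun j => hm (ns j)) hlim, ?_⟩, ?_⟩
  · refine hb.hasFiniteIntegral.mono' ?_
    filter_upwards [hlim, ae_all_iff.2 hbd] with ω h1 h2
    exact le_of_tendsto h1.norm (.of_forall fun j => h2 (ns j))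
  · exact tendsto_nhds_unique (tendsto_integral_of_dominated_convergence b (fun j => hm (ns j)) hb
      (fun j => hbd (ns j)) hlim) (hc.comp hns.tendsto_atTop)

theorem intervalIntegrable_unifGrid {F : Type*} [NormedAddCommGroup F] {f : ℝ → F} {s e : ℝ}
    (hse : s ≤ e) (hf : IntervalIntegrable f volume s e) (k i : ℕ) :
    IntervalIntegrable f volume (unifGrid s e k i) (unifGrid s e k (i + 1)) := by
  refine hf.mono_set ?_
  rw [uIcc_of_le hse]
  exact ordConnected_Icc.uIcc_subset (unifGrid_mem hse k i) (unifGrid_mem hse k _)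

theorem sum_integral_unifGrid {F : Type*} [NormedAddCommGroup F] [NormedSpace ℝ F] {f : ℝ → F}
    {s e : ℝ} (hse : s ≤ e) (hf : IntervalIntegrable f volume s e) {k : ℕ} (hk : k ≠ 0) :
    ∑ i ∈ Finset.range k, ∫ r in unifGrid s e k i..unifGrid s e k (i + 1), f r =
      ∫ r in s..e, f r := by
  rw [intervalIntegral.sum_integral_adjacent_intervals fun i _ =>
    intervalIntegrable_unifGrid hse hf k i, unifGrid_zero, unifGrid_self hk]

/-- Riemann sums with an integrable weight `w`, for integrands `a k` on the grid that are
uniformly close to `c` on the cells. -/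
theorem tendsto_sum_unifGrid {E₁ E₂ E₃ : Type*} [NormedAddCommGroup E₁] [NormedSpace ℝ E₁]
    [NormedAddCommGroup E₂] [NormedSpace ℝ E₂] [CompleteSpace E₂]
    [NormedAddCommGroup E₃] [NormedSpace ℝ E₃] [CompleteSpace E₃] (L : E₁ →L[ℝ] E₂ →L[ℝ] E₃)
    {s e : ℝ} (hse : s ≤ e) {w : ℝ → E₂} (hw : IntervalIntegrable w volume s e)
    {c : ℝ → E₁} (hc : IntervalIntegrable (fun r => L (c r) (w r)) volume s e) {a : ℕ → ℕ → E₁}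
    (happ : ∀ ε > 0, ∀ᶠ k in atTop, ∀ i < k,
      ∀ r ∈ Icc (unifGrid s e k i) (unifGrid s e k (i + 1)), ‖a k i - c r‖ ≤ ε) :
    Tendsto (fun k => ∑ i ∈ Finset.range k,
        L (a k i) (∫ r in unifGrid s e k i..unifGrid s e k (i + 1), w r)) atTop
      (𝓝 (∫ r in s..e, L (c r) (w r))) := by
  refine Metric.tendsto_atTop.2 fun ε hε => ?_
  set K := ∫ r in s..e, ‖L‖ * ‖w r‖ with hK
  have hK0 : 0 ≤ K := intervalIntegral.integral_nonneg hse fun u _ => by positivity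
  set η := ε / (2 * (K + 1)) with hη
  have hη0 : 0 < η := by positivity
  obtain ⟨k₀, hk₀⟩ := eventually_atTop.1 ((happ η hη0).and (eventually_ne_atTop 0))
  refine ⟨k₀, fun k hk => ?_⟩
  obtain ⟨h1, h2⟩ := hk₀ k hk
  have hwn : IntervalIntegrable (fun r => ‖L‖ * ‖w r‖) volume s e := hw.norm.const_mul _
  rw [dist_eq_norm, ← sum_integral_unifGrid hse hc h2, ← Finset.sum_sub_distrib]
  calc _ ≤ ∑ i ∈ Finset.range k,
        ∫ r in unifGrid s e k i..unifGrid s e k (i + 1), η * (‖L‖ * ‖w r‖) := by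
        refine norm_sum_le_of_le _ fun i hi => ?_
        have hle := unifGrid_mono hse k (Nat.le_add_right i 1)
        rw [← ContinuousLinearMap.intervalIntegral_comp_comm _
            (intervalIntegrable_unifGrid hse hw k i),
          ← intervalIntegral.integral_sub
            (intervalIntegrable_unifGrid hse (f := fun r => L (a k i) (w r))
            ⟨(L (a k i)).integrable_comp hw.1, (L (a k i)).integrable_comp hw.2⟩ k i)
            (intervalIntegrable_unifGrid hse hc k i)]
        refine intervalIntegral.norm_integral_le_of_norm_le hle (.of_forall fun r hr => ?_)
          ((intervalIntegrable_unifGrid hse hwn k i).const_mul η)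
        rw [← _root_.sub_apply, ← map_sub]
        refine (L.le_opNorm₂ _ _).trans ?_
        have := h1 i (Finset.mem_range.1 hi) r ⟨hr.1.le, hr.2⟩
        calc ‖L‖ * ‖a k i - c r‖ * ‖w r‖ ≤ ‖L‖ * η * ‖w r‖ := by gcongr
          _ = η * (‖L‖ * ‖w r‖) := by ring
    _ = η * K := by rw [sum_integral_unifGrid hse (hwn.const_mul η) h2,
        intervalIntegral.integral_const_mul]
    _ ≤ η * (K + 1) := by gcongr; linarith
    _ = ε / 2 := by rw [hη]; field_simp
    _ < ε := by linarith

section State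

variable {Ω : Type*} [MeasurableSpace Ω] {P : Measure Ω} [IsProbabilityMeasure P] {M : Model}
  {Narr Nsrv : ℝ → Ω → ℕ} {U : ℕ → Ω → ℝ} (hprim : IsPrimitives M P Narr Nsrv U)
  {pol : Policy}

omit [IsProbabilityMeasure P] in
theorem stateProb_nonneg (s : ℝ) (x : ℕ) (t : ℝ) (y : ℕ) :
    0 ≤ stateProb P Narr Nsrv U pol s x t y := measureReal_nonneg

theorem stateProb_le_one (s : ℝ) (x : ℕ) (t : ℝ) (y : ℕ) :
    stateProb P Narr Nsrv U pol s x t y ≤ 1 := measureReal_le_one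

include hprim

/-- Some event occurs between two times with probability at most the load between them. -/
theorem IsPrimitives.measureReal_total_ne_le {a b : ℝ} (ha : a ∈ Icc 0 M.T) (hb : b ∈ Icc 0 M.T) :
    P.real {ω | Narr a ω + Nsrv a ω ≠ Narr b ω + Nsrv b ω} ≤ |M.load 0 b - M.load 0 a| := by
  wlog hab : a ≤ b generalizing a b
  · have := this hb ha (le_of_not_ge hab)
    rw [abs_sub_comm]
    simpa only [ne_comm] using this
  have h0 : (0 : ℝ) ∈ Icc 0 M.T := ⟨le_rfl, M.T_pos.le⟩
  rw [← M.load_add h0 ha hb, add_sub_cancel_left, abs_of_nonneg (M.load_nonneg ha hb hab),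
    M.load_eq ha hb]
  refine le_trans (measureReal_mono (s₂ := {ω | 1 ≤ Narr b ω - Narr a ω} ∪
    {ω | 1 ≤ Nsrv b ω - Nsrv a ω}) fun ω hω => ?_) ((measureReal_union_le _ _).trans (add_le_add
    (hprim.arrivals.measureReal_incr_pos M.lam_nonneg ha.1 hab hb.2)
    (hprim.services.measureReal_incr_pos M.mu_nonneg ha.1 hab hb.2)))
  have m1 := hprim.arrivals.mono ω ha hb hab
  have m2 := hprim.services.mono ω ha hb hab
  simp only [mem_union, mem_ofPred_eq] at hω m1 m2 ⊢
  omega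

/-- The transition probabilities are continuous in both times, with the expected number of events
as modulus of continuity. -/
theorem IsPrimitives.abs_stateProb_sub_le {s s' t t' : ℝ} (hs : s ∈ Icc 0 M.T)
    (hs' : s' ∈ Icc 0 M.T) (ht : t ∈ Icc 0 M.T) (ht' : t' ∈ Icc 0 M.T) (x y : ℕ) :
    |stateProb P Narr Nsrv U pol s x t y - stateProb P Narr Nsrv U pol s' x t' y| ≤
      |M.load 0 s' - M.load 0 s| + |M.load 0 t' - M.load 0 t| := by
  refine (abs_measureReal_sub_le (D := {ω | Narr s ω + Nsrv s ω ≠ Narr s' ω + Nsrv s' ω} ∪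
    {ω | Narr t ω + Nsrv t ω ≠ Narr t' ω + Nsrv t' ω}) (.of_forall fun ω hω => ?_)).trans
    ((measureReal_union_le _ _).trans (add_le_add (hprim.measureReal_total_ne_le hs hs')
      (hprim.measureReal_total_ne_le ht ht')))
  simp only [mem_union, mem_ofPred_eq, not_or, not_not] at hω ⊢
  rw [queueLength_congr pol (fun i => U i ω) x (n := fun r => Narr r ω) (m := fun r => Nsrv r ω)
    hω.1 hω.2]

theorem IsPrimitives.continuousOn_stateProb {s : ℝ} (hs : s ∈ Icc 0 M.T) (x y : ℕ) :
    ContinuousOn (fun t => stateProb P Narr Nsrv U pol s x t y) (Icc 0 M.T) := by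
  intro t ht
  have h := (M.load_continuousOn t ht)
  rw [ContinuousWithinAt, tendsto_iff_dist_tendsto_zero] at h ⊢
  refine squeeze_zero' (.of_forall fun _ => dist_nonneg) ?_ h
  filter_upwards [self_mem_nhdsWithin] with r hr
  have := hprim.abs_stateProb_sub_le (pol := pol) hs hs hr ht x y
  rw [sub_self, abs_zero, zero_add] at this
  rw [Real.dist_eq, Real.dist_eq, abs_sub_comm (M.load 0 r)]
  exact this

variable (hadm : IsAdmissible M pol) {s e : ℝ} (hs : 0 ≤ s) (hse : s ≤ e) (he : e ≤ M.T) {x : ℕ}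
  (hx : x ≤ M.C)

include hadm hs hse he hx

/-- The law of the Euler scheme is uniformly close to the law of the queue. -/
theorem IsPrimitives.eventually_abs_gridQueue_sub_le (y : ℕ) {ε : ℝ} (hε : 0 < ε) :
    ∀ᶠ k in atTop, ∀ i < k, ∀ r ∈ Icc (unifGrid s e k i) (unifGrid s e k (i + 1)),
      |P.real {ω | gridQueue pol (fun r => Narr r ω) (fun r => Nsrv r ω) (fun j => U j ω)
        (unifGrid s e k) x i = y} - stateProb P Narr Nsrv U pol s x r y| ≤ ε := by
  have hI : ∀ k i, unifGrid s e k i ∈ Icc 0 M.T := fun k i =>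
    ⟨hs.trans (unifGrid_mem hse k i).1, (unifGrid_mem hse k i).2.trans he⟩
  have hbad := hprim.tendsto_measureReal_not_goodGrid hadm hs hse he
  filter_upwards [hbad.eventually (ge_mem_nhds (half_pos hε)),
    eventually_unifGrid_dist_le hse hs he M.load_continuousOn (half_pos hε)] with k h1 h2 i hi r hr
  have hrI : r ∈ Icc 0 M.T := ⟨(hI k i).1.trans hr.1, hr.2.trans (hI k _).2⟩
  refine (abs_measureReal_sub_le (D := {ω | ¬ GoodGrid pol M.C (fun r => Narr r ω)
      (fun r => Nsrv r ω) (fun j => U j ω) (unifGrid s e k) k} ∪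
    {ω | Narr (unifGrid s e k i) ω + Nsrv (unifGrid s e k i) ω ≠ Narr r ω + Nsrv r ω}) ?_).trans
    ((measureReal_union_le _ _).trans ((add_le_add h1 ((hprim.measureReal_total_ne_le (hI k i)
      hrI).trans (h2 i r hr))).trans (by linarith)))
  filter_upwards [hprim.ae_gridQueue_le hadm (hI k) hx] with ω hle hω
  simp only [mem_union, mem_ofPred_eq, not_or, not_not] at hω ⊢
  have hq := (hω.1.queueLength_eq (hprim.arrivals.isCountingPath ω)
    (hprim.services.isCountingPath ω) (unifGrid_mono hse k) (hI k 0).1 (fun i => (hI k i).2)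
    (fun i _ => hle i) hi.le).1
  rw [unifGrid_zero] at hq
  rw [← hq, queueLength_congr pol (fun i => U i ω) x (n := fun r => Narr r ω)
    (m := fun r => Nsrv r ω) rfl hω.2]

end State

/-! ### Compensators of the admissions and of the services -/

section Path

variable {E : Type*} [NormedAddCommGroup E] [NormedSpace ℝ E]

/-- The integral of `h` against the admissions of the Euler scheme. -/
noncomputable def gridAdmissionSum (pol : Policy) (n m : ℝ → ℕ) (u : ℕ → ℝ) (t : ℕ → ℝ) (x k : ℕ)
    (h : ℝ → ℕ → E) : E :=
  ∑ i ∈ Finset.range k, (((n (t (i + 1)) : ℝ) - n (t i)) * gridAccept pol n m u t x i) •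
    h (t i) (gridQueue pol n m u t x i)

/-- The integral of `f` against the services of the Euler scheme. -/
noncomputable def gridServiceSum (pol : Policy) (n m : ℝ → ℕ) (u : ℕ → ℝ) (t : ℕ → ℝ) (x k : ℕ)
    (f : ℕ → E) : E :=
  ∑ i ∈ Finset.range k, ((m (t (i + 1)) : ℝ) - m (t i)) • f (gridQueue pol n m u t x i)

theorem gridAccept_mem (pol : Policy) (n m : ℝ → ℕ) (u : ℕ → ℝ) (t : ℕ → ℝ) (x i : ℕ) :
    gridAccept pol n m u t x i ∈ Icc (0 : ℝ) 1 := by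
  unfold gridAccept
  by_cases h : u (n (t i)) ∈ Iio (pol (t i) (gridQueue pol n m u t x i) 1)
  · rw [indicator_of_mem h]; simp
  · rw [indicator_of_notMem h]; simp

theorem norm_sum_smul_le_mul_sub {w : ℕ → ℝ} (hw : Monotone w) {a : ℕ → ℝ}
    {v : ℕ → E} {B : ℝ} {k : ℕ} (ha : ∀ i < k, a i ∈ Icc (0 : ℝ) 1)
    (hv : ∀ i < k, w i < w (i + 1) → ‖v i‖ ≤ B) :
    ‖∑ i ∈ Finset.range k, ((w (i + 1) - w i) * a i) • v i‖ ≤ B * (w k - w 0) := by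
  rw [← Finset.sum_range_sub, Finset.mul_sum]
  refine norm_sum_le_of_le _ fun i hi => ?_
  have hi := Finset.mem_range.1 hi
  have h1 : 0 ≤ w (i + 1) - w i := sub_nonneg.2 (hw (Nat.le_add_right i 1))
  rw [norm_smul, Real.norm_of_nonneg (mul_nonneg h1 (ha i hi).1)]
  rcases h1.eq_or_lt with h0 | h0
  · rw [← h0]; simp
  · have hB := hv i hi (sub_pos.1 h0)
    calc (w (i + 1) - w i) * a i * ‖v i‖ ≤ (w (i + 1) - w i) * 1 * B := by
          gcongr
          exact (ha i hi).2
      _ = B * (w (i + 1) - w i) := by ring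

variable {T : ℝ} {C : ℕ} {n m : ℝ → ℕ} {pol : Policy} {u : ℕ → ℝ} {t : ℕ → ℝ} {x k : ℕ}

/-- On a good grid, the integral against the admissions and that of the Euler scheme differ only by
the oscillation of the integrand on the cells. -/
theorem GoodGrid.norm_jumpIntegral_sub_le (hn : IsCountingPath T n) (hm : IsCountingPath T m)
    (ht : Monotone t) (ht0 : 0 ≤ t 0) (htT : ∀ i, t i ≤ T) (hg : GoodGrid pol C n m u t k)
    (hle : ∀ i ≤ k, gridQueue pol n m u t x i ≤ C) {h : ℝ → ℕ → E} {ε : ℝ}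
    (hε : ∀ y ≤ C, ∀ i < k, ∀ r ∈ Icc (t i) (t (i + 1)), ‖h r y - h (t i) y‖ ≤ ε) :
    ‖jumpIntegral (fun r => h r (Function.leftLim (queueLength pol n m u (t 0) x) r))
        (admitted pol n m u (t 0) x) (t 0) (t k) - gridAdmissionSum pol n m u t x k h‖
      ≤ ε * (n (t k) - n (t 0)) := by
  obtain ⟨τ, hτ, hsum⟩ := hg.jumpIntegral_eq hn hm ht ht0 htT hle
  have htI : ∀ i, t i ∈ Icc 0 T := fun i => ⟨ht0.trans (ht (Nat.zero_le i)), htT i⟩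
  have hw : Monotone fun i => (n (t i) : ℝ) := fun i j hij =>
    Nat.cast_le.2 (hn.mono (htI i) (htI j) (ht hij))
  rw [hsum, gridAdmissionSum, ← Finset.sum_sub_distrib]
  simp only [← smul_sub]
  refine norm_sum_smul_le_mul_sub hw (fun i _ => gridAccept_mem _ _ _ _ _ _ _) fun i hi hlt => ?_
  obtain ⟨h1, h2, -⟩ := hτ i hi
  rw [(h2 (Nat.cast_lt.1 hlt)).2]
  exact hε _ (hle i hi.le) i hi _ h1

end Path

section Limits

variable {Ω : Type*} [MeasurableSpace Ω] {P : Measure Ω} [IsProbabilityMeasure P] {M : Model}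
  {Narr Nsrv : ℝ → Ω → ℕ} {U : ℕ → Ω → ℝ} (hprim : IsPrimitives M P Narr Nsrv U)
  {pol : Policy} (hadm : IsAdmissible M pol) {s e : ℝ} (hs : 0 ≤ s) (hse : s ≤ e) (he : e ≤ M.T)
  {x : ℕ} (hx : x ≤ M.C) {E : Type*} [NormedAddCommGroup E] [NormedSpace ℝ E] [CompleteSpace E]

theorem exists_forall_norm_le {T : ℝ} (C : ℕ) {E : Type*} [NormedAddCommGroup E] {h : ℝ → ℕ → E}
    (hh : ∀ y ≤ C, ContinuousOn (fun r => h r y) (Icc 0 T)) :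
    ∃ B : ℝ, 0 ≤ B ∧ ∀ y ≤ C, ∀ r ∈ Icc 0 T, ‖h r y‖ ≤ B := by
  have : ∀ y, ∃ B : ℝ, y ≤ C → ∀ r ∈ Icc 0 T, ‖h r y‖ ≤ B := by
    intro y
    by_cases hy : y ≤ C
    · obtain ⟨B, hB⟩ := isCompact_Icc.exists_bound_of_continuousOn (hh y hy)
      exact ⟨B, fun _ => hB⟩
    · exact ⟨0, fun h => absurd h hy⟩
  choose B hB using this
  refine ⟨∑ y ∈ Finset.range (C + 1), |B y|, Finset.sum_nonneg fun _ _ => abs_nonneg _,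
    fun y hy r hr => ((hB y hy r hr).trans (le_abs_self _)).trans ?_⟩
  exact Finset.single_le_sum (f := fun y => |B y|) (fun _ _ => abs_nonneg _)
    (Finset.mem_range.2 (by omega))

include hprim hadm hs hse he hx

omit [CompleteSpace E] in
/-- Uniform approximation by the Euler scheme of the integrands of the compensators. -/
theorem IsPrimitives.eventually_gridQueue_smul {y : ℕ} {F : ℝ → E}
    (hF : ContinuousOn F (Icc 0 M.T)) {ε : ℝ} (hε : 0 < ε) :
    ∀ᶠ k in atTop, ∀ i < k, ∀ r ∈ Icc (unifGrid s e k i) (unifGrid s e k (i + 1)),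
      ‖P.real {ω | gridQueue pol (fun r => Narr r ω) (fun r => Nsrv r ω) (fun j => U j ω)
        (unifGrid s e k) x i = y} • F (unifGrid s e k i)
        - stateProb P Narr Nsrv U pol s x r y • F r‖ ≤ ε := by
  obtain ⟨B, hB⟩ := isCompact_Icc.exists_bound_of_continuousOn hF
  have h0 : (0 : ℝ) ∈ Icc 0 M.T := ⟨le_rfl, M.T_pos.le⟩
  have hB0 : 0 ≤ B := (norm_nonneg _).trans (hB 0 h0)
  filter_upwards [hprim.eventually_abs_gridQueue_sub_le hadm hs hse he hx y
    (show 0 < ε / (2 * (B + 1)) by positivity),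
    eventually_unifGrid_dist_le hse hs he hF (half_pos hε)] with k h1 h2 i hi r hr
  have hI : unifGrid s e k i ∈ Icc 0 M.T :=
    ⟨hs.trans (unifGrid_mem hse k i).1, (unifGrid_mem hse k i).2.trans he⟩
  have h3 := h1 i hi r hr
  have h4 := h2 i r hr
  rw [dist_comm, dist_eq_norm] at h4
  set p := P.real {ω | gridQueue pol (fun r => Narr r ω) (fun r => Nsrv r ω) (fun j => U j ω)
        (unifGrid s e k) x i = y}
  set q := stateProb P Narr Nsrv U pol s x r y with hq
  have hq0 : 0 ≤ q := stateProb_nonneg _ _ _ _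
  have hq1 : q ≤ 1 := stateProb_le_one _ _ _ _
  have h5 : p • F (unifGrid s e k i) - q • F r =
      (p - q) • F (unifGrid s e k i) + q • (F (unifGrid s e k i) - F r) := by
    rw [sub_smul, smul_sub]; abel
  rw [h5]
  calc _ ≤ |p - q| * ‖F (unifGrid s e k i)‖ + q * ‖F (unifGrid s e k i) - F r‖ := by
        refine (norm_add_le _ _).trans ?_
        rw [norm_smul, norm_smul, Real.norm_eq_abs, Real.norm_of_nonneg hq0]
    _ ≤ ε / (2 * (B + 1)) * B + 1 * (ε / 2) := by
        gcongr
        exact hB _ hI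
    _ ≤ ε / (2 * (B + 1)) * (B + 1) + 1 * (ε / 2) := by gcongr; linarith
    _ = ε := by field_simp; norm_num

/-- The expected integrals against the admissions of the Euler scheme converge. -/
theorem IsPrimitives.tendsto_integral_gridAdmissionSum {h : ℝ → ℕ → E}
    (hh : ∀ y ≤ M.C, ContinuousOn (fun r => h r y) (Icc 0 M.T)) :
    Tendsto (fun k => ∫ ω, gridAdmissionSum pol (fun r => Narr r ω) (fun r => Nsrv r ω)
        (fun j => U j ω) (unifGrid s e k) x k h ∂P) atTop
      (𝓝 (∫ r in s..e, ∑ y ∈ Finset.range (M.C + 1),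
        M.lam r • ((stateProb P Narr Nsrv U pol s x r y * pol r y 1) • h r y))) := by
  have hI : ∀ k i, unifGrid s e k i ∈ Icc 0 M.T := fun k i =>
    ⟨hs.trans (unifGrid_mem hse k i).1, (unifGrid_mem hse k i).2.trans he⟩
  have hsI : s ∈ Icc 0 M.T := ⟨hs, hse.trans he⟩
  have heI : e ∈ Icc 0 M.T := ⟨hs.trans hse, he⟩
  have huIcc : uIcc s e ⊆ Icc 0 M.T := ordConnected_Icc.uIcc_subset hsI heI
  have hF : ∀ y ∈ Finset.range (M.C + 1), ContinuousOn (fun r => pol r y 1 • h r y) (Icc 0 M.T) :=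
    fun y hy => (hadm.cont y (Nat.lt_succ_iff.1 (Finset.mem_range.1 hy)) 1).smul
      (hh y (Nat.lt_succ_iff.1 (Finset.mem_range.1 hy)))
  have hlam := M.lam_intervalIntegrable hsI heI
  have hint : ∀ y ∈ Finset.range (M.C + 1), IntervalIntegrable (fun r =>
      M.lam r • ((stateProb P Narr Nsrv U pol s x r y * pol r y 1) • h r y)) volume s e := by
    intro y hy
    refine hlam.smul_continuousOn ?_
    simp only [mul_smul]
    exact ((hprim.continuousOn_stateProb hsI x y).smul (hF y hy)).mono huIcc
  rw [intervalIntegral.integral_finsetSum hint]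
  have heq : ∀ k, ∫ ω, gridAdmissionSum pol (fun r => Narr r ω) (fun r => Nsrv r ω)
        (fun j => U j ω) (unifGrid s e k) x k h ∂P = ∑ y ∈ Finset.range (M.C + 1),
      ∑ i ∈ Finset.range k, (ContinuousLinearMap.lsmul ℝ ℝ).flip
        (P.real {ω | gridQueue pol (fun r => Narr r ω) (fun r => Nsrv r ω) (fun j => U j ω)
        (unifGrid s e k) x i = y} • (pol (unifGrid s e k i) y 1 • h (unifGrid s e k i) y))
        (∫ r in unifGrid s e k i..unifGrid s e k (i + 1), M.lam r) := by
    intro k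
    rw [Finset.sum_comm]
    unfold gridAdmissionSum
    rw [integral_finsetSum _ fun i _ => (hprim.integral_cell_admission hadm
      (unifGrid_mono hse k) (hI k) hx i (h (unifGrid s e k i))).1]
    refine Finset.sum_congr rfl fun i _ => ?_
    rw [(hprim.integral_cell_admission hadm
      (unifGrid_mono hse k) (hI k) hx i (h (unifGrid s e k i))).2]
    refine Finset.sum_congr rfl fun y _ => ?_
    simp only [ContinuousLinearMap.flip_apply, ContinuousLinearMap.lsmul_apply, mul_smul]
  simp only [heq]
  refine tendsto_finsetSum _ fun y hy => ?_
  have := tendsto_sum_unifGrid (ContinuousLinearMap.lsmul ℝ ℝ).flip hse hlam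
    (c := fun r => stateProb P Narr Nsrv U pol s x r y • (pol r y 1 • h r y))
    (by simpa only [ContinuousLinearMap.flip_apply, ContinuousLinearMap.lsmul_apply, mul_smul]
          using hint y hy)
    (fun ε hε => hprim.eventually_gridQueue_smul hadm hs hse he hx (hF y hy) hε)
  simpa only [ContinuousLinearMap.flip_apply, ContinuousLinearMap.lsmul_apply, mul_smul] using this

/-- The expected integrals against the services of the Euler scheme converge. -/
theorem IsPrimitives.tendsto_integral_gridServiceSum (f : ℕ → E) :
    Tendsto (fun k => ∫ ω, gridServiceSum pol (fun r => Narr r ω) (fun r => Nsrv r ω)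
        (fun j => U j ω) (unifGrid s e k) x k f ∂P) atTop
      (𝓝 (∫ r in s..e, ∑ y ∈ Finset.range (M.C + 1),
        M.mu r • (stateProb P Narr Nsrv U pol s x r y • f y))) := by
  have hI : ∀ k i, unifGrid s e k i ∈ Icc 0 M.T := fun k i =>
    ⟨hs.trans (unifGrid_mem hse k i).1, (unifGrid_mem hse k i).2.trans he⟩
  have hsI : s ∈ Icc 0 M.T := ⟨hs, hse.trans he⟩
  have heI : e ∈ Icc 0 M.T := ⟨hs.trans hse, he⟩
  have huIcc : uIcc s e ⊆ Icc 0 M.T := ordConnected_Icc.uIcc_subset hsI heI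
  have hmu := M.mu_intervalIntegrable hsI heI
  have hint : ∀ y ∈ Finset.range (M.C + 1), IntervalIntegrable (fun r =>
      M.mu r • (stateProb P Narr Nsrv U pol s x r y • f y)) volume s e := fun y hy =>
    hmu.smul_continuousOn (((hprim.continuousOn_stateProb hsI x y).smul
      continuousOn_const).mono huIcc)
  rw [intervalIntegral.integral_finsetSum hint]
  have heq : ∀ k, ∫ ω, gridServiceSum pol (fun r => Narr r ω) (fun r => Nsrv r ω)
        (fun j => U j ω) (unifGrid s e k) x k f ∂P = ∑ y ∈ Finset.range (M.C + 1),
      ∑ i ∈ Finset.range k, (ContinuousLinearMap.lsmul ℝ ℝ).flip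
        (P.real {ω | gridQueue pol (fun r => Narr r ω) (fun r => Nsrv r ω) (fun j => U j ω)
        (unifGrid s e k) x i = y} • f y)
        (∫ r in unifGrid s e k i..unifGrid s e k (i + 1), M.mu r) := by
    intro k
    rw [Finset.sum_comm]
    unfold gridServiceSum
    rw [integral_finsetSum _ fun i _ => (hprim.integral_cell_service hadm
      (unifGrid_mono hse k) (hI k) hx i f).1]
    refine Finset.sum_congr rfl fun i _ => ?_
    rw [(hprim.integral_cell_service hadm (unifGrid_mono hse k) (hI k) hx i f).2]
    simp only [ContinuousLinearMap.flip_apply, ContinuousLinearMap.lsmul_apply]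
  simp only [heq]
  refine tendsto_finsetSum _ fun y hy => ?_
  have := tendsto_sum_unifGrid (ContinuousLinearMap.lsmul ℝ ℝ).flip hse hmu
    (c := fun r => stateProb P Narr Nsrv U pol s x r y • f y)
    (by simpa only [ContinuousLinearMap.flip_apply, ContinuousLinearMap.lsmul_apply]
          using hint y hy)
    (fun ε hε => hprim.eventually_gridQueue_smul hadm hs hse he hx
      (continuousOn_const (c := f y)) hε)
  simpa only [ContinuousLinearMap.flip_apply, ContinuousLinearMap.lsmul_apply] using this

/-- The expected integral of a function of the left limits of the queue against the admissions is
the time integral against the admission rate. -/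
theorem IsPrimitives.integral_jumpIntegral {h : ℝ → ℕ → E}
    (hh : ∀ y ≤ M.C, ContinuousOn (fun r => h r y) (Icc 0 M.T)) :
    Integrable (fun ω => jumpIntegral (fun r => h r (Function.leftLim (queueLength pol
        (fun r => Narr r ω) (fun r => Nsrv r ω) (fun i => U i ω) s x) r))
      (admitted pol (fun r => Narr r ω) (fun r => Nsrv r ω) (fun i => U i ω) s x) s e) P ∧
    ∫ ω, jumpIntegral (fun r => h r (Function.leftLim (queueLength pol
        (fun r => Narr r ω) (fun r => Nsrv r ω) (fun i => U i ω) s x) r))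
      (admitted pol (fun r => Narr r ω) (fun r => Nsrv r ω) (fun i => U i ω) s x) s e ∂P =
    ∫ r in s..e, ∑ y ∈ Finset.range (M.C + 1),
        M.lam r • ((stateProb P Narr Nsrv U pol s x r y * pol r y 1) • h r y) := by
  have hI : ∀ k i, unifGrid s e k i ∈ Icc 0 M.T := fun k i =>
    ⟨hs.trans (unifGrid_mem hse k i).1, (unifGrid_mem hse k i).2.trans he⟩
  obtain ⟨B, hB0, hB⟩ := exists_forall_norm_le M.C hh
  obtain ⟨ns, hns, hgood⟩ := hprim.exists_subseq_goodGrid hadm hs hse he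
  refine integrable_and_integral_eq_of_subseq hns (fun k => ?_)
    (b := fun ω => B * ((Narr e ω : ℝ) - Narr s ω)) ?_ (fun k => ?_) ?_
    (hprim.tendsto_integral_gridAdmissionSum hadm hs hse he hx hh)
  · exact (integrable_finsetSum _ fun i _ => (hprim.integral_cell_admission hadm
      (unifGrid_mono hse k) (hI k) hx i (h (unifGrid s e k i))).1).aestronglyMeasurable
  · exact (hprim.arrivals.integrable_incr hs hse he).const_mul B
  · filter_upwards [hprim.ae_gridQueue_le hadm (hI k) hx] with ω hle
    have hmono := (hprim.arrivals.isCountingPath ω).mono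
    refine (norm_sum_smul_le_mul_sub (B := B) (w := fun i => (Narr (unifGrid s e k i) ω : ℝ))
      (fun i j hij => Nat.cast_le.2 (hmono (hI k i) (hI k j) (unifGrid_mono hse k hij)))
      (fun i _ => gridAccept_mem _ _ _ _ _ _ _) fun i _ _ => hB _ (hle i) _ (hI k i)).trans ?_
    have h1 : Narr (unifGrid s e k k) ω ≤ Narr e ω := hmono (hI k k)
      ⟨hs.trans hse, he⟩ (unifGrid_mem hse k k).2
    rw [unifGrid_zero]
    have : (Narr (unifGrid s e k k) ω : ℝ) ≤ Narr e ω := by exact_mod_cast h1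
    gcongr
  · have hleall : ∀ᵐ ω ∂P, ∀ k i, gridQueue pol (fun r => Narr r ω) (fun r => Nsrv r ω)
        (fun j => U j ω) (unifGrid s e k) x i ≤ M.C :=
      ae_all_iff.2 fun k => hprim.ae_gridQueue_le hadm (hI k) hx
    filter_upwards [hgood, hleall] with ω hω hle
    refine Metric.tendsto_atTop'.2 fun ε hε => ?_
    set D := (Narr e ω : ℝ) - Narr s ω with hD
    have hD0 : 0 ≤ D := sub_nonneg.2 (Nat.cast_le.2
      ((hprim.arrivals.isCountingPath ω).mono ⟨hs, hse.trans he⟩ ⟨hs.trans hse, he⟩ hse))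
    have hη : 0 < ε / (2 * (D + 1)) := by positivity
    have h2 : ∀ᶠ k in atTop, ∀ y ∈ Finset.range (M.C + 1), ∀ i,
        ∀ r ∈ Icc (unifGrid s e k i) (unifGrid s e k (i + 1)),
        dist (h r y) (h (unifGrid s e k i) y) ≤ ε / (2 * (D + 1)) := by
      rw [Filter.eventually_all_finset]
      intro y hy
      exact eventually_unifGrid_dist_le hse hs he
        (hh y (Nat.lt_succ_iff.1 (Finset.mem_range.1 hy))) hη
    obtain ⟨j₀, hj₀⟩ := eventually_atTop.1 (hω.and (hns.tendsto_atTop.eventually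
      (h2.and (eventually_ne_atTop 0))))
    refine ⟨j₀, fun j hj => ?_⟩
    obtain ⟨hg, hmod, hne⟩ := hj₀ j hj.le
    have key := hg.norm_jumpIntegral_sub_le (hprim.arrivals.isCountingPath ω)
      (hprim.services.isCountingPath ω) (unifGrid_mono hse (ns j)) (hI _ 0).1
      (fun i => (hI _ i).2) (x := x) (fun i _ => hle _ i) (h := h) (ε := ε / (2 * (D + 1)))
      (fun y hy i _ r hr => by
        rw [← dist_eq_norm]; exact hmod y (Finset.mem_range.2 (by omega)) i r hr)
    rw [unifGrid_zero, unifGrid_self hne] at key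
    rw [dist_comm, dist_eq_norm]
    calc _ ≤ ε / (2 * (D + 1)) * D := key
      _ ≤ ε / (2 * (D + 1)) * (D + 1) := by gcongr; linarith
      _ = ε / 2 := by field_simp
      _ < ε := by linarith

end Limits

/-! ### Expectations of functionals of the queue -/

/-- A function that equals `F₁` up to time `τ` and `F₂` afterwards is integrated like `F₁`, up to an
error proportional to `b - τ`. -/
theorem intervalIntegral_of_eq_on_pieces {E : Type*} [NormedAddCommGroup E] [NormedSpace ℝ E]
    {F F₁ F₂ : ℝ → E} {a τ b B : ℝ} (haτ : a ≤ τ) (hτb : τ ≤ b)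
    (h1 : IntervalIntegrable F₁ volume a b) (h2 : IntervalIntegrable F₂ volume a b)
    (e1 : ∀ r ∈ Ioc a τ, F r = F₁ r) (e2 : ∀ r ∈ Ioc τ b, F r = F₂ r)
    (b1 : ∀ r ∈ Icc a b, ‖F₁ r‖ ≤ B) (b2 : ∀ r ∈ Icc a b, ‖F₂ r‖ ≤ B) :
    IntervalIntegrable F volume a b ∧
      ‖(∫ r in a..b, F r) - ∫ r in a..b, F₁ r‖ ≤ 2 * B * (b - τ) := by
  have m1 : uIcc a τ ⊆ uIcc a b := by
    rw [uIcc_of_le haτ, uIcc_of_le (haτ.trans hτb)]; exact Icc_subset_Icc_right hτb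
  have m2 : uIcc τ b ⊆ uIcc a b := by
    rw [uIcc_of_le hτb, uIcc_of_le (haτ.trans hτb)]; exact Icc_subset_Icc_left haτ
  have i1 : IntervalIntegrable F volume a τ := (h1.mono_set m1).congr (by
    rw [uIoc_of_le haτ]; exact fun r hr => (e1 r hr).symm)
  have i2 : IntervalIntegrable F volume τ b := (h2.mono_set m2).congr (by
    rw [uIoc_of_le hτb]; exact fun r hr => (e2 r hr).symm)
  refine ⟨i1.trans i2, ?_⟩
  rw [← intervalIntegral.integral_add_adjacent_intervals i1 i2,
    ← intervalIntegral.integral_add_adjacent_intervals (h1.mono_set m1) (h1.mono_set m2),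
    intervalIntegral.integral_congr_ae (g := F₁) (.of_forall (by
      rw [uIoc_of_le haτ]; exact e1)),
    add_sub_add_left_eq_sub, ← intervalIntegral.integral_sub i2 (h1.mono_set m2)]
  refine (intervalIntegral.norm_integral_le_of_norm_le_const (C := 2 * B) fun r hr => ?_).trans
    (by rw [abs_of_nonneg (sub_nonneg.2 hτb)])
  rw [uIoc_of_le hτb] at hr
  have hr' : r ∈ Icc a b := ⟨haτ.trans hr.1.le, hr.2⟩
  rw [e2 r hr, two_mul]
  exact (norm_sub_le _ _).trans (add_le_add (b2 r hr') (b1 r hr'))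

section Path

variable {E : Type*} [NormedAddCommGroup E] [NormedSpace ℝ E]
  {T : ℝ} {C : ℕ} {n m : ℝ → ℕ} {pol : Policy} {u : ℕ → ℝ} {t : ℕ → ℝ} {x k : ℕ}

/-- On a resolved path, the queue differs from the Euler scheme in cells with an event only. -/
theorem GoodGrid.norm_integral_sub_le (hn : IsCountingPath T n) (hm : IsCountingPath T m)
    (ht : Monotone t) (ht0 : 0 ≤ t 0) (htT : ∀ i, t i ≤ T) (hg : GoodGrid pol C n m u t k)
    (hle : ∀ i ≤ k, gridQueue pol n m u t x i ≤ C) {g : ℝ → ℕ → E} {B δ : ℝ}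
    (hint : ∀ y ≤ C, ∀ i < k, IntervalIntegrable (fun r => g r y) volume (t i) (t (i + 1)))
    (hB : ∀ y ≤ C, ∀ r ∈ Icc 0 T, ‖g r y‖ ≤ B) (hδ : ∀ i < k, t (i + 1) - t i ≤ δ) :
    IntervalIntegrable (fun r => g r (Function.leftLim (queueLength pol n m u (t 0) x) r))
      volume (t 0) (t k) ∧
    ‖(∫ r in t 0..t k, g r (Function.leftLim (queueLength pol n m u (t 0) x) r)) -
        ∑ i ∈ Finset.range k, ∫ r in t i..t (i + 1), g r (gridQueue pol n m u t x i)‖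
      ≤ 2 * B * δ * (((n (t k) : ℝ) - n (t 0)) + ((m (t k) : ℝ) - m (t 0))) := by
  have htI : ∀ i, t i ∈ Icc 0 T := fun i => ⟨ht0.trans (ht (Nat.zero_le i)), htT i⟩
  have hB0 : 0 ≤ B := (norm_nonneg _).trans (hB 0 (Nat.zero_le _) _ (htI 0))
  have cell : ∀ i < k,
      IntervalIntegrable (fun r => g r (Function.leftLim (queueLength pol n m u (t 0) x) r))
        volume (t i) (t (i + 1)) ∧
      ‖(∫ r in t i..t (i + 1), g r (Function.leftLim (queueLength pol n m u (t 0) x) r)) -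
        ∫ r in t i..t (i + 1), g r (gridQueue pol n m u t x i)‖
      ≤ 2 * B * δ * (((n (t (i + 1)) + m (t (i + 1)) : ℕ) : ℝ) -
        ((n (t i) + m (t i) : ℕ) : ℝ)) := by
    intro i hi
    obtain ⟨τ, hτ, e1, e2, e3⟩ := hg.leftLim_queueLength hn hm ht ht0 htT hle hi
    have hsub : Icc (t i) (t (i + 1)) ⊆ Icc 0 T := Icc_subset_Icc (htI i).1 (htI _).2
    obtain ⟨h1, h2⟩ := intervalIntegral_of_eq_on_pieces
      (F := fun r => g r (Function.leftLim (queueLength pol n m u (t 0) x) r)) hτ.1 hτ.2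
      (hint _ (hle i hi.le) i hi) (hint _ (hle (i + 1) hi) i hi)
      (fun r hr => by rw [e1 r hr]) (fun r hr => by rw [e2 r hr])
      (fun r hr => hB _ (hle i hi.le) r (hsub hr))
      (fun r hr => hB _ (hle (i + 1) hi) r (hsub hr))
    refine ⟨h1, h2.trans ?_⟩
    have hmono : n (t i) + m (t i) ≤ n (t (i + 1)) + m (t (i + 1)) :=
      add_le_add (hn.mono (htI i) (htI _) (ht (Nat.le_add_right i 1)))
        (hm.mono (htI i) (htI _) (ht (Nat.le_add_right i 1)))
    rcases hmono.eq_or_lt with h0 | h0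
    · rw [e3 h0.symm, h0]; simp
    · have h4 : ((n (t i) + m (t i) : ℕ) : ℝ) + 1 ≤ ((n (t (i + 1)) + m (t (i + 1)) : ℕ) : ℝ) := by
        exact_mod_cast h0
      have h5 := hδ i hi
      have h6 := ht (Nat.le_add_right i 1)
      calc 2 * B * (t (i + 1) - τ) ≤ 2 * B * δ * 1 := by
            rw [mul_one]
            gcongr
            linarith [hτ.1]
        _ ≤ _ := by
            have : 0 ≤ δ := by linarith
            gcongr
            linarith
  refine ⟨IntervalIntegrable.trans_iterate fun i hi => (cell i hi).1, ?_⟩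
  rw [← intervalIntegral.sum_integral_adjacent_intervals fun i hi => (cell i hi).1,
    ← Finset.sum_sub_distrib]
  refine (norm_sum_le_of_le _ fun i hi => (cell i (Finset.mem_range.1 hi)).2).trans ?_
  rw [← Finset.mul_sum, Finset.sum_range_sub (fun i => ((n (t i) + m (t i) : ℕ) : ℝ))]
  push_cast
  apply le_of_eq
  ring

end Path

section Expect

variable {Ω : Type*} [MeasurableSpace Ω] {P : Measure Ω} [IsProbabilityMeasure P] {M : Model}
  {Narr Nsrv : ℝ → Ω → ℕ} {U : ℕ → Ω → ℝ} (hprim : IsPrimitives M P Narr Nsrv U)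
  {pol : Policy} (hadm : IsAdmissible M pol) {s e : ℝ} (hs : 0 ≤ s) (hse : s ≤ e) (he : e ≤ M.T)
  {x : ℕ} (hx : x ≤ M.C) {E : Type*} [NormedAddCommGroup E] [NormedSpace ℝ E] [CompleteSpace E]

include hprim hadm hs hse he hx

/-- Almost every path is eventually resolved by a sequence of uniform grids, and its queue at the
end of the interval is given by the Euler scheme. -/
theorem IsPrimitives.exists_subseq_queueLength_eq : ∃ ns : ℕ → ℕ, StrictMono ns ∧
    ∀ᵐ ω ∂P, ∀ᶠ j in atTop,
      GoodGrid pol M.C (fun r => Narr r ω) (fun r => Nsrv r ω)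
        (fun j => U j ω) (unifGrid s e (ns j)) (ns j) ∧ ns j ≠ 0 ∧
      (∀ i, gridQueue pol (fun r => Narr r ω) (fun r => Nsrv r ω) (fun j => U j ω)
        (unifGrid s e (ns j)) x i ≤ M.C) ∧
      queueLength pol (fun r => Narr r ω) (fun r => Nsrv r ω) (fun i => U i ω) s x e =
        gridQueue pol (fun r => Narr r ω) (fun r => Nsrv r ω) (fun j => U j ω)
          (unifGrid s e (ns j)) x (ns j) := by
  obtain ⟨ns, hns, hgood⟩ := hprim.exists_subseq_goodGrid hadm hs hse he
  have hI : ∀ k i, unifGrid s e k i ∈ Icc 0 M.T := fun k i =>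
    ⟨hs.trans (unifGrid_mem hse k i).1, (unifGrid_mem hse k i).2.trans he⟩
  have hleall : ∀ᵐ ω ∂P, ∀ k i, gridQueue pol (fun r => Narr r ω) (fun r => Nsrv r ω)
      (fun j => U j ω) (unifGrid s e k) x i ≤ M.C :=
    ae_all_iff.2 fun k => hprim.ae_gridQueue_le hadm (hI k) hx
  refine ⟨ns, hns, ?_⟩
  filter_upwards [hgood, hleall] with ω hω hle
  filter_upwards [hω, hns.tendsto_atTop.eventually (eventually_ne_atTop 0)] with j hg hne
  refine ⟨hg, hne, hle _, ?_⟩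
  have := (hg.queueLength_eq (hprim.arrivals.isCountingPath ω)
      (hprim.services.isCountingPath ω) (unifGrid_mono hse (ns j)) (hI _ 0).1
      (fun i => (hI _ i).2) (x₀ := x) (fun i _ => hle _ i) le_rfl).1
  rwa [unifGrid_zero, unifGrid_self hne] at this

theorem IsPrimitives.ae_queueLength_le : ∀ᵐ ω ∂P,
    queueLength pol (fun r => Narr r ω) (fun r => Nsrv r ω) (fun i => U i ω) s x e ≤ M.C := by
  obtain ⟨ns, -, h⟩ := hprim.exists_subseq_queueLength_eq hadm hs hse he hx
  filter_upwards [h] with ω hω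
  obtain ⟨j, -, -, h1, h2⟩ := hω.exists
  rw [h2]
  exact h1 _

theorem IsPrimitives.aestronglyMeasurable_queueLength : AEStronglyMeasurable (fun ω =>
    queueLength pol (fun r => Narr r ω) (fun r => Nsrv r ω) (fun i => U i ω) s x e) P := by
  obtain ⟨ns, -, h⟩ := hprim.exists_subseq_queueLength_eq hadm hs hse he hx
  have hI : ∀ k i, unifGrid s e k i ∈ Icc 0 M.T := fun k i =>
    ⟨hs.trans (unifGrid_mem hse k i).1, (unifGrid_mem hse k i).2.trans he⟩
  refine aestronglyMeasurable_of_tendsto_ae atTop (f := fun j ω => gridQueue pol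
    (fun r => Narr r ω) (fun r => Nsrv r ω) (fun j => U j ω) (unifGrid s e (ns j)) x (ns j))
    (fun j =>
      (hprim.measurable_gridQueue (hI (ns j)) x (ns j)).stronglyMeasurable.aestronglyMeasurable) ?_
  filter_upwards [h] with ω hω
  refine tendsto_const_nhds.congr' ?_
  filter_upwards [hω] with j hj using hj.2.2.2

/-- Expectations of functions of the queue length at time `e`; the integrability includes the
measurability of the queue length, as an almost sure limit of Euler schemes. -/
theorem IsPrimitives.integral_queueLength (f : ℕ → E) :
    Integrable (fun ω => f (queueLength pol (fun r => Narr r ω) (fun r => Nsrv r ω)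
      (fun i => U i ω) s x e)) P ∧
    ∫ ω, f (queueLength pol (fun r => Narr r ω) (fun r => Nsrv r ω) (fun i => U i ω) s x e) ∂P =
      ∑ y ∈ Finset.range (M.C + 1), stateProb P Narr Nsrv U pol s x e y • f y := by
  set X : Ω → ℕ := fun ω => queueLength pol (fun r => Narr r ω) (fun r => Nsrv r ω)
    (fun i => U i ω) s x e with hX
  have hXm : AEStronglyMeasurable X P := hprim.aestronglyMeasurable_queueLength hadm hs hse he hx
  have hnull : ∀ y, NullMeasurableSet (X ⁻¹' {y}) P := fun y =>
    hXm.aemeasurable.nullMeasurable (measurableSet_singleton y)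
  have heq : (fun ω => f (X ω)) =ᵐ[P] fun ω => ∑ y ∈ Finset.range (M.C + 1),
      (X ⁻¹' {y}).indicator (fun _ => f y) ω := by
    filter_upwards [hprim.ae_queueLength_le hadm hs hse he hx] with ω hω
    rw [Finset.sum_eq_single (X ω)]
    · simp
    · intro y _ hy
      exact indicator_of_notMem (fun h => hy (by simpa using h.symm)) _
    · intro h; exact absurd (Finset.mem_range.2 (Nat.lt_succ_of_le hω)) h
  have hint : ∀ y ∈ Finset.range (M.C + 1),
      Integrable ((X ⁻¹' {y}).indicator (fun _ => f y)) P := fun y _ =>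
    (integrable_const _).indicator₀ (hnull y)
  refine ⟨(integrable_finsetSum _ hint).congr heq.symm, ?_⟩
  rw [integral_congr_ae heq, integral_finsetSum _ hint]
  refine Finset.sum_congr rfl fun y _ => ?_
  rw [integral_indicator₀ (hnull y), setIntegral_const]
  rfl

end Expect

section Expect

variable {Ω : Type*} [MeasurableSpace Ω] {P : Measure Ω} [IsProbabilityMeasure P] {M : Model}
  {Narr Nsrv : ℝ → Ω → ℕ} {U : ℕ → Ω → ℝ} (hprim : IsPrimitives M P Narr Nsrv U)
  {pol : Policy} (hadm : IsAdmissible M pol) {s e : ℝ} (hs : 0 ≤ s) (hse : s ≤ e) (he : e ≤ M.T)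
  {x : ℕ} (hx : x ≤ M.C) {E : Type*} [NormedAddCommGroup E] [NormedSpace ℝ E] [CompleteSpace E]

include hprim hadm hs hse he hx

/-- The forward equation of the transition probabilities, in integrated form. -/
theorem IsPrimitives.sum_stateProb_smul (f : ℕ → E) :
    ∑ y ∈ Finset.range (M.C + 1), stateProb P Narr Nsrv U pol s x e y • f y = f x +
      ((∫ r in s..e, ∑ y ∈ Finset.range (M.C + 1),
        M.lam r • ((stateProb P Narr Nsrv U pol s x r y * pol r y 1) • (f (y + 1) - f y))) +
      ∫ r in s..e, ∑ y ∈ Finset.range (M.C + 1),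
        M.mu r • (stateProb P Narr Nsrv U pol s x r y • (f (y - 1) - f y))) := by
  have hI : ∀ k i, unifGrid s e k i ∈ Icc 0 M.T := fun k i =>
    ⟨hs.trans (unifGrid_mem hse k i).1, (unifGrid_mem hse k i).2.trans he⟩
  have heI : e ∈ Icc 0 M.T := ⟨hs.trans hse, he⟩
  obtain ⟨B, hB0, hB⟩ := exists_forall_norm_le (T := M.T) M.C
    (h := fun _ y => f (y + 1) - f y) fun _ _ => continuousOn_const
  obtain ⟨B', hB0', hB'⟩ := exists_forall_norm_le (T := M.T) M.C
    (h := fun _ y => f (y - 1) - f y) fun _ _ => continuousOn_const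
  obtain ⟨ns, hns, hgood⟩ := hprim.exists_subseq_queueLength_eq hadm hs hse he hx
  have hi1 : ∀ k, Integrable (fun ω => gridAdmissionSum pol (fun r => Narr r ω) (fun r => Nsrv r ω)
      (fun j => U j ω) (unifGrid s e k) x k fun _ y => f (y + 1) - f y) P := fun k =>
    integrable_finsetSum _ fun i _ => (hprim.integral_cell_admission hadm
      (unifGrid_mono hse k) (hI k) hx i fun y => f (y + 1) - f y).1
  have hi2 : ∀ k, Integrable (fun ω => gridServiceSum pol (fun r => Narr r ω) (fun r => Nsrv r ω)
      (fun j => U j ω) (unifGrid s e k) x k fun y => f (y - 1) - f y) P := fun k =>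
    integrable_finsetSum _ fun i _ => (hprim.integral_cell_service hadm
      (unifGrid_mono hse k) (hI k) hx i fun y => f (y - 1) - f y).1
  have hlim := (hprim.tendsto_integral_gridAdmissionSum hadm hs hse he hx
      (h := fun _ y => f (y + 1) - f y) fun _ _ => continuousOn_const).add
    (hprim.tendsto_integral_gridServiceSum hadm hs hse he hx fun y => f (y - 1) - f y)
  simp only [← integral_add (hi1 _) (hi2 _)] at hlim
  have key := integrable_and_integral_eq_of_subseq (Z := fun ω => f (queueLength pol
      (fun r => Narr r ω) (fun r => Nsrv r ω) (fun i => U i ω) s x e) - f x) hns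
    (fun k => ((hi1 k).add (hi2 k)).aestronglyMeasurable)
    (b := fun ω => B * ((Narr e ω : ℝ) - Narr s ω) + B' * ((Nsrv e ω : ℝ) - Nsrv s ω))
    (((hprim.arrivals.integrable_incr hs hse he).const_mul B).add
      ((hprim.services.integrable_incr hs hse he).const_mul B')) (fun k => ?_) ?_ hlim
  · rw [integral_sub (hprim.integral_queueLength hadm hs hse he hx f).1 (integrable_const _),
      (hprim.integral_queueLength hadm hs hse he hx f).2, integral_const, probReal_univ,
      one_smul] at key
    rw [← key.2]
    abel
  · filter_upwards [hprim.ae_gridQueue_le hadm (hI k) hx] with ω hle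
    have m1 := (hprim.arrivals.isCountingPath ω).mono
    have m2 := (hprim.services.isCountingPath ω).mono
    have e1 : (Narr (unifGrid s e k k) ω : ℝ) ≤ Narr e ω :=
      Nat.cast_le.2 (m1 (hI k k) heI (unifGrid_mem hse k k).2)
    have e2 : (Nsrv (unifGrid s e k k) ω : ℝ) ≤ Nsrv e ω :=
      Nat.cast_le.2 (m2 (hI k k) heI (unifGrid_mem hse k k).2)
    refine (norm_add_le _ _).trans (add_le_add ?_ ?_)
    · refine (norm_sum_smul_le_mul_sub (B := B) (w := fun i => (Narr (unifGrid s e k i) ω : ℝ))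
        (fun i j hij => Nat.cast_le.2 (m1 (hI k i) (hI k j) (unifGrid_mono hse k hij)))
        (fun i _ => gridAccept_mem _ _ _ _ _ _ _) fun i _ _ => hB _ (hle i) _ (hI k i)).trans ?_
      rw [unifGrid_zero]
      gcongr
    · have := norm_sum_smul_le_mul_sub (B := B') (w := fun i => (Nsrv (unifGrid s e k i) ω : ℝ))
        (a := fun _ => 1) (k := k)
        (fun i j hij => Nat.cast_le.2 (m2 (hI k i) (hI k j) (unifGrid_mono hse k hij)))
        (fun i _ => by simp) fun i _ _ => hB' _ (hle i) _ (hI k i)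
      simp only [mul_one] at this
      refine this.trans ?_
      rw [unifGrid_zero]
      gcongr
  · filter_upwards [hgood] with ω hω
    refine tendsto_const_nhds.congr' ?_
    filter_upwards [hω] with j hj
    obtain ⟨hg, -, -, hq⟩ := hj
    have m1 := (hprim.arrivals.isCountingPath ω).mono
    have m2 := (hprim.services.isCountingPath ω).mono
    rw [hq, hg.map_gridQueue_sub
      (fun i l hil => m1 (hI _ i) (hI _ l) (unifGrid_mono hse _ hil))
      (fun i l hil => m2 (hI _ i) (hI _ l) (unifGrid_mono hse _ hil)) f le_rfl,
      Finset.sum_add_distrib]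
    rfl

/-- The expected number of admissions is the integral of the admission rate. -/
theorem IsPrimitives.integral_admitted :
    Integrable (fun ω => (admitted pol (fun r => Narr r ω) (fun r => Nsrv r ω)
      (fun i => U i ω) s x e : ℝ)) P ∧
    ∫ ω, (admitted pol (fun r => Narr r ω) (fun r => Nsrv r ω) (fun i => U i ω) s x e : ℝ) ∂P =
      ∫ r in s..e, ∑ y ∈ Finset.range (M.C + 1),
        M.lam r * (stateProb P Narr Nsrv U pol s x r y * pol r y 1) := by
  have hI : ∀ k i, unifGrid s e k i ∈ Icc 0 M.T := fun k i =>
    ⟨hs.trans (unifGrid_mem hse k i).1, (unifGrid_mem hse k i).2.trans he⟩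
  obtain ⟨ns, -, hgood⟩ := hprim.exists_subseq_queueLength_eq hadm hs hse he hx
  have h1 := hprim.integral_jumpIntegral hadm hs hse he hx (h := fun _ _ => (1 : ℝ))
    fun _ _ => continuousOn_const
  have heq : (fun ω => jumpIntegral (fun _ => (1 : ℝ))
      (admitted pol (fun r => Narr r ω) (fun r => Nsrv r ω) (fun i => U i ω) s x) s e) =ᵐ[P]
      fun ω =>
        (admitted pol (fun r => Narr r ω) (fun r => Nsrv r ω) (fun i => U i ω) s x e : ℝ) := by
    filter_upwards [hgood] with ω hω
    obtain ⟨j, hg, hne, hle, -⟩ := hω.exists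
    have hn := hprim.arrivals.isCountingPath ω
    have hm := hprim.services.isCountingPath ω
    obtain ⟨τ, -, h2⟩ := hg.jumpIntegral_eq hn hm (unifGrid_mono hse (ns j)) (hI _ 0).1
      (fun i => (hI _ i).2) (x₀ := x) (fun i _ => hle i)
    have h3 := (hg.queueLength_eq hn hm (unifGrid_mono hse (ns j)) (hI _ 0).1
      (fun i => (hI _ i).2) (x₀ := x) (fun i _ => hle i) le_rfl).2
    have h4 := h2 (fun _ => (1 : ℝ))
    simp only [smul_eq_mul, mul_one] at h4
    rw [← h4, unifGrid_zero, unifGrid_self hne] at h3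
    exact h3.symm
  refine ⟨h1.1.congr heq, ?_⟩
  rw [← integral_congr_ae heq, h1.2]
  simp only [smul_eq_mul, mul_one]

/-- Almost surely, all customers are admitted with a positive probability. -/
theorem IsPrimitives.ae_pol_pos_of_jump : ∀ᵐ ω ∂P, ∀ r ∈ Ioc s e,
    (admitted pol (fun r => Narr r ω) (fun r => Nsrv r ω) (fun i => U i ω) s x r : ℝ) -
      (Function.leftLim (admitted pol (fun r => Narr r ω) (fun r => Nsrv r ω)
        (fun i => U i ω) s x) r : ℕ) ≠ 0 →
    Function.leftLim (queueLength pol (fun r => Narr r ω) (fun r => Nsrv r ω)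
        (fun i => U i ω) s x) r ≤ M.C ∧
    0 < pol r (Function.leftLim (queueLength pol (fun r => Narr r ω) (fun r => Nsrv r ω)
        (fun i => U i ω) s x) r) 1 := by
  have hI : ∀ k i, unifGrid s e k i ∈ Icc 0 M.T := fun k i =>
    ⟨hs.trans (unifGrid_mem hse k i).1, (unifGrid_mem hse k i).2.trans he⟩
  obtain ⟨ns, -, hgood⟩ := hprim.exists_subseq_queueLength_eq hadm hs hse he hx
  filter_upwards [hgood, hprim.ae_U_nonneg] with ω hω hU r hr hjump
  obtain ⟨j, hg, hne, hle, -⟩ := hω.exists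
  obtain ⟨τ, h1, -⟩ := GoodGrid.jumpIntegral_eq.{0} (hg := hg) (hprim.arrivals.isCountingPath ω)
    (hprim.services.isCountingPath ω) (unifGrid_mono hse (ns j)) (hI _ 0).1
    (fun i => (hI _ i).2) (x₀ := x) (fun i _ => hle i)
  rw [unifGrid_zero] at h1
  have hcell : ∃ i < ns j, r ∈ Ioc (unifGrid s e (ns j) i) (unifGrid s e (ns j) (i + 1)) := by
    have hex : ∃ i, r ≤ unifGrid s e (ns j) i := ⟨ns j, by rw [unifGrid_self hne]; exact hr.2⟩
    have hpos : Nat.find hex ≠ 0 := by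
      intro h0
      have := Nat.find_spec hex
      rw [h0, unifGrid_zero] at this
      exact absurd hr.1 (not_lt.2 this)
    obtain ⟨i, hi⟩ := Nat.exists_eq_succ_of_ne_zero hpos
    have hlek : Nat.find hex ≤ ns j := Nat.find_min' hex (by rw [unifGrid_self hne]; exact hr.2)
    refine ⟨i, by omega, not_le.1 (Nat.find_min hex (m := i) (by omega)), ?_⟩
    have := Nat.find_spec hex
    rwa [hi] at this
  obtain ⟨i, hi, hri⟩ := hcell
  obtain ⟨-, h2, h3⟩ := h1 i hi
  obtain ⟨rfl, h4, h5⟩ := h3 r hri hjump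
  rw [(h2 h4).2]
  exact ⟨hle i, (hU _).trans_lt (((hg i hi).2 h4 _ (hle i) _ ⟨hri.1.le, hri.2⟩).2 h5)⟩

end Expect

section Time

variable {Ω : Type*} [MeasurableSpace Ω] {P : Measure Ω} [IsProbabilityMeasure P] {M : Model}
  {Narr Nsrv : ℝ → Ω → ℕ} {U : ℕ → Ω → ℝ} (hprim : IsPrimitives M P Narr Nsrv U)
  {pol : Policy} (hadm : IsAdmissible M pol) {s e : ℝ} (hs : 0 ≤ s) (hse : s ≤ e) (he : e ≤ M.T)
  {x : ℕ} (hx : x ≤ M.C) {E : Type*} [NormedAddCommGroup E] [NormedSpace ℝ E] [CompleteSpace E]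

include hprim hadm hs hse he hx

/-- Functions of the queue can be integrated along almost every path, and the expectation of the
integral is computed with the transition probabilities. -/
theorem IsPrimitives.integral_comp_leftLim {g : ℝ → ℕ → E} {B : ℝ}
    (hg : ∀ y ≤ M.C, IntervalIntegrable (fun r => g r y) volume 0 M.T)
    (hB : ∀ y ≤ M.C, ∀ r ∈ Icc 0 M.T, ‖g r y‖ ≤ B) :
    (∀ᵐ ω ∂P, IntervalIntegrable (fun r => g r (Function.leftLim (queueLength pol
        (fun r => Narr r ω) (fun r => Nsrv r ω) (fun i => U i ω) s x) r)) volume s e) ∧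
    Integrable (fun ω => ∫ r in s..e, g r (Function.leftLim (queueLength pol
        (fun r => Narr r ω) (fun r => Nsrv r ω) (fun i => U i ω) s x) r)) P ∧
    ∫ ω, (∫ r in s..e, g r (Function.leftLim (queueLength pol
        (fun r => Narr r ω) (fun r => Nsrv r ω) (fun i => U i ω) s x) r)) ∂P =
      ∫ r in s..e, ∑ y ∈ Finset.range (M.C + 1), stateProb P Narr Nsrv U pol s x r y • g r y := by
  have hI : ∀ k i, unifGrid s e k i ∈ Icc 0 M.T := fun k i =>
    ⟨hs.trans (unifGrid_mem hse k i).1, (unifGrid_mem hse k i).2.trans he⟩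
  have hsI : s ∈ Icc 0 M.T := ⟨hs, hse.trans he⟩
  have heI : e ∈ Icc 0 M.T := ⟨hs.trans hse, he⟩
  have huIcc : uIcc s e ⊆ Icc 0 M.T := ordConnected_Icc.uIcc_subset hsI heI
  have hB0 : 0 ≤ B := (norm_nonneg _).trans (hB 0 (Nat.zero_le _) s hsI)
  have hgse : ∀ y ≤ M.C, IntervalIntegrable (fun r => g r y) volume s e := fun y hy =>
    (hg y hy).mono_set (by rw [uIcc_of_le M.T_pos.le]; exact huIcc)
  have hint : ∀ y ∈ Finset.range (M.C + 1), IntervalIntegrable (fun r =>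
      stateProb P Narr Nsrv U pol s x r y • g r y) volume s e := fun y hy =>
    (hgse y (Nat.lt_succ_iff.1 (Finset.mem_range.1 hy))).continuousOn_smul
      ((hprim.continuousOn_stateProb hsI x y).mono huIcc)
  obtain ⟨ns, hns, hgood⟩ := hprim.exists_subseq_queueLength_eq hadm hs hse he hx
  -- one cell of the Euler scheme
  have hcell : ∀ k i, Integrable (fun ω => ∫ r in unifGrid s e k i..unifGrid s e k (i + 1),
        g r (gridQueue pol (fun r => Narr r ω) (fun r => Nsrv r ω) (fun j => U j ω)
          (unifGrid s e k) x i)) P ∧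
      ∫ ω, (∫ r in unifGrid s e k i..unifGrid s e k (i + 1),
        g r (gridQueue pol (fun r => Narr r ω) (fun r => Nsrv r ω) (fun j => U j ω)
          (unifGrid s e k) x i)) ∂P =
      ∑ y ∈ Finset.range (M.C + 1), P.real {ω | gridQueue pol (fun r => Narr r ω)
          (fun r => Nsrv r ω) (fun j => U j ω) (unifGrid s e k) x i = y} •
        ∫ r in unifGrid s e k i..unifGrid s e k (i + 1), g r y := by
    intro k i
    set Y : Ω → ℕ := fun ω => gridQueue pol (fun r => Narr r ω) (fun r => Nsrv r ω)
      (fun j => U j ω) (unifGrid s e k) x i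
    have hYm : ∀ y, MeasurableSet {ω | Y ω = y} := fun y =>
      hprim.measurable_gridQueue (hI k) x i (measurableSet_singleton y)
    have heq : (fun ω => ∫ r in unifGrid s e k i..unifGrid s e k (i + 1), g r (Y ω)) =ᵐ[P]
        fun ω => ∑ y ∈ Finset.range (M.C + 1), {ω | Y ω = y}.indicator
          (fun _ => ∫ r in unifGrid s e k i..unifGrid s e k (i + 1), g r y) ω := by
      filter_upwards [hprim.ae_gridQueue_le hadm (hI k) hx] with ω hω
      rw [Finset.sum_eq_single (Y ω)]
      · simp
      · intro y _ hy
        exact indicator_of_notMem (fun h => hy (by simpa using h.symm)) _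
      · intro h; exact absurd (Finset.mem_range.2 (Nat.lt_succ_of_le (hω i))) h
    have hi : ∀ y ∈ Finset.range (M.C + 1), Integrable ({ω | Y ω = y}.indicator
        (fun _ => ∫ r in unifGrid s e k i..unifGrid s e k (i + 1), g r y)) P := fun y _ =>
      (integrable_const _).indicator (hYm y)
    refine ⟨(integrable_finsetSum _ hi).congr heq.symm, ?_⟩
    rw [integral_congr_ae heq, integral_finsetSum _ hi]
    refine Finset.sum_congr rfl fun y _ => ?_
    rw [integral_indicator (hYm y), setIntegral_const]
  -- comparison of the queue and of the Euler scheme along a path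
  have hpath : ∀ᵐ ω ∂P, ∀ᶠ j in atTop,
      IntervalIntegrable (fun r => g r (Function.leftLim (queueLength pol
        (fun r => Narr r ω) (fun r => Nsrv r ω) (fun i => U i ω) s x) r)) volume s e ∧
      ‖(∫ r in s..e, g r (Function.leftLim (queueLength pol
          (fun r => Narr r ω) (fun r => Nsrv r ω) (fun i => U i ω) s x) r)) -
        ∑ i ∈ Finset.range (ns j), ∫ r in unifGrid s e (ns j) i..unifGrid s e (ns j) (i + 1),
          g r (gridQueue pol (fun r => Narr r ω) (fun r => Nsrv r ω) (fun j => U j ω)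
            (unifGrid s e (ns j)) x i)‖ ≤ 2 * B * ((e - s) / (ns j : ℕ)) *
        (((Narr e ω : ℝ) - Narr s ω) + ((Nsrv e ω : ℝ) - Nsrv s ω)) := by
    filter_upwards [hgood] with ω hω
    filter_upwards [hω] with j hj
    obtain ⟨hgr, hne, hle, -⟩ := hj
    have := hgr.norm_integral_sub_le (hprim.arrivals.isCountingPath ω)
      (hprim.services.isCountingPath ω) (unifGrid_mono hse (ns j)) (hI _ 0).1
      (fun i => (hI _ i).2) (x := x) (fun i _ => hle i) (g := g) (B := B)
      (δ := (e - s) / (ns j : ℕ))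
      (fun y hy i _ => intervalIntegrable_unifGrid hse (hgse y hy) _ _) hB
      (fun i _ => unifGrid_succ_sub_le hse _ i)
    rwa [unifGrid_zero, unifGrid_self hne] at this
  refine ⟨?_, integrable_and_integral_eq_of_subseq hns (Zk := fun k ω => ∑ i ∈ Finset.range k,
      ∫ r in unifGrid s e k i..unifGrid s e k (i + 1),
          g r (gridQueue pol (fun r => Narr r ω) (fun r => Nsrv r ω) (fun j => U j ω)
            (unifGrid s e k) x i)) (fun k => ?_) (b := fun _ => B * (e - s)) (integrable_const _)
      (fun k => ?_) ?_ ?_⟩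
  · filter_upwards [hpath] with ω hω using hω.exists.choose_spec.1
  · exact (integrable_finsetSum _ fun i _ => (hcell k i).1).aestronglyMeasurable
  · filter_upwards [hprim.ae_gridQueue_le hadm (hI k) hx] with ω hle
    calc _ ≤ ∑ i ∈ Finset.range k, B * (unifGrid s e k (i + 1) - unifGrid s e k i) := by
          refine norm_sum_le_of_le _ fun i _ => ?_
          have hm := unifGrid_mono hse k (Nat.le_add_right i 1)
          refine (intervalIntegral.norm_integral_le_of_norm_le_const fun r hr => ?_).trans
            (by rw [abs_of_nonneg (sub_nonneg.2 hm)])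
          rw [uIoc_of_le hm] at hr
          exact hB _ (hle i) r ⟨(hI k i).1.trans hr.1.le, hr.2.trans (hI k _).2⟩
      _ = B * (unifGrid s e k k - s) := by
          rw [← Finset.mul_sum, Finset.sum_range_sub, unifGrid_zero]
      _ ≤ B * (e - s) := by
          gcongr
          exact (unifGrid_mem hse k k).2
  · filter_upwards [hpath] with ω hω
    rw [tendsto_iff_norm_sub_tendsto_zero]
    have hlim : Tendsto (fun j => 2 * B * ((e - s) / (ns j : ℕ)) *
        (((Narr e ω : ℝ) - Narr s ω) + ((Nsrv e ω : ℝ) - Nsrv s ω))) atTop (𝓝 0) := by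
      have h1 : Tendsto (fun j => (e - s) / (ns j : ℕ)) atTop (𝓝 0) :=
        (tendsto_const_div_atTop_nhds_zero_nat (e - s)).comp hns.tendsto_atTop
      simpa using (h1.const_mul (2 * B)).mul_const
        (((Narr e ω : ℝ) - Narr s ω) + ((Nsrv e ω : ℝ) - Nsrv s ω))
    refine squeeze_zero' (.of_forall fun _ => norm_nonneg _) ?_ hlim
    filter_upwards [hω] with j hj
    rw [norm_sub_rev]
    exact hj.2
  · rw [intervalIntegral.integral_finsetSum hint]
    have heq : ∀ k, ∫ ω, (∑ i ∈ Finset.range k,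
        ∫ r in unifGrid s e k i..unifGrid s e k (i + 1),
          g r (gridQueue pol (fun r => Narr r ω) (fun r => Nsrv r ω) (fun j => U j ω)
            (unifGrid s e k) x i)) ∂P = ∑ y ∈ Finset.range (M.C + 1), ∑ i ∈ Finset.range k,
        ContinuousLinearMap.lsmul ℝ ℝ (P.real {ω | gridQueue pol (fun r => Narr r ω)
          (fun r => Nsrv r ω) (fun j => U j ω) (unifGrid s e k) x i = y})
        (∫ r in unifGrid s e k i..unifGrid s e k (i + 1), g r y) := by
      intro k
      rw [Finset.sum_comm, integral_finsetSum _ fun i _ => (hcell k i).1]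
      exact Finset.sum_congr rfl fun i _ => (hcell k i).2
    simp only [heq]
    refine tendsto_finsetSum _ fun y hy => ?_
    exact tendsto_sum_unifGrid (ContinuousLinearMap.lsmul ℝ ℝ) hse
      (hgse y (Nat.lt_succ_iff.1 (Finset.mem_range.1 hy))) (hint y hy)
      fun ε hε => hprim.eventually_abs_gridQueue_sub_le hadm hs hse he hx y hε

end Time

/-! ### The value function as a time integral -/

theorem intervalIntegrable_fun_sum {E ι : Type*} [NormedAddCommGroup E] {t : Finset ι}
    {f : ι → ℝ → E} {a b : ℝ} (h : ∀ i ∈ t, IntervalIntegrable (f i) volume a b) :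
    IntervalIntegrable (fun r => ∑ i ∈ t, f i r) volume a b := by
  have := IntervalIntegrable.sum t h
  rwa [Finset.sum_fn] at this

/-- Expected reward per unit of time in state `y` at time `r`. -/
noncomputable def rewardRate (M : Model) (pol : Policy) (r : ℝ) (y : ℕ) : ℝ :=
  M.K1 * (M.lam r * pol r y 1) - M.K2 * y + M.gam * entropy M pol r y

theorem IsAdmissible.continuousOn_entropy {M : Model} {pol : Policy} (hadm : IsAdmissible M pol)
    {y : ℕ} (hy : y ≤ M.C) : ContinuousOn (fun r => entropy M pol r y) (Icc 0 M.T) :=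
  continuousOn_finsetSum _ fun a _ =>
    Real.continuous_negMulLog.comp_continuousOn (hadm.cont y hy a)

theorem IsAdmissible.intervalIntegrable_rewardRate {M : Model} {pol : Policy}
    (hadm : IsAdmissible M pol) {y : ℕ} (hy : y ≤ M.C) :
    IntervalIntegrable (fun r => rewardRate M pol r y) volume 0 M.T := by
  have hu : uIcc 0 M.T = Icc 0 M.T := uIcc_of_le M.T_pos.le
  refine (((M.lam_integrable.mul_continuousOn ?_).const_mul M.K1).sub
    intervalIntegrable_const).add (ContinuousOn.intervalIntegrable ?_)
  · rw [hu]; exact hadm.cont y hy 1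
  · rw [hu]; exact (hadm.continuousOn_entropy hy).const_smul M.gam

section Value

variable {Ω : Type*} [MeasurableSpace Ω] {P : Measure Ω} [IsProbabilityMeasure P] {M : Model}
  {Narr Nsrv : ℝ → Ω → ℕ} {U : ℕ → Ω → ℝ} (hprim : IsPrimitives M P Narr Nsrv U)
  {pol : Policy} (hadm : IsAdmissible M pol) {s : ℝ} (hs : s ∈ Icc 0 M.T)
  {x : ℕ} (hx : x ≤ M.C)

include hprim hadm hs hx

/-- The reward is integrable, and its expectation is the time integral of the reward rates along the
law of the queue, with the final penalty. -/
theorem IsPrimitives.integrable_reward_and_value_eq :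
    Integrable (fun ω => reward M pol (fun t => Narr t ω) (fun t => Nsrv t ω)
      (fun i => U i ω) s x) P ∧
    value M P Narr Nsrv U pol s x =
      (∫ r in s..M.T, ∑ y ∈ Finset.range (M.C + 1),
        stateProb P Narr Nsrv U pol s x r y * rewardRate M pol r y) -
      M.K3 * ∑ y ∈ Finset.range (M.C + 1), stateProb P Narr Nsrv U pol s x M.T y * y := by
  have hT : M.T ∈ Icc 0 M.T := ⟨M.T_pos.le, le_rfl⟩
  have huIcc : uIcc s M.T ⊆ Icc 0 M.T := ordConnected_Icc.uIcc_subset hs hT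
  have hA := hprim.integral_admitted hadm hs.1 hs.2 le_rfl hx
  have hX := hprim.integral_queueLength hadm hs.1 hs.2 le_rfl hx (fun y => (y : ℝ))
  obtain ⟨B, -, hB⟩ := exists_forall_norm_le (T := M.T) M.C (h := fun _ y => (y : ℝ))
    fun _ _ => continuousOn_const
  have hL := (hprim.integral_comp_leftLim hadm hs.1 hs.2 le_rfl hx (g := fun _ y => (y : ℝ))
    (fun y _ => intervalIntegrable_const) hB).2
  obtain ⟨B', -, hB'⟩ := exists_forall_norm_le (T := M.T) M.C (h := fun r y => entropy M pol r y)
    fun _ hy => hadm.continuousOn_entropy hy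
  have hH := (hprim.integral_comp_leftLim hadm hs.1 hs.2 le_rfl hx
    (g := fun r y => entropy M pol r y) (fun y hy => ContinuousOn.intervalIntegrable (by
      rw [uIcc_of_le M.T_pos.le]; exact hadm.continuousOn_entropy hy)) hB').2
  simp only [value, reward, queueLength_self, Nat.cast_zero, sub_zero]
  have i1 := hA.1.const_mul M.K1
  have i2 := hL.1.const_mul M.K2
  have i3 := hX.1.const_mul M.K3
  have i4 := hH.1.const_mul M.gam
  refine ⟨((i1.sub i2).sub i3).add i4, ?_⟩
  refine (integral_add ((i1.sub i2).sub i3) i4).trans ?_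
  rw [integral_sub' (i1.sub i2) i3, integral_sub' i1 i2, integral_const_mul,
    integral_const_mul, integral_const_mul, integral_const_mul,
    hA.2, hL.2, hX.2, hH.2]
  have hq : ∀ y, ContinuousOn (fun r => stateProb P Narr Nsrv U pol s x r y) (uIcc s M.T) :=
    fun y => (hprim.continuousOn_stateProb hs x y).mono huIcc
  have hle : ∀ {y}, y ∈ Finset.range (M.C + 1) → y ≤ M.C := fun hy =>
    Nat.lt_succ_iff.1 (Finset.mem_range.1 hy)
  have j1 : IntervalIntegrable (fun r => ∑ y ∈ Finset.range (M.C + 1),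
      M.lam r * (stateProb P Narr Nsrv U pol s x r y * pol r y 1)) volume s M.T :=
    intervalIntegrable_fun_sum fun y hy => (M.lam_intervalIntegrable hs hT).mul_continuousOn
      ((hq y).mul ((hadm.cont y (hle hy) 1).mono huIcc))
  have j2 : IntervalIntegrable (fun r => ∑ y ∈ Finset.range (M.C + 1),
      stateProb P Narr Nsrv U pol s x r y • (y : ℝ)) volume s M.T :=
    ContinuousOn.intervalIntegrable (continuousOn_finsetSum _ fun y _ =>
      (hq y).smul continuousOn_const)
  have j3 : IntervalIntegrable (fun r => ∑ y ∈ Finset.range (M.C + 1),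
      stateProb P Narr Nsrv U pol s x r y • entropy M pol r y) volume s M.T :=
    ContinuousOn.intervalIntegrable (continuousOn_finsetSum _ fun y hy =>
      (hq y).smul ((hadm.continuousOn_entropy (hle hy)).mono huIcc))
  have : ∀ r, ∑ y ∈ Finset.range (M.C + 1),
        stateProb P Narr Nsrv U pol s x r y * rewardRate M pol r y =
      M.K1 * (∑ y ∈ Finset.range (M.C + 1),
        M.lam r * (stateProb P Narr Nsrv U pol s x r y * pol r y 1)) -
      M.K2 * (∑ y ∈ Finset.range (M.C + 1), stateProb P Narr Nsrv U pol s x r y • (y : ℝ)) +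
      M.gam * ∑ y ∈ Finset.range (M.C + 1),
        stateProb P Narr Nsrv U pol s x r y • entropy M pol r y := by
    intro r
    simp only [Finset.mul_sum, ← Finset.sum_sub_distrib, ← Finset.sum_add_distrib]
    refine Finset.sum_congr rfl fun y _ => ?_
    simp only [rewardRate, smul_eq_mul]
    ring
  simp only [this]
  rw [intervalIntegral.integral_add ((j1.const_mul _).sub (j2.const_mul _)) (j3.const_mul _),
    intervalIntegral.integral_sub (j1.const_mul _) (j2.const_mul _),
    intervalIntegral.integral_const_mul, intervalIntegral.integral_const_mul,
    intervalIntegral.integral_const_mul]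
  simp only [smul_eq_mul]
  ring

end Value

/-! ### Linear integral equations: uniqueness and variation of constants -/

/-- The set of pairs of times `r ≤ v` in `[0, T]`. -/
def timeTriangle (T : ℝ) : Set (ℝ × ℝ) := {p | 0 ≤ p.1 ∧ p.1 ≤ p.2 ∧ p.2 ≤ T}

theorem isCompact_timeTriangle (T : ℝ) : IsCompact (timeTriangle T) := by
  refine (isCompact_Icc.prod isCompact_Icc :
    IsCompact (Icc (0 : ℝ) T ×ˢ Icc (0 : ℝ) T)).of_isClosed_subset ?_ fun p hp =>
    ⟨⟨hp.1, hp.2.1.trans hp.2.2⟩, hp.1.trans hp.2.1, hp.2.2⟩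
  exact (isClosed_le continuous_const continuous_fst).inter
    ((isClosed_le continuous_fst continuous_snd).inter
      (isClosed_le continuous_snd continuous_const))

/-- Fubini's theorem on a triangle. -/
theorem integral_timeTriangle_swap {T : ℝ} (hT : 0 ≤ T) {d α : ℝ → ℝ}
    (hd : IntervalIntegrable d volume 0 T) (hα : IntervalIntegrable α volume 0 T) {K : ℝ → ℝ → ℝ}
    (hK : ContinuousOn (Function.uncurry K) (timeTriangle T)) :
    IntervalIntegrable (fun v => α v * ∫ r in 0..v, d r * K r v) volume 0 T ∧
    IntervalIntegrable (fun r => d r * ∫ v in r..T, K r v * α v) volume 0 T ∧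
    ∫ r in 0..T, d r * ∫ v in r..T, K r v * α v =
      ∫ v in 0..T, α v * ∫ r in 0..v, d r * K r v := by
  have hmeas : MeasurableSet (timeTriangle T) := (isCompact_timeTriangle T).measurableSet
  obtain ⟨B, hB⟩ := (isCompact_timeTriangle T).exists_bound_of_continuousOn hK
  rw [intervalIntegrable_iff_integrableOn_Ioc_of_le hT] at hd hα
  set κ : Measure ℝ := volume.restrict (Ioc 0 T) with hκ
  -- integrate the kernel over the square, cut off outside the triangle
  have hint : Integrable (fun p : ℝ × ℝ => (timeTriangle T).indicator (Function.uncurry K) p *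
      (d p.1 * α p.2)) (κ.prod κ) := by
    refine Integrable.bdd_mul (c := max B 0) (hd.mul_prod hα) ?_ (.of_forall fun p => ?_)
    · exact (aestronglyMeasurable_indicator_iff hmeas).2 (hK.aestronglyMeasurable hmeas)
    · by_cases hp : p ∈ timeTriangle T
      · rw [indicator_of_mem hp]; exact (hB p hp).trans (le_max_left _ _)
      · rw [indicator_of_notMem hp, norm_zero]; exact le_max_right _ _
  have e1 : ∀ r ∈ Ioc 0 T, ∫ v, (timeTriangle T).indicator (Function.uncurry K) (r, v) *
      (d r * α v) ∂κ = d r * ∫ v in r..T, K r v * α v := by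
    intro r hr
    have : ∀ v ∈ Ioc 0 T, (timeTriangle T).indicator (Function.uncurry K) (r, v) * (d r * α v) =
        (Icc r T).indicator (fun v => d r * (K r v * α v)) v := by
      intro v hv
      by_cases h : r ≤ v
      · rw [indicator_of_mem (show (r, v) ∈ timeTriangle T from ⟨hr.1.le, h, hv.2⟩),
          indicator_of_mem (show v ∈ Icc r T from ⟨h, hv.2⟩)]
        simp only [Function.uncurry_apply_pair]; ring
      · rw [indicator_of_notMem (fun h' => h h'.2.1), indicator_of_notMem (fun h' => h h'.1),
          zero_mul]
    rw [hκ, setIntegral_congr_fun measurableSet_Ioc this, setIntegral_indicator measurableSet_Icc,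
      inter_eq_right.2 (show Icc r T ⊆ Ioc 0 T from fun v hv => ⟨hr.1.trans_le hv.1, hv.2⟩),
      integral_Icc_eq_integral_Ioc,
      integral_const_mul, intervalIntegral.integral_of_le hr.2]
  have e2 : ∀ v ∈ Ioc 0 T, ∫ r, (timeTriangle T).indicator (Function.uncurry K) (r, v) *
      (d r * α v) ∂κ = α v * ∫ r in 0..v, d r * K r v := by
    intro v hv
    have : ∀ r ∈ Ioc 0 T, (timeTriangle T).indicator (Function.uncurry K) (r, v) * (d r * α v) =
        (Iic v).indicator (fun r => α v * (d r * K r v)) r := by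
      intro r hr
      by_cases h : r ≤ v
      · rw [indicator_of_mem (show (r, v) ∈ timeTriangle T from ⟨hr.1.le, h, hv.2⟩),
          indicator_of_mem (show r ∈ Iic v from h)]
        simp only [Function.uncurry_apply_pair]; ring
      · rw [indicator_of_notMem (fun h' => h h'.2.1),
          indicator_of_notMem (show r ∉ Iic v from h), zero_mul]
    rw [hκ, setIntegral_congr_fun measurableSet_Ioc this, setIntegral_indicator measurableSet_Iic,
      Ioc_inter_Iic, min_eq_right hv.2, integral_const_mul, intervalIntegral.integral_of_le hv.1.le]
  refine ⟨?_, ?_, ?_⟩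
  · rw [intervalIntegrable_iff_integrableOn_Ioc_of_le hT]
    refine hint.integral_prod_right.congr ?_
    filter_upwards [ae_restrict_mem measurableSet_Ioc] with v hv using e2 v hv
  · rw [intervalIntegrable_iff_integrableOn_Ioc_of_le hT]
    refine hint.integral_prod_left.congr ?_
    filter_upwards [ae_restrict_mem measurableSet_Ioc] with r hr using e1 r hr
  · rw [intervalIntegral.integral_of_le hT, intervalIntegral.integral_of_le hT,
      ← setIntegral_congr_fun measurableSet_Ioc e1, ← setIntegral_congr_fun measurableSet_Ioc e2]
    exact integral_integral_swap hint

/-- A homogeneous linear integral inequality with an integrable coefficient has only the trivial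
solution. -/
theorem eq_zero_of_le_integral_mul {T : ℝ} {W k : ℝ → ℝ} (hk : IntervalIntegrable k volume 0 T)
    (hk0 : ∀ r ∈ Icc 0 T, 0 ≤ k r) (hW : ContinuousOn W (Icc 0 T)) (hW0 : ∀ r ∈ Icc 0 T, 0 ≤ W r)
    (h : ∀ t ∈ Icc 0 T, W t ≤ ∫ r in 0..t, k r * W r) : ∀ t ∈ Icc 0 T, W t = 0 := by
  intro t₀ ht₀
  have hT : 0 ≤ T := ht₀.1.trans ht₀.2
  have hkI : ∀ {a b}, a ∈ Icc 0 T → b ∈ Icc 0 T → IntervalIntegrable k volume a b :=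
    fun ha hb => hk.mono_set (by rw [uIcc_of_le hT]; exact ordConnected_Icc.uIcc_subset ha hb)
  have hkW : ∀ {a b}, a ∈ Icc 0 T → b ∈ Icc 0 T →
      IntervalIntegrable (fun r => k r * W r) volume a b :=
    fun ha hb => (hkI ha hb).mul_continuousOn (hW.mono (ordConnected_Icc.uIcc_subset ha hb))
  have h0 : (0 : ℝ) ∈ Icc 0 T := ⟨le_rfl, hT⟩
  have hprim : ContinuousOn (fun t => ∫ r in 0..t, k r) (Icc 0 T) := by
    have := intervalIntegral.continuousOn_primitive_interval (a := 0) (b := T) (μ := volume)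
      (f := k) ((intervalIntegrable_iff' (by finiteness)).1 hk)
    rwa [uIcc_of_le hT] at this
  have hclosed : IsClosed ({t | W t = 0} ∩ Icc 0 T) := by
    rw [inter_comm]
    exact hW.preimage_isClosed_of_isClosed isClosed_Icc (isClosed_singleton (x := (0 : ℝ)))
  suffices Icc 0 T ⊆ {t | ∀ r ∈ Icc 0 t, W r = 0} from this ht₀ t₀ ⟨ht₀.1, le_rfl⟩
  have hclosed' : IsClosed ({t | ∀ r ∈ Icc 0 t, W r = 0} ∩ Icc 0 T) := by
    refine isClosed_of_closure_subset fun t ht => ?_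
    have htI : t ∈ Icc 0 T := isClosed_Icc.closure_subset (closure_mono inter_subset_right ht)
    refine ⟨fun r hr => ?_, htI⟩
    rcases hr.2.eq_or_lt with rfl | hlt
    · exact (hclosed.closure_subset (closure_mono (show {t | ∀ r ∈ Icc 0 t, W r = 0} ∩ Icc 0 T ⊆
        {t | W t = 0} ∩ Icc 0 T from fun t ht => ⟨ht.1 t ⟨ht.2.1, le_rfl⟩, ht.2⟩) ht)).1
    · obtain ⟨t', ht', h1⟩ := mem_closure_iff.1 ht (Ioi r) isOpen_Ioi hlt
      exact h1.1 r ⟨hr.1, ht'.le⟩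
  have hz : W 0 = 0 := le_antisymm (by simpa using h 0 h0) (hW0 0 h0)
  refine hclosed'.Icc_subset_of_forall_mem_nhdsWithin
    (show ∀ r ∈ Icc (0 : ℝ) 0, W r = 0 by simpa using hz) fun t ht => ?_
  -- on a short interval beyond `t` the coefficient has a small integral
  have htI : t ∈ Icc 0 T := ⟨ht.2.1, ht.2.2.le⟩
  have hev : ∀ᶠ b in 𝓝[>] t, b ∈ Ioc t T ∧ ∫ r in t..b, k r ≤ 1 / 2 := by
    have h1 : ∀ᶠ b in 𝓝[>] t, b ∈ Ioc t T := Ioc_mem_nhdsGT ht.2.2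
    have h2 : Tendsto (fun b => ∫ r in 0..b, k r) (𝓝[Icc 0 T] t) (𝓝 (∫ r in 0..t, k r)) :=
      hprim t htI
    have h3 : 𝓝[>] t ≤ 𝓝[Icc 0 T] t := by
      refine le_inf nhdsWithin_le_nhds (le_principal_iff.2 ?_)
      filter_upwards [h1] with b hb using ⟨htI.1.trans hb.1.le, hb.2⟩
    have h4 := (h2.mono_left h3).eventually
      (ge_mem_nhds (show ∫ r in 0..t, k r < (∫ r in 0..t, k r) + 1 / 2 by linarith))
    filter_upwards [h1, h4] with b hb1 hb2
    refine ⟨hb1, ?_⟩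
    have hbI : b ∈ Icc 0 T := ⟨htI.1.trans hb1.1.le, hb1.2⟩
    rw [← intervalIntegral.integral_interval_sub_left (hkI h0 hbI) (hkI h0 htI)]
    linarith
  filter_upwards [hev] with b hb
  obtain ⟨⟨htb, hbT⟩, hkb⟩ := hb
  have hbI : b ∈ Icc 0 T := ⟨htI.1.trans htb.le, hbT⟩
  -- at a maximum of `W` on `[0, b]`, the inequality gives `W r₀ ≤ W r₀ / 2`
  obtain ⟨r₀, hr₀, hmax⟩ := (isCompact_Icc : IsCompact (Icc 0 b)).exists_isMaxOn
    (nonempty_Icc.2 hbI.1) (hW.mono (Icc_subset_Icc_right hbT))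
  have hr₀I : r₀ ∈ Icc 0 T := ⟨hr₀.1, hr₀.2.trans hbT⟩
  have hle0 : W r₀ ≤ 0 := by
    rcases le_or_gt r₀ t with hrt | hrt
    · exact (ht.1 r₀ ⟨hr₀.1, hrt⟩).le
    · have h5 : ∫ r in 0..t, k r * W r = 0 := by
        rw [intervalIntegral.integral_congr (g := fun _ => (0 : ℝ)) (fun r hr => ?_)]
        · simp
        · rw [uIcc_of_le htI.1] at hr
          simp [ht.1 r hr]
      have h6 : ∫ r in t..r₀, k r * W r ≤ (∫ r in t..r₀, k r) * W r₀ := by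
        rw [← intervalIntegral.integral_mul_const]
        refine intervalIntegral.integral_mono_on hrt.le (hkW htI hr₀I)
          ((hkI htI hr₀I).mul_const _) fun r hr => ?_
        exact mul_le_mul_of_nonneg_left (hmax ⟨htI.1.trans hr.1, hr.2.trans hr₀.2⟩)
          (hk0 r ⟨htI.1.trans hr.1, hr.2.trans hr₀I.2⟩)
      have h7 : ∫ r in t..r₀, k r ≤ 1 / 2 := by
        refine le_trans ?_ hkb
        rw [← intervalIntegral.integral_add_adjacent_intervals (hkI htI hr₀I) (hkI hr₀I hbI)]
        have := intervalIntegral.integral_nonneg hr₀.2 (f := k) (μ := volume)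
          fun r hr => hk0 r ⟨hr₀.1.trans hr.1, hr.2.trans hbT⟩
        linarith
      have h8 := h r₀ hr₀I
      rw [← intervalIntegral.integral_add_adjacent_intervals (hkW h0 htI) (hkW htI hr₀I), h5] at h8
      nlinarith [hW0 r₀ hr₀I]
  exact fun r hr => le_antisymm ((hmax hr).trans hle0) (hW0 r ⟨hr.1, hr.2.trans hbT⟩)

theorem mem_timeTriangle_of_mem_Icc {T r v : ℝ} (hr : 0 ≤ r) (hv : v ∈ Icc r T) :
    (r, v) ∈ timeTriangle T := ⟨hr, hv.1, hv.2⟩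

theorem timeTriangle_mono {t T : ℝ} (h : t ≤ T) : timeTriangle t ⊆ timeTriangle T :=
  fun _ hp => ⟨hp.1, hp.2.1, hp.2.2.trans h⟩

/-- `q s y t z` solves the forward equation on the finite state space `S`, with rates `a r x z`
at time `r` from `x` to `z`. -/
structure IsPropagator (S : Finset ℕ) (T : ℝ) (a : ℝ → ℕ → ℕ → ℝ) (q : ℝ → ℕ → ℝ → ℕ → ℝ) :
    Prop where
  rate : ∀ x ∈ S, ∀ z ∈ S, IntervalIntegrable (fun r => a r x z) volume 0 T
  cont : ∀ y ∈ S, ∀ z ∈ S,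
    ContinuousOn (Function.uncurry fun s t => q s y t z) (timeTriangle T)
  eq : ∀ y ∈ S, ∀ z ∈ S, ∀ s ∈ Icc 0 T, ∀ t ∈ Icc s T,
    q s y t z = (if y = z then 1 else 0) + ∫ r in s..t, ∑ x ∈ S, q s y r x * a r x z

section

variable {S : Finset ℕ} {T : ℝ} {a : ℝ → ℕ → ℕ → ℝ} {q : ℝ → ℕ → ℝ → ℕ → ℝ}

theorem intervalIntegrable_of_mem {E : Type*} [NormedAddCommGroup E] {f : ℝ → E} {T : ℝ}
    (hf : IntervalIntegrable f volume 0 T) {s t : ℝ} (hs : s ∈ Icc 0 T) (ht : t ∈ Icc 0 T) :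
    IntervalIntegrable f volume s t :=
  hf.mono_set (by
    rw [uIcc_of_le (hs.1.trans hs.2)]; exact ordConnected_Icc.uIcc_subset hs ht)

theorem IsPropagator.continuousOn_section (hq : IsPropagator S T a q) {y z : ℕ} (hy : y ∈ S)
    (hz : z ∈ S) {s : ℝ} (hs : s ∈ Icc 0 T) : ContinuousOn (fun t => q s y t z) (Icc s T) :=
  (hq.cont y hy z hz).comp (f := fun t : ℝ => (s, t)) (by fun_prop)
    fun _ ht => mem_timeTriangle_of_mem_Icc hs.1 ht

theorem IsPropagator.intervalIntegrable (hq : IsPropagator S T a q) {y x z : ℕ} (hy : y ∈ S)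
    (hx : x ∈ S) (hz : z ∈ S) {s t : ℝ} (hs : s ∈ Icc 0 T) (ht : t ∈ Icc s T) :
    IntervalIntegrable (fun r => q s y r x * a r x z) volume s t := by
  refine (intervalIntegrable_of_mem (hq.rate x hx z hz) hs
    ⟨hs.1.trans ht.1, ht.2⟩).continuousOn_mul ((hq.continuousOn_section hy hx hs).mono ?_)
  rw [uIcc_of_le ht.1]
  exact Icc_subset_Icc_right ht.2

/-- The equation satisfied by the contribution of a source `d` in state `y`. -/
theorem IsPropagator.integral_source (hq : IsPropagator S T a q) {d : ℝ → ℝ}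
    (hd : IntervalIntegrable d volume 0 T) {y z : ℕ} (hy : y ∈ S) (hz : z ∈ S) {t : ℝ}
    (ht : t ∈ Icc 0 T) :
    (∀ x ∈ S, IntervalIntegrable (fun v => a v x z * ∫ r in 0..v, d r * q r y v x) volume 0 t) ∧
    ∫ r in 0..t, d r * q r y t z = (if y = z then ∫ r in 0..t, d r else 0) +
      ∑ x ∈ S, ∫ v in 0..t, a v x z * ∫ r in 0..v, d r * q r y v x := by
  have h0 : (0 : ℝ) ∈ Icc 0 T := ⟨le_rfl, ht.1.trans ht.2⟩
  have hd' := intervalIntegrable_of_mem hd h0 ht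
  have hF : ∀ x ∈ S, _ := fun x hx => integral_timeTriangle_swap ht.1 hd'
    (intervalIntegrable_of_mem (hq.rate x hx z hz) h0 ht)
    ((hq.cont y hy x hx).mono (timeTriangle_mono ht.2))
  refine ⟨fun x hx => (hF x hx).1, ?_⟩
  have heq : ∀ r ∈ uIcc 0 t, d r * q r y t z = d r * (if y = z then 1 else 0) +
      ∑ x ∈ S, d r * ∫ v in r..t, q r y v x * a v x z := by
    intro r hr
    rw [uIcc_of_le ht.1] at hr
    have hrI : r ∈ Icc 0 T := ⟨hr.1, hr.2.trans ht.2⟩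
    rw [hq.eq y hy z hz r hrI t ⟨hr.2, ht.2⟩, intervalIntegral.integral_finsetSum fun x hx =>
      hq.intervalIntegrable hy hx hz hrI ⟨hr.2, ht.2⟩, mul_add, Finset.mul_sum]
  rw [intervalIntegral.integral_congr heq, intervalIntegral.integral_add (hd'.mul_const _)
    (intervalIntegrable_fun_sum fun x hx => (hF x hx).2.1),
    intervalIntegral.integral_finsetSum fun x hx => (hF x hx).2.1]
  congr 1
  · split_ifs <;> simp
  · exact Finset.sum_congr rfl fun x hx => (hF x hx).2.2

/-- Uniqueness for linear systems with integrable coefficients. -/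
theorem eq_zero_of_forall_eq_integral_sum {w : ℝ → ℕ → ℝ}
    (ha : ∀ x ∈ S, ∀ z ∈ S, IntervalIntegrable (fun r => a r x z) volume 0 T)
    (hi : ∀ x ∈ S, ∀ z ∈ S, IntervalIntegrable (fun r => a r x z * w r x) volume 0 T)
    (hw : ∀ z ∈ S, ∀ t ∈ Icc 0 T, w t z = ∫ r in 0..t, ∑ x ∈ S, a r x z * w r x) :
    ∀ z ∈ S, ∀ t ∈ Icc 0 T, w t z = 0 := by
  intro z₀ hz₀ t₀ ht₀
  have hT : 0 ≤ T := ht₀.1.trans ht₀.2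
  have hcont : ∀ z ∈ S, ContinuousOn (fun t => w t z) (Icc 0 T) := by
    intro z hz
    have := intervalIntegral.continuousOn_primitive_interval (a := 0) (b := T) (μ := volume)
      (f := fun r => ∑ x ∈ S, a r x z * w r x) ((intervalIntegrable_iff' (by finiteness)).1
        (intervalIntegrable_fun_sum fun x hx => hi x hx z hz))
    rw [uIcc_of_le hT] at this
    exact this.congr fun t ht => hw z hz t ht
  -- apply the scalar result to the sum of the absolute values
  have key := eq_zero_of_le_integral_mul (T := T) (W := fun t => ∑ z ∈ S, |w t z|)
    (k := fun r => ∑ z ∈ S, ∑ x ∈ S, |a r x z|)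
    (intervalIntegrable_fun_sum fun z hz => intervalIntegrable_fun_sum fun x hx =>
      (ha x hx z hz).abs)
    (fun r _ => Finset.sum_nonneg fun _ _ => Finset.sum_nonneg fun _ _ => abs_nonneg _)
    (continuousOn_finsetSum _ fun z hz => (hcont z hz).abs)
    (fun r _ => Finset.sum_nonneg fun _ _ => abs_nonneg _) ?_ t₀ ht₀
  · exact abs_eq_zero.1 ((Finset.sum_eq_zero_iff_of_nonneg fun _ _ => abs_nonneg _).1 key z₀ hz₀)
  · intro t ht
    have h0 : (0 : ℝ) ∈ Icc 0 T := ⟨le_rfl, hT⟩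
    have hW : ContinuousOn (fun t => ∑ z ∈ S, |w t z|) (uIcc 0 t) :=
      (continuousOn_finsetSum _ fun z hz => (hcont z hz).abs).mono
        (ordConnected_Icc.uIcc_subset h0 ht)
    have hz : ∀ z ∈ S, IntervalIntegrable (fun r => (∑ x ∈ S, |a r x z|) * ∑ x ∈ S, |w r x|)
        volume 0 t := fun z hz => (intervalIntegrable_fun_sum fun x hx =>
        (intervalIntegrable_of_mem (ha x hx z hz) h0 ht).abs).mul_continuousOn hW
    have hs : ∀ r, (∑ z ∈ S, ∑ x ∈ S, |a r x z|) * ∑ x ∈ S, |w r x| =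
        ∑ z ∈ S, (∑ x ∈ S, |a r x z|) * ∑ x ∈ S, |w r x| := fun r => Finset.sum_mul _ _ _
    simp only [hs]
    rw [intervalIntegral.integral_finsetSum hz]
    refine Finset.sum_le_sum fun z hz' => ?_
    rw [hw z hz' t ht, ← Real.norm_eq_abs]
    refine intervalIntegral.norm_integral_le_of_norm_le ht.1 (.of_forall fun r _ => ?_) (hz z hz')
    rw [Finset.sum_mul]
    refine norm_sum_le_of_le _ fun x hx => ?_
    rw [norm_mul, Real.norm_eq_abs, Real.norm_eq_abs]
    exact mul_le_mul_of_nonneg_left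
      (Finset.single_le_sum (f := fun x => |w r x|) (fun _ _ => abs_nonneg _) hx) (abs_nonneg _)

/-- Variation of constants: the solution of the perturbed forward equation. -/
theorem IsPropagator.variation_of_constants (hq : IsPropagator S T a q) {p d : ℝ → ℕ → ℝ}
    {b : ℕ → ℝ} (hd : ∀ y ∈ S, IntervalIntegrable (fun r => d r y) volume 0 T)
    (hpc : ∀ z ∈ S, ContinuousOn (fun t => p t z) (Icc 0 T))
    (hp : ∀ z ∈ S, ∀ t ∈ Icc 0 T,
      p t z = b z + ((∫ r in 0..t, ∑ x ∈ S, p r x * a r x z) + ∫ r in 0..t, d r z))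
    {z : ℕ} (hz : z ∈ S) {t : ℝ} (ht : t ∈ Icc 0 T) :
    p t z = ∑ y ∈ S, (b y * q 0 y t z + ∫ r in 0..t, d r y * q r y t z) := by
  have hT : 0 ≤ T := ht.1.trans ht.2
  have h0 : (0 : ℝ) ∈ Icc 0 T := ⟨le_rfl, hT⟩
  have hTI : T ∈ Icc 0 T := ⟨hT, le_rfl⟩
  have hpi : ∀ x ∈ S, ∀ z ∈ S, IntervalIntegrable (fun r => p r x * a r x z) volume 0 T :=
    fun x hx z hz => (hq.rate x hx z hz).continuousOn_mul
      ((hpc x hx).mono (by rw [uIcc_of_le hT]))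
  set v : ℝ → ℕ → ℝ := fun t z => ∑ y ∈ S, (b y * q 0 y t z + ∫ r in 0..t, d r y * q r y t z)
    with hv
  have hvi' : ∀ x ∈ S, ∀ z ∈ S, ∀ y ∈ S, ∀ t ∈ Icc 0 T,
      IntervalIntegrable (fun r => b y * (q 0 y r x * a r x z) +
        a r x z * ∫ s in 0..r, d s y * q s y r x) volume 0 t :=
    fun x hx z hz y hy t ht => ((hq.intervalIntegrable hy hx hz h0 ht).const_mul _).add
      ((hq.integral_source (hd y hy) hy hz ht).1 x hx)
  have hav : ∀ r x z, a r x z * v r x = ∑ y ∈ S, (b y * (q 0 y r x * a r x z) +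
        a r x z * ∫ s in 0..r, d s y * q s y r x) := by
    intro r x z
    rw [hv, Finset.mul_sum]
    refine Finset.sum_congr rfl fun y _ => ?_
    ring
  have hvi : ∀ x ∈ S, ∀ z ∈ S, IntervalIntegrable (fun r => a r x z * v r x) volume 0 T := by
    intro x hx z hz
    simp only [hav]
    exact intervalIntegrable_fun_sum fun y hy => hvi' x hx z hz y hy T hTI
  -- the candidate solves the same equation
  have hveq : ∀ z ∈ S, ∀ t ∈ Icc 0 T,
      v t z = b z + ((∫ r in 0..t, ∑ x ∈ S, a r x z * v r x) + ∫ r in 0..t, d r z) := by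
    intro z hz t ht
    have e1 : ∀ y ∈ S, b y * q 0 y t z + ∫ r in 0..t, d r y * q r y t z =
        ((if y = z then b y else 0) + if y = z then ∫ r in 0..t, d r y else 0) +
        ∑ x ∈ S, ∫ r in 0..t, (b y * (q 0 y r x * a r x z) +
          a r x z * ∫ s in 0..r, d s y * q s y r x) := by
      intro y hy
      rw [hq.eq y hy z hz 0 h0 t ht, (hq.integral_source (hd y hy) hy hz ht).2,
        intervalIntegral.integral_finsetSum fun x hx => hq.intervalIntegrable hy hx hz h0 ht,
        Finset.sum_congr rfl fun x hx => intervalIntegral.integral_add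
          ((hq.intervalIntegrable hy hx hz h0 ht).const_mul (b y))
          ((hq.integral_source (hd y hy) hy hz ht).1 x hx), Finset.sum_add_distrib]
      simp only [intervalIntegral.integral_const_mul, ← Finset.mul_sum]
      split_ifs <;> ring
    have e2 : ∫ r in 0..t, ∑ x ∈ S, a r x z * v r x = ∑ y ∈ S, ∑ x ∈ S, ∫ r in 0..t,
        (b y * (q 0 y r x * a r x z) + a r x z * ∫ s in 0..r, d s y * q s y r x) := by
      simp only [hav]
      rw [intervalIntegral.integral_finsetSum fun x hx => intervalIntegrable_fun_sum fun y hy =>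
        hvi' x hx z hz y hy t ht, Finset.sum_comm]
      refine Finset.sum_congr rfl fun x hx => ?_
      exact intervalIntegral.integral_finsetSum fun y hy => hvi' x hx z hz y hy t ht
    rw [e2]
    simp only [hv]
    rw [Finset.sum_congr rfl e1, Finset.sum_add_distrib, Finset.sum_add_distrib]
    simp only [Finset.sum_ite_eq', if_pos hz]
    ring
  have key := eq_zero_of_forall_eq_integral_sum (S := S) (T := T) (a := a)
    (w := fun t z => p t z - v t z) hq.rate
    (fun x hx z hz => by
      simp only [mul_sub, mul_comm (a _ _ _) (p _ _)]
      exact (hpi x hx z hz).sub (hvi x hx z hz)) (fun z hz t ht => by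
      simp only [mul_sub, mul_comm (a _ _ _) (p _ _), Finset.sum_sub_distrib]
      rw [intervalIntegral.integral_sub, hp z hz t ht, hveq z hz t ht]
      · ring
      · exact intervalIntegrable_fun_sum fun x hx => intervalIntegrable_of_mem (hpi x hx z hz) h0 ht
      · exact intervalIntegrable_fun_sum fun x hx =>
          intervalIntegrable_of_mem (hvi x hx z hz) h0 ht)
    z hz t ht
  exact sub_eq_zero.1 key

end

/-- Continuity in the lower limit of an integral whose kernel depends on that limit. -/
theorem continuousOn_integral_timeTriangle {T : ℝ} {α : ℝ → ℝ}
    (hα : IntervalIntegrable α volume 0 T) {K : ℝ → ℝ → ℝ}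
    (hK : ContinuousOn (Function.uncurry K) (timeTriangle T)) :
    ContinuousOn (fun s => ∫ t in s..T, K s t * α t) (Icc 0 T) := by
  intro s₀ hs₀
  have hT : 0 ≤ T := hs₀.1.trans hs₀.2
  obtain ⟨B, hB⟩ := (isCompact_timeTriangle T).exists_bound_of_continuousOn hK
  have h00 : ((0 : ℝ), (0 : ℝ)) ∈ timeTriangle T := ⟨le_rfl, le_rfl, hT⟩
  have hB0 : 0 ≤ B := (norm_nonneg _).trans (hB _ h00)
  have hsec : ∀ s ∈ Icc 0 T, ContinuousOn (fun t => K s t) (Icc s T) := fun s hs =>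
    hK.comp (f := fun t : ℝ => (s, t)) (by fun_prop) fun _ ht => mem_timeTriangle_of_mem_Icc hs.1 ht
  have heq : ∀ s ∈ Icc 0 T, ∫ t in s..T, K s t * α t =
      ∫ t in 0..T, (Ioc s T).indicator (fun t => K s t * α t) t := by
    intro s hs
    rw [intervalIntegral.integral_of_le hT, intervalIntegral.integral_of_le hs.2,
      setIntegral_indicator measurableSet_Ioc, inter_eq_right.2 (Ioc_subset_Ioc_left hs.1)]
  have hmain : ContinuousWithinAt (fun s => ∫ t in 0..T, (Ioc s T).indicator
      (fun t => K s t * α t) t) (Icc 0 T) s₀ := by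
    refine intervalIntegral.continuousWithinAt_of_dominated_interval
      (bound := fun t => B * ‖α t‖) ?_ ?_ (hα.norm.const_mul B) ?_
    · filter_upwards [self_mem_nhdsWithin] with s hs
      rw [uIoc_of_le hT]
      refine AEStronglyMeasurable.restrict ?_
      rw [aestronglyMeasurable_indicator_iff measurableSet_Ioc]
      have hαs := intervalIntegrable_of_mem hα hs ⟨hT, le_rfl⟩
      rw [intervalIntegrable_iff_integrableOn_Ioc_of_le hs.2] at hαs
      exact (((hsec s hs).mono Ioc_subset_Icc_self).aestronglyMeasurable measurableSet_Ioc).mul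
        hαs.aestronglyMeasurable
    · filter_upwards [self_mem_nhdsWithin] with s hs
      refine .of_forall fun t _ => ?_
      by_cases ht : t ∈ Ioc s T
      · rw [indicator_of_mem ht, norm_mul]
        gcongr
        exact hB (s, t) ⟨hs.1, ht.1.le, ht.2⟩
      · rw [indicator_of_notMem ht, norm_zero]; positivity
    · filter_upwards [compl_mem_ae_iff.2 (measure_singleton s₀)] with t hts ht
      rw [uIoc_of_le hT] at ht
      rcases lt_or_gt_of_ne (show t ≠ s₀ from hts) with hlt | hlt
      · refine (tendsto_const_nhds (x := (0 : ℝ))).congr' ?_ |>.trans_eq ?_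
        · filter_upwards [nhdsWithin_le_nhds (Ioi_mem_nhds hlt)] with s hs
          exact (indicator_of_notMem (fun h => lt_asymm h.1 hs) _).symm
        · exact congrArg 𝓝 (indicator_of_notMem (fun h => lt_asymm h.1 hlt) _).symm
      · have hc : ContinuousWithinAt (fun s => K s t * α t) (Icc 0 t) s₀ := by
          refine ContinuousWithinAt.mul (f := fun s => K s t) ?_ continuousWithinAt_const
          exact (hK (s₀, t) ⟨hs₀.1, hlt.le, ht.2⟩).comp (f := fun s : ℝ => (s, t))
            (Continuous.continuousWithinAt (by fun_prop)) fun s hs => ⟨hs.1, hs.2, ht.2⟩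
        have hle : 𝓝[Icc 0 T] s₀ ≤ 𝓝[Icc 0 t] s₀ := by
          refine le_inf nhdsWithin_le_nhds (le_principal_iff.2 ?_)
          filter_upwards [nhdsWithin_le_nhds (Iio_mem_nhds hlt), self_mem_nhdsWithin] with s h1 h2
            using ⟨h2.1, le_of_lt h1⟩
        have hc' : Tendsto (fun s => K s t * α t) (𝓝[Icc 0 T] s₀) (𝓝 (K s₀ t * α t)) :=
          Tendsto.mono_left hc hle
        have : ContinuousWithinAt (fun s => (Ioc s T).indicator (fun t => K s t * α t) t)
            (Icc 0 T) s₀ := by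
          rw [ContinuousWithinAt, indicator_of_mem (show t ∈ Ioc s₀ T from ⟨hlt, ht.2⟩)]
          refine hc'.congr' ?_
          filter_upwards [nhdsWithin_le_nhds (Iio_mem_nhds hlt)] with s hs
          rw [indicator_of_mem (show t ∈ Ioc s T from ⟨hs, ht.2⟩)]
        exact this
  exact hmain.congr heq (heq s₀ hs₀)

section

variable {S : Finset ℕ} {T : ℝ} {a : ℝ → ℕ → ℕ → ℝ} {q : ℝ → ℕ → ℝ → ℕ → ℝ}

/-- Total of the running reward `ρ` on `[s, T]` and of the final reward `g`, from state `y` at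
time `s`, for the transition probabilities `q`. -/
noncomputable def totalReward (S : Finset ℕ) (T : ℝ) (q : ℝ → ℕ → ℝ → ℕ → ℝ) (ρ : ℝ → ℕ → ℝ)
    (g : ℕ → ℝ) (s : ℝ) (y : ℕ) : ℝ :=
  (∫ t in s..T, ∑ z ∈ S, q s y t z * ρ t z) + ∑ z ∈ S, q s y T z * g z

variable {ρ : ℝ → ℕ → ℝ} (g : ℕ → ℝ) (hρ : ∀ z ∈ S, IntervalIntegrable (fun r => ρ r z) volume 0 T)

include hρ

theorem IsPropagator.totalReward_eq (hq : IsPropagator S T a q) {y : ℕ} (hy : y ∈ S) {s : ℝ}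
    (hs : s ∈ Icc 0 T) : totalReward S T q ρ g s y =
      ∑ z ∈ S, ((∫ t in s..T, q s y t z * ρ t z) + q s y T z * g z) := by
  rw [totalReward, intervalIntegral.integral_finsetSum, Finset.sum_add_distrib]
  intro z hz
  refine (intervalIntegrable_of_mem (hρ z hz) hs ⟨hs.1.trans hs.2, le_rfl⟩).continuousOn_mul ?_
  rw [uIcc_of_le hs.2]
  exact hq.continuousOn_section hy hz hs

theorem IsPropagator.continuousOn_totalReward (hq : IsPropagator S T a q) {y : ℕ} (hy : y ∈ S) :
    ContinuousOn (fun s => totalReward S T q ρ g s y) (Icc 0 T) := by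
  refine ContinuousOn.congr ?_ fun s hs => hq.totalReward_eq g hρ hy hs
  refine continuousOn_finsetSum _ fun z hz => ContinuousOn.add
    (continuousOn_integral_timeTriangle (hρ z hz) (hq.cont y hy z hz)) ?_
  refine ContinuousOn.mul ?_ continuousOn_const
  exact (hq.cont y hy z hz).comp (f := fun s : ℝ => (s, T)) (by fun_prop)
    fun s hs => ⟨hs.1, hs.2, le_rfl⟩

/-- The total reward of the solution of a perturbed forward equation: the perturbation `d` acts
through the total reward of the unperturbed equation. -/
theorem IsPropagator.sum_reward_eq (hT : 0 ≤ T) (hq : IsPropagator S T a q) {p d : ℝ → ℕ → ℝ}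
    {b : ℕ → ℝ} (hd : ∀ y ∈ S, IntervalIntegrable (fun r => d r y) volume 0 T)
    (hpc : ∀ z ∈ S, ContinuousOn (fun t => p t z) (Icc 0 T))
    (hp : ∀ z ∈ S, ∀ t ∈ Icc 0 T,
      p t z = b z + ((∫ r in 0..t, ∑ x ∈ S, p r x * a r x z) + ∫ r in 0..t, d r z)) :
    (∫ t in 0..T, ∑ z ∈ S, p t z * ρ t z) + ∑ z ∈ S, p T z * g z =
      (∑ y ∈ S, b y * totalReward S T q ρ g 0 y) +
      ∫ r in 0..T, ∑ y ∈ S, d r y * totalReward S T q ρ g r y := by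
  have h0 : (0 : ℝ) ∈ Icc 0 T := ⟨le_rfl, hT⟩
  have hTI : T ∈ Icc 0 T := ⟨hT, le_rfl⟩
  have hu : uIcc 0 T = Icc 0 T := uIcc_of_le hT
  have hpt := fun z (hz : z ∈ S) t (ht : t ∈ Icc 0 T) => hq.variation_of_constants hd hpc hp hz ht
  have hF : ∀ y ∈ S, ∀ z ∈ S, _ := fun y hy z hz =>
    integral_timeTriangle_swap hT (hd y hy) (hρ z hz) (hq.cont y hy z hz)
  have hqT : ∀ y ∈ S, ∀ z ∈ S, IntervalIntegrable (fun r => d r y * q r y T z) volume 0 T :=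
    fun y hy z hz => (hd y hy).mul_continuousOn (by
      rw [hu]
      exact (hq.cont y hy z hz).comp (f := fun s : ℝ => (s, T)) (by fun_prop)
        fun s hs => ⟨hs.1, hs.2, le_rfl⟩)
  have hq0 : ∀ y ∈ S, ∀ z ∈ S, IntervalIntegrable (fun t => q 0 y t z * ρ t z) volume 0 T :=
    fun y hy z hz => (hρ z hz).continuousOn_mul (by rw [hu]; exact hq.continuousOn_section hy hz h0)
  -- the running rewards
  have e1 : ∫ t in 0..T, ∑ z ∈ S, p t z * ρ t z = ∑ z ∈ S, ∑ y ∈ S,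
      (b y * (∫ t in 0..T, q 0 y t z * ρ t z) +
        ∫ r in 0..T, d r y * ∫ t in r..T, q r y t z * ρ t z) := by
    have : ∀ t ∈ uIcc 0 T, ∑ z ∈ S, p t z * ρ t z = ∑ z ∈ S, ∑ y ∈ S,
        (b y * (q 0 y t z * ρ t z) + ρ t z * ∫ r in 0..t, d r y * q r y t z) := by
      intro t ht
      rw [hu] at ht
      refine Finset.sum_congr rfl fun z hz => ?_
      rw [hpt z hz t ht, Finset.sum_mul]
      refine Finset.sum_congr rfl fun y _ => ?_
      ring
    rw [intervalIntegral.integral_congr this, intervalIntegral.integral_finsetSum fun z hz =>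
      intervalIntegrable_fun_sum fun y hy =>
        ((hq0 y hy z hz).const_mul (b y)).add (hF y hy z hz).1]
    refine Finset.sum_congr rfl fun z hz => ?_
    rw [intervalIntegral.integral_finsetSum fun y hy =>
        ((hq0 y hy z hz).const_mul (b y)).add (hF y hy z hz).1]
    refine Finset.sum_congr rfl fun y hy => ?_
    rw [intervalIntegral.integral_add ((hq0 y hy z hz).const_mul (b y)) (hF y hy z hz).1,
      intervalIntegral.integral_const_mul, (hF y hy z hz).2.2]
  have e2 : ∫ r in 0..T, ∑ y ∈ S, d r y * totalReward S T q ρ g r y = ∑ y ∈ S, ∑ z ∈ S,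
      ((∫ r in 0..T, d r y * ∫ t in r..T, q r y t z * ρ t z) +
        (∫ r in 0..T, d r y * q r y T z) * g z) := by
    have : ∀ r ∈ uIcc 0 T, ∑ y ∈ S, d r y * totalReward S T q ρ g r y = ∑ y ∈ S, ∑ z ∈ S,
        (d r y * (∫ t in r..T, q r y t z * ρ t z) + d r y * q r y T z * g z) := by
      intro r hr
      rw [hu] at hr
      refine Finset.sum_congr rfl fun y hy => ?_
      rw [hq.totalReward_eq g hρ hy hr, Finset.mul_sum]
      refine Finset.sum_congr rfl fun z _ => ?_
      ring
    rw [intervalIntegral.integral_congr this, intervalIntegral.integral_finsetSum fun y hy =>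
      intervalIntegrable_fun_sum fun z hz =>
        ((hF y hy z hz).2.1).add ((hqT y hy z hz).mul_const (g z))]
    refine Finset.sum_congr rfl fun y hy => ?_
    rw [intervalIntegral.integral_finsetSum fun z hz =>
        ((hF y hy z hz).2.1).add ((hqT y hy z hz).mul_const (g z))]
    refine Finset.sum_congr rfl fun z hz => ?_
    rw [intervalIntegral.integral_add ((hF y hy z hz).2.1) ((hqT y hy z hz).mul_const (g z)),
      intervalIntegral.integral_mul_const]
  have e3 : ∑ z ∈ S, p T z * g z = ∑ z ∈ S, ∑ y ∈ S,
      (b y * q 0 y T z * g z + (∫ r in 0..T, d r y * q r y T z) * g z) := by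
    refine Finset.sum_congr rfl fun z hz => ?_
    rw [hpt z hz T hTI, Finset.sum_mul]
    exact Finset.sum_congr rfl fun y _ => add_mul _ _ _
  have e4 : ∑ y ∈ S, b y * totalReward S T q ρ g 0 y = ∑ y ∈ S, ∑ z ∈ S,
      (b y * (∫ t in 0..T, q 0 y t z * ρ t z) + b y * q 0 y T z * g z) := by
    refine Finset.sum_congr rfl fun y hy => ?_
    rw [hq.totalReward_eq g hρ hy h0, Finset.mul_sum]
    refine Finset.sum_congr rfl fun z _ => ?_
    ring
  rw [e1, e2, e3, e4, Finset.sum_comm, Finset.sum_comm (f := fun z y => b y * q 0 y T z * g z + _),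
    ← Finset.sum_add_distrib, ← Finset.sum_add_distrib]
  refine Finset.sum_congr rfl fun y _ => ?_
  rw [← Finset.sum_add_distrib, ← Finset.sum_add_distrib]
  refine Finset.sum_congr rfl fun z _ => ?_
  ring

end

/-! ### The performance difference formula -/

/-- Transition rate from `x` to `z` at time `r` of the controlled queue (minus the total rate out
of `x` if `x = z`). -/
noncomputable def transitionRate (M : Model) (pol : Policy) (r : ℝ) (x z : ℕ) : ℝ :=
  M.lam r * (pol r x 1 * ((if x + 1 = z then 1 else 0) - if x = z then 1 else 0)) +
    M.mu r * ((if x - 1 = z then 1 else 0) - if x = z then 1 else 0)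

theorem IsAdmissible.unavailable_self {M : Model} {pol : Policy} (hadm : IsAdmissible M pol) {r : ℝ}
    (hr : r ∈ Icc 0 M.T) : pol r M.C 1 = 0 :=
  hadm.unavailable r hr M.C le_rfl 1 (by simp [available])

theorem IsAdmissible.mem_Icc {M : Model} {pol : Policy} (hadm : IsAdmissible M pol) {r : ℝ}
    (hr : r ∈ Icc 0 M.T) {y : ℕ} (hy : y ≤ M.C) (a : Fin 2) : pol r y a ∈ Icc 0 1 := by
  refine ⟨hadm.nonneg r hr y hy a, ?_⟩
  rw [← hadm.sum_one r hr y hy]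
  exact Finset.single_le_sum (f := fun a => pol r y a)
    (fun a _ => hadm.nonneg r hr y hy a) (Finset.mem_univ a)

/-- Pairing `v` with a flow of rates `w` from each state to the next one gives the increments of
`v`; the top state has no outflow. -/
theorem sum_mul_increment {C : ℕ} {w v : ℕ → ℝ} (hw : w C = 0) :
    ∑ z ∈ Finset.range (C + 1), (∑ x ∈ Finset.range (C + 1),
        w x * ((if x + 1 = z then 1 else 0) - if x = z then 1 else 0)) * v z =
      ∑ x ∈ Finset.range (C + 1), w x * (v (x + 1) - v x) := by
  simp only [Finset.sum_mul]
  rw [Finset.sum_comm]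
  refine Finset.sum_congr rfl fun x hx => ?_
  rcases (Nat.lt_succ_iff.1 (Finset.mem_range.1 hx)).eq_or_lt with rfl | hlt
  · simp [hw]
  · simp only [mul_assoc, ← Finset.mul_sum, sub_mul, Finset.sum_sub_distrib, ite_mul, one_mul,
      zero_mul, Finset.sum_ite_eq, Finset.mem_range]
    rw [if_pos (by omega), if_pos (by omega)]

section

variable {Ω : Type*} [MeasurableSpace Ω] {P : Measure Ω} [IsProbabilityMeasure P] {M : Model}
  {Narr Nsrv : ℝ → Ω → ℕ} {U : ℕ → Ω → ℝ} (hprim : IsPrimitives M P Narr Nsrv U)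
  {pol : Policy} (hadm : IsAdmissible M pol)

theorem mem_range_succ_iff_le {C y : ℕ} : y ∈ Finset.range (C + 1) ↔ y ≤ C := by
  rw [Finset.mem_range, Nat.lt_succ_iff]

include hprim in
theorem IsPrimitives.continuousOn_uncurry_stateProb (y z : ℕ) :
    ContinuousOn (Function.uncurry fun s t => stateProb P Narr Nsrv U pol s y t z)
      (timeTriangle M.T) := by
  intro p hp
  have m1 : MapsTo (Prod.fst : ℝ × ℝ → ℝ) (timeTriangle M.T) (Icc 0 M.T) :=
    fun r hr => ⟨hr.1, hr.2.1.trans hr.2.2⟩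
  have m2 : MapsTo (Prod.snd : ℝ × ℝ → ℝ) (timeTriangle M.T) (Icc 0 M.T) :=
    fun r hr => ⟨hr.1.trans hr.2.1, hr.2.2⟩
  have h1 := (M.load_continuousOn.comp continuousOn_fst m1) p hp
  have h2 := (M.load_continuousOn.comp continuousOn_snd m2) p hp
  rw [ContinuousWithinAt, tendsto_iff_dist_tendsto_zero] at h1 h2 ⊢
  refine squeeze_zero' (.of_forall fun _ => dist_nonneg) ?_ (by simpa using h1.add h2)
  filter_upwards [self_mem_nhdsWithin] with r hr
  have := hprim.abs_stateProb_sub_le (pol := pol) (m1 hp) (m1 hr) (m2 hp) (m2 hr) y z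
  rw [dist_comm, Real.dist_eq, Real.dist_eq, Real.dist_eq]
  exact this

theorem IsAdmissible.intervalIntegrable_transitionRate (hadm : IsAdmissible M pol) {x : ℕ}
    (hx : x ≤ M.C) (z : ℕ) :
    IntervalIntegrable (fun r => transitionRate M pol r x z) volume 0 M.T :=
  (M.lam_integrable.mul_continuousOn (((hadm.cont x hx 1).mul continuousOn_const).mono
    (by rw [uIcc_of_le M.T_pos.le]))).add (M.mu_integrable.mul_const _)

include hprim hadm

/-- The forward equation for the probability of a single state. -/
theorem IsPrimitives.stateProb_eq {s t : ℝ} (hs : s ∈ Icc 0 M.T) (ht : t ∈ Icc s M.T) {y z : ℕ}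
    (hy : y ≤ M.C) (hz : z ≤ M.C) :
    stateProb P Narr Nsrv U pol s y t z = (if y = z then 1 else 0) +
      ∫ r in s..t, ∑ x ∈ Finset.range (M.C + 1),
        stateProb P Narr Nsrv U pol s y r x * transitionRate M pol r x z := by
  have h := hprim.sum_stateProb_smul hadm hs.1 ht.1 ht.2 hy (fun x => if x = z then (1 : ℝ) else 0)
  have hsub : uIcc s t ⊆ Icc 0 M.T := by
    rw [uIcc_of_le ht.1]; exact Icc_subset_Icc hs.1 ht.2
  have hst : t ∈ Icc 0 M.T := ⟨hs.1.trans ht.1, ht.2⟩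
  simp only [smul_eq_mul, mul_ite, mul_one, mul_zero, Finset.sum_ite_eq', mem_range_succ_iff_le,
    if_pos hz] at h
  rw [h, ← intervalIntegral.integral_add]
  · congr 1
    refine intervalIntegral.integral_congr fun r _ => ?_
    simp only [← Finset.sum_add_distrib]
    refine Finset.sum_congr rfl fun x _ => ?_
    rw [transitionRate]
    ring
  · refine intervalIntegrable_fun_sum fun x hx => ?_
    exact (M.lam_intervalIntegrable hs hst).mul_continuousOn
      ((((hprim.continuousOn_stateProb hs y x).mul (hadm.cont x (mem_range_succ_iff_le.1 hx) 1)).mul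
        continuousOn_const).mono hsub)
  · refine intervalIntegrable_fun_sum fun x hx => ?_
    exact (M.mu_intervalIntegrable hs hst).mul_continuousOn
      (((hprim.continuousOn_stateProb hs y x).mul continuousOn_const).mono hsub)

/-- The transition probabilities of the queue solve the forward equation with `transitionRate`. -/
theorem IsPrimitives.isPropagator : IsPropagator (Finset.range (M.C + 1)) M.T
    (transitionRate M pol) (stateProb P Narr Nsrv U pol) where
  rate _ hx z _ := hadm.intervalIntegrable_transitionRate (mem_range_succ_iff_le.1 hx) z
  cont y _ z _ := hprim.continuousOn_uncurry_stateProb y z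
  eq _ hy _ hz _ hs _ ht := hprim.stateProb_eq hadm hs ht (mem_range_succ_iff_le.1 hy)
    (mem_range_succ_iff_le.1 hz)

theorem IsPrimitives.value_eq_totalReward {s : ℝ} (hs : s ∈ Icc 0 M.T) {x : ℕ} (hx : x ≤ M.C) :
    value M P Narr Nsrv U pol s x = totalReward (Finset.range (M.C + 1)) M.T
      (stateProb P Narr Nsrv U pol) (rewardRate M pol) (fun y => -(M.K3 * y)) s x := by
  rw [(hprim.integrable_reward_and_value_eq hadm hs hx).2, totalReward, sub_eq_add_neg,
    Finset.mul_sum, ← Finset.sum_neg_distrib]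
  congr 1
  refine Finset.sum_congr rfl fun y _ => ?_
  ring

theorem IsPrimitives.continuousOn_value {x : ℕ} (hx : x ≤ M.C) :
    ContinuousOn (fun s => value M P Narr Nsrv U pol s x) (Icc 0 M.T) :=
  ((hprim.isPropagator hadm).continuousOn_totalReward _
    (fun _ hz => hadm.intervalIntegrable_rewardRate (mem_range_succ_iff_le.1 hz))
    (mem_range_succ_iff_le.2 hx)).congr fun _ hs => hprim.value_eq_totalReward hadm hs hx

/-- Value of an admission in state `x` at time `r`: its reward, and the change of the value
function; zero if the system is full. -/
noncomputable def admissionGain {Ω : Type*} [MeasurableSpace Ω] (M : Model) (P : Measure Ω)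
    (Narr Nsrv : ℝ → Ω → ℕ) (U : ℕ → Ω → ℝ) (pol : Policy) (r : ℝ) (x : ℕ) : ℝ :=
  if x < M.C then
    value M P Narr Nsrv U pol r (x + 1) - value M P Narr Nsrv U pol r x + M.K1
  else 0

theorem IsPrimitives.continuousOn_admissionGain (x : ℕ) :
    ContinuousOn (fun r => admissionGain M P Narr Nsrv U pol r x) (Icc 0 M.T) := by
  unfold admissionGain
  split_ifs with h
  · exact ((hprim.continuousOn_value hadm h).sub (hprim.continuousOn_value hadm h.le)).add
      continuousOn_const
  · exact continuousOn_const

/-- Rate of change of the law of the queue under `pol'` caused by replacing the admission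
probabilities of `pol` with those of `pol'`. -/
noncomputable def admissionPerturbation {Ω : Type*} [MeasurableSpace Ω] (M : Model) (P : Measure Ω)
    (Narr Nsrv : ℝ → Ω → ℕ) (U : ℕ → Ω → ℝ) (pol pol' : Policy) (c : ℕ) (r : ℝ) (z : ℕ) : ℝ :=
  ∑ x ∈ Finset.range (M.C + 1),
    stateProb P Narr Nsrv U pol' 0 c r x * (M.lam r * (pol' r x 1 - pol r x 1)) *
      ((if x + 1 = z then 1 else 0) - if x = z then 1 else 0)

variable {pol' : Policy} (hadm' : IsAdmissible M pol') {c : ℕ}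

include hadm'

theorem IsPrimitives.intervalIntegrable_perturbation_term (c : ℕ) {x : ℕ} (hx : x ≤ M.C) :
    IntervalIntegrable (fun r => stateProb P Narr Nsrv U pol' 0 c r x *
      (M.lam r * (pol' r x 1 - pol r x 1))) volume 0 M.T := by
  have hu : uIcc 0 M.T = Icc 0 M.T := uIcc_of_le M.T_pos.le
  refine (M.lam_integrable.mul_continuousOn ?_).continuousOn_mul ?_
  · rw [hu]; exact (hadm'.cont x hx 1).sub (hadm.cont x hx 1)
  · rw [hu]; exact hprim.continuousOn_stateProb ⟨le_rfl, M.T_pos.le⟩ c x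

theorem IsPrimitives.intervalIntegrable_admissionPerturbation (c z : ℕ) :
    IntervalIntegrable (fun r => admissionPerturbation M P Narr Nsrv U pol pol' c r z)
      volume 0 M.T :=
  intervalIntegrable_fun_sum fun _ hx => (hprim.intervalIntegrable_perturbation_term hadm hadm' c
    (mem_range_succ_iff_le.1 hx)).mul_const _

variable (hc : c ≤ M.C)

include hc

/-- The forward equation under one policy as a perturbation of that under another policy. -/
theorem IsPrimitives.stateProb_eq_perturbed {t : ℝ} (ht : t ∈ Icc 0 M.T) {z : ℕ} (hz : z ≤ M.C) :
    stateProb P Narr Nsrv U pol' 0 c t z = (if c = z then 1 else 0) +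
      ((∫ r in 0..t, ∑ x ∈ Finset.range (M.C + 1),
        stateProb P Narr Nsrv U pol' 0 c r x * transitionRate M pol r x z) +
      ∫ r in 0..t, admissionPerturbation M P Narr Nsrv U pol pol' c r z) := by
  have h0 : (0 : ℝ) ∈ Icc 0 M.T := ⟨le_rfl, M.T_pos.le⟩
  have hpa : ∀ x ∈ Finset.range (M.C + 1), IntervalIntegrable (fun r =>
      stateProb P Narr Nsrv U pol' 0 c r x * transitionRate M pol r x z) volume 0 M.T :=
    fun x hx => (hadm.intervalIntegrable_transitionRate
      (mem_range_succ_iff_le.1 hx) z).continuousOn_mul (by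
        rw [uIcc_of_le M.T_pos.le]; exact hprim.continuousOn_stateProb h0 c x)
  rw [← intervalIntegral.integral_add
    (intervalIntegrable_of_mem (intervalIntegrable_fun_sum hpa) h0 ht)
    (intervalIntegrable_of_mem
      (hprim.intervalIntegrable_admissionPerturbation hadm hadm' c z) h0 ht),
    hprim.stateProb_eq hadm' h0 ht hc hz]
  congr 1
  refine intervalIntegral.integral_congr fun r _ => ?_
  simp only [admissionPerturbation, ← Finset.sum_add_distrib]
  refine Finset.sum_congr rfl fun x _ => ?_
  simp only [transitionRate]
  ring

/-- The law of the queue is Lipschitz in the admission probabilities. -/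
theorem IsPrimitives.abs_stateProb_sub_le_of_policy {δ : ℝ}
    (hδ : ∀ r ∈ Icc 0 M.T, ∀ x ≤ M.C, |pol' r x 1 - pol r x 1| ≤ δ) {t : ℝ}
    (ht : t ∈ Icc 0 M.T) {z : ℕ} (hz : z ≤ M.C) :
    |stateProb P Narr Nsrv U pol' 0 c t z - stateProb P Narr Nsrv U pol 0 c t z| ≤
      (M.C + 1) * ((M.C + 1) * ((∫ r in 0..M.T, M.lam r) * δ)) := by
  have h0 : (0 : ℝ) ∈ Icc 0 M.T := ⟨le_rfl, M.T_pos.le⟩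
  have hT : M.T ∈ Icc 0 M.T := ⟨M.T_pos.le, le_rfl⟩
  have hδ0 : 0 ≤ δ := (abs_nonneg _).trans (hδ 0 h0 0 (Nat.zero_le _))
  have key := (hprim.isPropagator hadm).variation_of_constants
    (b := fun y => if c = y then 1 else 0)
    (fun y _ => hprim.intervalIntegrable_admissionPerturbation hadm hadm' c y)
    (fun z _ => hprim.continuousOn_stateProb h0 c z)
    (fun z hz t ht => hprim.stateProb_eq_perturbed hadm hadm' hc ht (mem_range_succ_iff_le.1 hz))
    (mem_range_succ_iff_le.2 hz) ht
  rw [Finset.sum_add_distrib] at key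
  simp only [ite_mul, one_mul, zero_mul, Finset.sum_ite_eq, mem_range_succ_iff_le, if_pos hc] at key
  rw [key, add_sub_cancel_left, ← Real.norm_eq_abs]
  have hbound : ∀ y ∈ Finset.range (M.C + 1), ‖∫ r in 0..t,
      admissionPerturbation M P Narr Nsrv U pol pol' c r y *
        stateProb P Narr Nsrv U pol r y t z‖ ≤ (M.C + 1) * ((∫ r in 0..M.T, M.lam r) * δ) := by
    intro y _
    have hlam := M.lam_intervalIntegrable h0 ht
    calc _ ≤ ∫ r in 0..t, (M.C + 1) * (M.lam r * δ) := by
          refine intervalIntegral.norm_integral_le_of_norm_le ht.1 (.of_forall fun r hr => ?_)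
            ((hlam.mul_const δ).const_mul _)
          have hr : r ∈ Icc 0 M.T := ⟨hr.1.le, hr.2.trans ht.2⟩
          have h1 : ‖admissionPerturbation M P Narr Nsrv U pol pol' c r y‖ ≤
              ∑ _x ∈ Finset.range (M.C + 1), M.lam r * δ := by
            refine norm_sum_le_of_le _ fun x hx => ?_
            have hl := M.lam_nonneg r hr
            rw [norm_mul, norm_mul, norm_mul, Real.norm_of_nonneg hl,
              Real.norm_of_nonneg (stateProb_nonneg _ _ _ _), Real.norm_eq_abs]
            have h2 := hδ r hr x (mem_range_succ_iff_le.1 hx)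
            have h3 : ‖((if x + 1 = y then 1 else 0) - if x = y then 1 else 0 : ℝ)‖ ≤ 1 := by
              split_ifs <;> simp
            calc _ ≤ 1 * (M.lam r * δ) * 1 := by
                  gcongr
                  exact stateProb_le_one _ _ _ _
              _ = M.lam r * δ := by ring
          rw [Finset.sum_const, Finset.card_range, nsmul_eq_mul] at h1
          rw [norm_mul, Real.norm_of_nonneg (stateProb_nonneg _ _ _ _)]
          push_cast at h1
          exact (mul_le_of_le_one_right (norm_nonneg _) (stateProb_le_one _ _ _ _)).trans h1
      _ = (M.C + 1) * ((∫ r in 0..t, M.lam r) * δ) := by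
          rw [intervalIntegral.integral_const_mul, intervalIntegral.integral_mul_const]
      _ ≤ _ := by
          have h4 := M.integral_lam_nonneg ht hT ht.2
          rw [← intervalIntegral.integral_add_adjacent_intervals hlam
            (M.lam_intervalIntegrable ht hT)]
          gcongr
          linarith
  refine (norm_sum_le_of_le _ hbound).trans ?_
  rw [Finset.sum_const, Finset.card_range, nsmul_eq_mul]
  push_cast
  rfl

/-- The difference of the values of two policies, as an integral along the queue under the second
policy, with the value function of the first one. -/
theorem IsPrimitives.value_sub_value :
    value M P Narr Nsrv U pol' 0 c - value M P Narr Nsrv U pol 0 c =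
      ∫ r in 0..M.T, ∑ x ∈ Finset.range (M.C + 1), stateProb P Narr Nsrv U pol' 0 c r x *
        (M.lam r * ((pol' r x 1 - pol r x 1) * admissionGain M P Narr Nsrv U pol r x) +
          M.gam * (entropy M pol' r x - entropy M pol r x)) := by
  set S := Finset.range (M.C + 1) with hS
  have h0 : (0 : ℝ) ∈ Icc 0 M.T := ⟨le_rfl, M.T_pos.le⟩
  have hu : uIcc 0 M.T = Icc 0 M.T := uIcc_of_le M.T_pos.le
  have hle : ∀ {y}, y ∈ S → y ≤ M.C := mem_range_succ_iff_le.1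
  set p : ℝ → ℕ → ℝ := fun t z => stateProb P Narr Nsrv U pol' 0 c t z with hp
  set w : ℝ → ℕ → ℝ := fun r x => p r x * (M.lam r * (pol' r x 1 - pol r x 1)) with hw
  set d : ℝ → ℕ → ℝ := admissionPerturbation M P Narr Nsrv U pol pol' c with hd
  have hpc : ∀ z, ContinuousOn (fun t => p t z) (Icc 0 M.T) := fun z =>
    hprim.continuousOn_stateProb h0 c z
  have hwi : ∀ x ∈ S, IntervalIntegrable (fun r => w r x) volume 0 M.T := fun x hx =>
    hprim.intervalIntegrable_perturbation_term hadm hadm' c (hle hx)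
  have key := (hprim.isPropagator hadm).sum_reward_eq (ρ := rewardRate M pol)
    (fun y => -(M.K3 * (y : ℝ))) (fun z hz => hadm.intervalIntegrable_rewardRate (hle hz))
    M.T_pos.le (p := p) (d := d) (b := fun y => if c = y then 1 else 0)
    (fun z _ => hprim.intervalIntegrable_admissionPerturbation hadm hadm' c z) (fun z _ => hpc z)
    (fun z hz t ht => hprim.stateProb_eq_perturbed hadm hadm' hc ht (hle hz))
  have e1 : value M P Narr Nsrv U pol' 0 c =
      (∫ t in 0..M.T, ∑ z ∈ S, p t z * rewardRate M pol' t z) +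
        ∑ z ∈ S, p M.T z * -(M.K3 * (z : ℝ)) := hprim.value_eq_totalReward hadm' h0 hc
  have e2 : ∑ y ∈ S, (if c = y then 1 else 0) * totalReward S M.T
      (stateProb P Narr Nsrv U pol) (rewardRate M pol) (fun y => -(M.K3 * y)) 0 y =
      value M P Narr Nsrv U pol 0 c := by
    simp only [ite_mul, one_mul, zero_mul, Finset.sum_ite_eq, hS, mem_range_succ_iff_le, if_pos hc]
    exact (hprim.value_eq_totalReward hadm h0 hc).symm
  have hpρ : ∀ {pol'' : Policy}, IsAdmissible M pol'' → IntervalIntegrable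
      (fun t => ∑ z ∈ S, p t z * rewardRate M pol'' t z) volume 0 M.T := fun h =>
    intervalIntegrable_fun_sum fun z hz =>
      (h.intervalIntegrable_rewardRate (hle hz)).continuousOn_mul (by rw [hu]; exact hpc z)
  have e3 : ∫ r in 0..M.T, ∑ y ∈ S, d r y * totalReward S M.T
      (stateProb P Narr Nsrv U pol) (rewardRate M pol) (fun y => -(M.K3 * y)) r y =
      ∫ r in 0..M.T, ∑ x ∈ S, w r x * (admissionGain M P Narr Nsrv U pol r x - M.K1) := by
    refine intervalIntegral.integral_congr fun r hr => ?_
    rw [hu] at hr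
    -- both policies reject in a full system
    have hwC : w r M.C = 0 := by
      simp only [hw, hadm.unavailable_self hr, hadm'.unavailable_self hr, sub_self, mul_zero]
    simp only [hd, hS, admissionPerturbation]
    rw [sum_mul_increment hwC]
    refine Finset.sum_congr rfl fun x hx => ?_
    rcases (hle hx).eq_or_lt with rfl | hlt
    · rw [hwC, zero_mul, zero_mul]
    · rw [admissionGain, if_pos hlt, hprim.value_eq_totalReward hadm hr hlt,
        hprim.value_eq_totalReward hadm hr hlt.le]
      ring
  have hwg : IntervalIntegrable (fun r => ∑ x ∈ S,
      w r x * (admissionGain M P Narr Nsrv U pol r x - M.K1)) volume 0 M.T :=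
    intervalIntegrable_fun_sum fun x hx => (hwi x hx).mul_continuousOn (by
      rw [hu]; exact (hprim.continuousOn_admissionGain hadm x).sub continuousOn_const)
  rw [e2, e3] at key
  have e4 : value M P Narr Nsrv U pol' 0 c - value M P Narr Nsrv U pol 0 c =
      (∫ r in 0..M.T, ∑ x ∈ S, w r x * (admissionGain M P Narr Nsrv U pol r x - M.K1)) +
      ((∫ t in 0..M.T, ∑ z ∈ S, p t z * rewardRate M pol' t z) -
        ∫ t in 0..M.T, ∑ z ∈ S, p t z * rewardRate M pol t z) := by
    rw [e1]; linarith
  rw [e4, ← intervalIntegral.integral_sub (hpρ hadm') (hpρ hadm),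
    ← intervalIntegral.integral_add hwg ((hpρ hadm').sub (hpρ hadm))]
  refine intervalIntegral.integral_congr fun r _ => ?_
  simp only [← Finset.sum_sub_distrib, ← Finset.sum_add_distrib]
  refine Finset.sum_congr rfl fun x _ => ?_
  simp only [hw, rewardRate]
  ring

end

/-! ### Nonnegative functions with bounded second derivative, and their entropy -/

section

variable {E : Type*} [NormedAddCommGroup E] [NormedSpace ℝ E] {f : E → ℝ} {φ : E} {ρ B : ℝ}

/-- A bound of the second derivative is a Lipschitz constant of the derivative. -/
theorem norm_fderiv_sub_le_of_iteratedFDeriv_le (hf : ContDiffOn ℝ 2 f (Metric.ball φ ρ))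
    (hB : ∀ ψ ∈ Metric.ball φ ρ, ‖iteratedFDeriv ℝ 2 f ψ‖ ≤ B) {ψ ψ' : E}
    (hψ : ψ ∈ Metric.ball φ ρ) (hψ' : ψ' ∈ Metric.ball φ ρ) :
    ‖fderiv ℝ f ψ' - fderiv ℝ f ψ‖ ≤ B * ‖ψ' - ψ‖ := by
  refine (convex_ball φ ρ).norm_image_sub_le_of_norm_fderiv_le (𝕜 := ℝ) (fun ξ hξ => ?_)
    (fun ξ hξ => ?_) hψ hψ'
  · exact ((hf.contDiffAt (Metric.isOpen_ball.mem_nhds hξ)).fderiv_right (m := 1)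
      (by norm_num)).differentiableAt (by norm_num)
  · rw [← norm_iteratedFDeriv_one (𝕜 := ℝ), norm_iteratedFDeriv_fderiv]
    exact hB ξ hξ

/-- First order Taylor expansion with quadratic error. -/
theorem abs_sub_sub_fderiv_le (hf : ContDiffOn ℝ 2 f (Metric.ball φ ρ))
    (hB : ∀ ψ ∈ Metric.ball φ ρ, ‖iteratedFDeriv ℝ 2 f ψ‖ ≤ B) {ψ ψ' : E}
    (hψ : ψ ∈ Metric.ball φ ρ) (hψ' : ψ' ∈ Metric.ball φ ρ) :
    |f ψ' - f ψ - fderiv ℝ f ψ (ψ' - ψ)| ≤ B * ‖ψ' - ψ‖ * ‖ψ' - ψ‖ := by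
  have hseg : segment ℝ ψ ψ' ⊆ Metric.ball φ ρ := (convex_ball φ ρ).segment_subset hψ hψ'
  have hB0 : 0 ≤ B := (norm_nonneg _).trans (hB ψ hψ)
  rw [← Real.norm_eq_abs]
  refine (convex_segment (𝕜 := ℝ) ψ ψ').norm_image_sub_le_of_norm_fderiv_le' (𝕜 := ℝ)
    (fun ξ hξ => ?_) (fun ξ hξ => ?_) (left_mem_segment ℝ ψ ψ') (right_mem_segment ℝ ψ ψ')
  · exact (hf.contDiffAt (Metric.isOpen_ball.mem_nhds (hseg hξ))).differentiableAt (by norm_num)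
  · refine (norm_fderiv_sub_le_of_iteratedFDeriv_le hf hB hψ (hseg hξ)).trans ?_
    gcongr
    exact norm_sub_le_of_mem_segment hξ

/-- Constant in the bound of the derivative of a function with values in `[0, 1]` by its square
root, on the ball of radius `ρ / 2`, if the second derivative is bounded by `B` on the ball of
radius `ρ`. -/
noncomputable def sqrtConst (ρ B : ℝ) : ℝ := (1 + B * (ρ / 2) ^ 2) / (ρ / 2)

variable (hρ : 0 < ρ) (hf : ContDiffOn ℝ 2 f (Metric.ball φ ρ))
  (hB : ∀ ψ ∈ Metric.ball φ ρ, ‖iteratedFDeriv ℝ 2 f ψ‖ ≤ B)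
  (hmem : ∀ ψ ∈ Metric.ball φ ρ, f ψ ∈ Icc 0 1)

include hρ hB in
theorem sqrtConst_nonneg : 0 ≤ sqrtConst ρ B := by
  have hB0 : 0 ≤ B := (norm_nonneg _).trans (hB φ (Metric.mem_ball_self hρ))
  unfold sqrtConst
  positivity

omit [NormedSpace ℝ E] in
theorem ball_half_subset (hρ : 0 < ρ) : Metric.ball φ (ρ / 2) ⊆ Metric.ball φ ρ :=
  Metric.ball_subset_ball (by linarith)

include hmem in
omit [NormedSpace ℝ E] in
theorem isLocalMin_of_eq_zero {ψ : E} (hψ : ψ ∈ Metric.ball φ ρ)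
    (h0 : f ψ = 0) : IsLocalMin f ψ := by
  filter_upwards [Metric.isOpen_ball.mem_nhds hψ] with ξ hξ
  rw [h0]
  exact (hmem ξ hξ).1

include hf in
theorem differentiableAt_of_mem_ball {ψ : E} (hψ : ψ ∈ Metric.ball φ ρ) :
    DifferentiableAt ℝ f ψ :=
  (hf.contDiffAt (Metric.isOpen_ball.mem_nhds hψ)).differentiableAt (by norm_num)

include hf hmem hB

/-- The entropy term `-f log f` is differentiable even where `f` vanishes, because `f` has a
minimum there and grows quadratically. -/
theorem hasFDerivAt_negMulLog_comp {ψ : E} (hψ : ψ ∈ Metric.ball φ ρ) :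
    HasFDerivAt (fun ξ => Real.negMulLog (f ξ)) (-(1 + Real.log (f ψ)) • fderiv ℝ f ψ) ψ := by
  have hd := differentiableAt_of_mem_ball hf hψ
  rcases (hmem ψ hψ).1.eq_or_lt with h0 | h0
  · have hmin := (isLocalMin_of_eq_zero hmem hψ h0.symm).fderiv_eq_zero
    rw [hmin, smul_zero, hasFDerivAt_iff_isLittleO]
    simp only [← h0, Real.negMulLog_zero, sub_zero, _root_.zero_apply]
    have hB0 : 0 ≤ B := (norm_nonneg _).trans (hB ψ hψ)
    have hsq : ∀ᶠ ξ in 𝓝 ψ, √(f ξ) ≤ √B * ‖ξ - ψ‖ := by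
      filter_upwards [Metric.isOpen_ball.mem_nhds hψ] with ξ hξ
      have h1 := (abs_le.1 (abs_sub_sub_fderiv_le hf hB hψ hξ)).2
      rw [hmin, ← h0, sub_zero, _root_.zero_apply, sub_zero] at h1
      calc √(f ξ) ≤ √(B * ‖ξ - ψ‖ ^ 2) := Real.sqrt_le_sqrt (by linarith)
        _ = √B * ‖ξ - ψ‖ := by rw [Real.sqrt_mul hB0, Real.sqrt_sq (norm_nonneg _)]
    have hO : (fun ξ => √(f ξ)) =O[𝓝 ψ] fun ξ => ‖ξ - ψ‖ := by
      refine Asymptotics.IsBigO.of_bound (√B) ?_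
      filter_upwards [hsq] with ξ hξ
      rwa [Real.norm_of_nonneg (Real.sqrt_nonneg _), norm_norm]
    -- `-x log x = √x * (2 * (-√x log √x))`, where the second factor tends to zero
    have ho : (fun ξ => 2 * Real.negMulLog √(f ξ)) =o[𝓝 ψ] fun _ => (1 : ℝ) := by
      rw [Asymptotics.isLittleO_one_iff]
      have h1 : ContinuousAt (fun ξ => 2 * Real.negMulLog √(f ξ)) ψ :=
        continuousAt_const.mul (Real.continuous_negMulLog.continuousAt.comp
          (Real.continuous_sqrt.continuousAt.comp hd.continuousAt))
      have h2 := h1.tendsto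
      simpa [← h0] using h2
    have := hO.mul_isLittleO ho
    simp only [mul_one] at this
    refine (Asymptotics.isLittleO_norm_right.1 this).congr' ?_ EventuallyEq.rfl
    filter_upwards [Metric.isOpen_ball.mem_nhds hψ] with ξ hξ
    have hξ0 := Real.mul_self_sqrt (hmem ξ hξ).1
    conv_rhs => rw [← hξ0, Real.negMulLog_mul]
    ring
  · rw [neg_add_rev, ← sub_eq_add_neg]
    exact (Real.hasDerivAt_negMulLog h0.ne').comp_hasFDerivAt ψ hd.hasFDerivAt

include hρ

/-- The derivative of a nonnegative function with bounded second derivative is controlled by the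
square root of the function: otherwise the function would become negative nearby. -/
theorem norm_fderiv_le_mul_sqrt {ψ : E} (hψ : ψ ∈ Metric.ball φ (ρ / 2)) :
    ‖fderiv ℝ f ψ‖ ≤ sqrtConst ρ B * √(f ψ) := by
  have hψ' := ball_half_subset hρ hψ
  have hK := sqrtConst_nonneg hρ hB
  have hfψ := hmem ψ hψ'
  rcases hfψ.1.eq_or_lt with h0 | h0
  · rw [(isLocalMin_of_eq_zero hmem hψ' h0.symm).fderiv_eq_zero, norm_zero]
    positivity
  set σ := ρ / 2 with hσ
  have hσ0 : 0 < σ := half_pos hρ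
  set R := √(f ψ) with hR
  have hR0 : 0 < R := Real.sqrt_pos.2 h0
  have hR1 : R ≤ 1 := Real.sqrt_le_one.2 hfψ.2
  have hRR : R * R = f ψ := Real.mul_self_sqrt hfψ.1
  -- the quadratic expansion at distance `σ * √(f ψ)` in the direction `-v`
  have hone : ∀ v : E, ‖v‖ = 1 → fderiv ℝ f ψ v ≤ sqrtConst ρ B * R := by
    intro v hv
    have hnorm : ‖(-(σ * R)) • v‖ = σ * R := by
      rw [norm_smul, hv, mul_one, norm_neg, Real.norm_of_nonneg (by positivity)]
    have hin : ψ + (-(σ * R)) • v ∈ Metric.ball φ ρ := by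
      rw [Metric.mem_ball, dist_eq_norm] at hψ ⊢
      calc _ = ‖(ψ - φ) + (-(σ * R)) • v‖ := by congr 1; abel
        _ ≤ ‖ψ - φ‖ + ‖(-(σ * R)) • v‖ := norm_add_le _ _
        _ < σ + σ * 1 := by
            rw [hnorm]
            exact add_lt_add_of_lt_of_le hψ (by gcongr)
        _ = ρ := by rw [hσ]; ring
    have h1 := (abs_le.1 (abs_sub_sub_fderiv_le hf hB hψ' hin)).2
    rw [add_sub_cancel_left, hnorm, map_smul, smul_eq_mul] at h1
    have h2 := (hmem _ hin).1
    have h3 : σ * R * fderiv ℝ f ψ v ≤ σ * R * (sqrtConst ρ B * R) := by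
      have h4 : σ * R * (sqrtConst ρ B * R) = R * R * (1 + B * σ ^ 2) := by
        rw [sqrtConst, ← hσ]
        field_simp
      rw [h4]
      nlinarith
    exact le_of_mul_le_mul_left h3 (by positivity)
  refine ContinuousLinearMap.opNorm_le_of_unit_norm (𝕜 := ℝ) (by positivity) fun v hv => ?_
  rw [Real.norm_eq_abs, abs_le]
  refine ⟨?_, hone v hv⟩
  have := hone (-v) (by rwa [norm_neg])
  rw [map_neg] at this
  linarith

theorem norm_fderiv_le_sqrtConst {ψ : E} (hψ : ψ ∈ Metric.ball φ (ρ / 2)) :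
    ‖fderiv ℝ f ψ‖ ≤ sqrtConst ρ B := by
  refine (norm_fderiv_le_mul_sqrt hρ hf hB hmem hψ).trans
    (mul_le_of_le_one_right (sqrtConst_nonneg hρ hB) (Real.sqrt_le_one.2 ?_))
  exact (hmem ψ (ball_half_subset hρ hψ)).2

/-- The derivative of `-f log f` stays bounded as `f` tends to zero: the logarithm is absorbed by
the factor `√f` in the bound of the derivative of `f`. -/
theorem norm_log_smul_fderiv_le {ψ : E} (hψ : ψ ∈ Metric.ball φ (ρ / 2)) :
    ‖-(1 + Real.log (f ψ)) • fderiv ℝ f ψ‖ ≤ 3 * sqrtConst ρ B := by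
  have hfψ := hmem ψ (ball_half_subset hρ hψ)
  have hK := sqrtConst_nonneg hρ hB
  have hD := norm_fderiv_le_mul_sqrt hρ hf hB hmem hψ
  rcases hfψ.1.eq_or_lt with h0 | h0
  · rw [← h0, Real.sqrt_zero, mul_zero] at hD
    rw [norm_smul, le_antisymm hD (norm_nonneg _), mul_zero]
    positivity
  set R := √(f ψ) with hR
  have hR0 : 0 < R := Real.sqrt_pos.2 h0
  have hR1 : R ≤ 1 := Real.sqrt_le_one.2 hfψ.2
  have hlog : Real.log (f ψ) = 2 * Real.log R := by rw [hR, Real.log_sqrt h0.le]; ring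
  have h1 := (Real.abs_log_mul_self_lt R hR0 hR1).le
  rw [abs_mul, abs_of_pos hR0] at h1
  rw [norm_smul, norm_neg, Real.norm_eq_abs, hlog]
  calc |1 + 2 * Real.log R| * ‖fderiv ℝ f ψ‖
      ≤ (1 + 2 * |Real.log R|) * (sqrtConst ρ B * R) := by
        gcongr
        refine (abs_add_le _ _).trans ?_
        rw [abs_one, abs_mul, abs_two]
    _ = sqrtConst ρ B * (R + 2 * (|Real.log R| * R)) := by ring
    _ ≤ sqrtConst ρ B * (1 + 2 * 1) := by gcongr
    _ = 3 * sqrtConst ρ B := by ring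

theorem abs_sub_le_sqrtConst {ψ ψ' : E} (hψ : ψ ∈ Metric.ball φ (ρ / 2))
    (hψ' : ψ' ∈ Metric.ball φ (ρ / 2)) : |f ψ' - f ψ| ≤ sqrtConst ρ B * ‖ψ' - ψ‖ :=
  (convex_ball φ (ρ / 2)).norm_image_sub_le_of_norm_fderiv_le (𝕜 := ℝ)
    (fun _ hξ => differentiableAt_of_mem_ball hf (ball_half_subset hρ hξ))
    (fun _ hξ => norm_fderiv_le_sqrtConst hρ hf hB hmem hξ) hψ hψ'

theorem abs_negMulLog_sub_le {ψ ψ' : E} (hψ : ψ ∈ Metric.ball φ (ρ / 2))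
    (hψ' : ψ' ∈ Metric.ball φ (ρ / 2)) :
    |Real.negMulLog (f ψ') - Real.negMulLog (f ψ)| ≤ 3 * sqrtConst ρ B * ‖ψ' - ψ‖ :=
  (convex_ball φ (ρ / 2)).norm_image_sub_le_of_norm_hasFDerivWithin_le (𝕜 := ℝ)
    (fun _ hξ => (hasFDerivAt_negMulLog_comp hf hB hmem
      (ball_half_subset hρ hξ)).hasFDerivWithinAt)
    (fun _ hξ => norm_log_smul_fderiv_le hρ hf hB hmem hξ) hψ hψ'

end

/-! ### Integrals of inverse probabilities against the admissions -/

section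

variable {Ω : Type*} [MeasurableSpace Ω] {P : Measure Ω} [IsProbabilityMeasure P] {M : Model}
  {Narr Nsrv : ℝ → Ω → ℕ} {U : ℕ → Ω → ℝ} (hprim : IsPrimitives M P Narr Nsrv U)
  {pol : Policy} (hadm : IsAdmissible M pol) {s e : ℝ} (hs : 0 ≤ s) (hse : s ≤ e) (he : e ≤ M.T)
  {x : ℕ} (hx : x ≤ M.C)

include hprim hadm hs hse he hx

/-- Along almost every path, the integrals against the admissions are finite sums over times at
which the admission probability is positive. -/
theorem IsPrimitives.ae_exists_jumpIntegral_eq_sum : ∀ᵐ ω ∂P, ∃ (k : ℕ) (τ a : ℕ → ℝ),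
    (∀ i < k, 0 ≤ a i ∧ (a i ≠ 0 → τ i ∈ Icc 0 M.T ∧
      Function.leftLim (queueLength pol (fun r => Narr r ω) (fun r => Nsrv r ω)
        (fun i => U i ω) s x) (τ i) ≤ M.C ∧
      0 < pol (τ i) (Function.leftLim (queueLength pol (fun r => Narr r ω) (fun r => Nsrv r ω)
        (fun i => U i ω) s x) (τ i)) 1)) ∧
    ∀ {E : Type} [AddCommGroup E] [Module ℝ E] (f : ℝ → E),
      jumpIntegral f (admitted pol (fun r => Narr r ω) (fun r => Nsrv r ω) (fun i => U i ω) s x)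
        s e = ∑ i ∈ Finset.range k, a i • f (τ i) := by
  have hI : ∀ k i, unifGrid s e k i ∈ Icc 0 M.T := fun k i =>
    ⟨hs.trans (unifGrid_mem hse k i).1, (unifGrid_mem hse k i).2.trans he⟩
  obtain ⟨ns, -, hgood⟩ := hprim.exists_subseq_queueLength_eq hadm hs hse he hx
  filter_upwards [hgood, hprim.ae_U_nonneg] with ω hω hU
  obtain ⟨j, hg, hne, hle, -⟩ := hω.exists
  obtain ⟨τ, h1, h2⟩ := GoodGrid.jumpIntegral_eq.{0} (hg := hg) (hprim.arrivals.isCountingPath ω)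
    (hprim.services.isCountingPath ω) (unifGrid_mono hse (ns j)) (hI _ 0).1
    (fun i => (hI _ i).2) (x₀ := x) (fun i _ => hle i)
  rw [unifGrid_zero, unifGrid_self hne] at h2
  rw [unifGrid_zero] at h1
  refine ⟨ns j, τ, _, fun i hi => ⟨?_, fun h0 => ?_⟩, h2⟩
  · refine mul_nonneg (sub_nonneg.2 (Nat.cast_le.2 ?_)) (gridAccept_mem _ _ _ _ _ _ _).1
    exact (hprim.arrivals.isCountingPath ω).mono (hI _ i) (hI _ _)
      (unifGrid_mono hse _ (Nat.le_add_right i 1))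
  · obtain ⟨hτ, h3, -⟩ := h1 i hi
    have hmono : Narr (unifGrid s e (ns j) i) ω ≤ Narr (unifGrid s e (ns j) (i + 1)) ω :=
      (hprim.arrivals.isCountingPath ω).mono (hI _ i) (hI _ _)
        (unifGrid_mono hse _ (Nat.le_add_right i 1))
    have hlt : Narr (unifGrid s e (ns j) i) ω < Narr (unifGrid s e (ns j) (i + 1)) ω := by
      refine lt_of_le_of_ne hmono fun h => h0 ?_
      rw [h, sub_self, zero_mul]
    have hacc : U (Narr (unifGrid s e (ns j) i) ω) ω < pol (unifGrid s e (ns j) i)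
        (gridQueue pol (fun r => Narr r ω) (fun r => Nsrv r ω) (fun j => U j ω)
          (unifGrid s e (ns j)) x i) 1 := by
      by_contra h
      exact h0 (by rw [gridAccept, indicator_of_notMem (mt mem_Iio.1 h), mul_zero])
    rw [(h3 hlt).2]
    exact ⟨⟨(hI _ i).1.trans hτ.1, hτ.2.trans (hI _ _).2⟩, hle i,
      (hU _).trans_lt (((hg i hi).2 hlt _ (hle i) _ hτ).2 hacc)⟩

variable {E : Type} [NormedAddCommGroup E] [NormedSpace ℝ E] [CompleteSpace E]

/-- The compensation formula for integrands divided by the admission probability, which may be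
arbitrarily small: the division is cancelled by the probability of the admission. -/
theorem IsPrimitives.integral_jumpIntegral_inv_smul {v : ℝ → ℕ → E}
    (hv : ∀ y ≤ M.C, ContinuousOn (fun r => v r y) (Icc 0 M.T)) :
    Integrable (fun ω => jumpIntegral (fun r =>
        (pol r (Function.leftLim (queueLength pol (fun r => Narr r ω) (fun r => Nsrv r ω)
          (fun i => U i ω) s x) r) 1)⁻¹ • v r (Function.leftLim (queueLength pol
          (fun r => Narr r ω) (fun r => Nsrv r ω) (fun i => U i ω) s x) r))
      (admitted pol (fun r => Narr r ω) (fun r => Nsrv r ω) (fun i => U i ω) s x) s e) P ∧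
    ∫ ω, jumpIntegral (fun r =>
        (pol r (Function.leftLim (queueLength pol (fun r => Narr r ω) (fun r => Nsrv r ω)
          (fun i => U i ω) s x) r) 1)⁻¹ • v r (Function.leftLim (queueLength pol
          (fun r => Narr r ω) (fun r => Nsrv r ω) (fun i => U i ω) s x) r))
      (admitted pol (fun r => Narr r ω) (fun r => Nsrv r ω) (fun i => U i ω) s x) s e ∂P =
    ∫ r in s..e, ∑ y ∈ Finset.range (M.C + 1), M.lam r •
      ((stateProb P Narr Nsrv U pol s x r y * pol r y 1) • ((pol r y 1)⁻¹ • v r y)) := by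
  have hsI : s ∈ Icc 0 M.T := ⟨hs, hse.trans he⟩
  have heI : e ∈ Icc 0 M.T := ⟨hs.trans hse, he⟩
  have huIcc : uIcc s e ⊆ Icc 0 M.T := ordConnected_Icc.uIcc_subset hsI heI
  obtain ⟨B, hB0, hB⟩ := exists_forall_norm_le M.C hv
  set ε : ℕ → ℝ := fun n => 1 / ((n : ℝ) + 1) with hε
  have hε0 : ∀ n, 0 < ε n := fun n => Nat.one_div_pos_of_nat
  have hεlim : Tendsto ε atTop (𝓝 0) := tendsto_one_div_add_atTop_nhds_zero_nat
  set h : ℕ → ℝ → ℕ → E := fun n r y => (max (pol r y 1) (ε n))⁻¹ • v r y with hh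
  have hcont : ∀ n, ∀ y ≤ M.C, ContinuousOn (fun r => h n r y) (Icc 0 M.T) := fun n y hy =>
    (((hadm.cont y hy 1).sup continuousOn_const).inv₀ fun r _ =>
      (lt_max_of_lt_right (hε0 n)).ne').smul (hv y hy)
  -- truncation does not matter where the probability is positive, for small thresholds
  have hlim : ∀ r y, 0 < pol r y 1 → Tendsto (fun n => h n r y) atTop
      (𝓝 ((pol r y 1)⁻¹ • v r y)) := by
    intro r y hpos
    refine tendsto_const_nhds.congr' ?_
    filter_upwards [hεlim.eventually (gt_mem_nhds hpos)] with n hn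
    rw [hh]
    simp only
    rw [max_eq_left hn.le]
  have hle : ∀ n r y, 0 < pol r y 1 → ‖h n r y‖ ≤ ‖(pol r y 1)⁻¹ • v r y‖ := by
    intro n r y hpos
    rw [hh, norm_smul, norm_smul]
    gcongr
    rw [norm_inv, norm_inv, Real.norm_of_nonneg hpos.le,
      Real.norm_of_nonneg (hpos.le.trans (le_max_left _ _))]
    gcongr
    exact le_max_left _ _
  have hπh : ∀ n, ∀ y ≤ M.C, ∀ r ∈ Icc 0 M.T, pol r y 1 * ‖h n r y‖ ≤ B := by
    intro n y hy r hr
    have hp := (hadm.mem_Icc hr hy 1).1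
    have hm : 0 < max (pol r y 1) (ε n) := lt_max_of_lt_right (hε0 n)
    rw [hh, norm_smul, norm_inv, Real.norm_of_nonneg hm.le, ← mul_assoc, ← div_eq_mul_inv]
    exact (mul_le_of_le_one_left (norm_nonneg _) (div_le_one_of_le₀ (le_max_left _ _) hm.le)).trans
      (hB y hy r hr)
  have hpath := hprim.ae_exists_jumpIntegral_eq_sum hadm hs hse he hx
  have hZ := fun n => hprim.integral_jumpIntegral hadm hs hse he hx (hcont n)
  have hN := fun n => hprim.integral_jumpIntegral hadm hs hse he hx (h := fun r y => ‖h n r y‖)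
    fun y hy => (hcont n y hy).norm
  have hlamI := M.lam_intervalIntegrable hsI heI
  have hq := fun y => (hprim.continuousOn_stateProb (pol := pol) hsI x y)
  -- uniform bound of the expected norms
  have hNint : ∀ n, ∫ ω, jumpIntegral (fun r => ‖h n r (Function.leftLim (queueLength pol
        (fun r => Narr r ω) (fun r => Nsrv r ω) (fun i => U i ω) s x) r)‖)
      (admitted pol (fun r => Narr r ω) (fun r => Nsrv r ω) (fun i => U i ω) s x) s e ∂P ≤
      ∫ r in s..e, ∑ _y ∈ Finset.range (M.C + 1), M.lam r * B := by
    intro n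
    rw [(hN n).2]
    refine intervalIntegral.integral_mono_on hse (intervalIntegrable_fun_sum fun y hy => ?_)
      (intervalIntegrable_fun_sum fun y _ => hlamI.mul_const B) fun r hr =>
        Finset.sum_le_sum fun y hy => ?_
    · have hy := mem_range_succ_iff_le.1 hy
      exact hlamI.mul_continuousOn ((((hq y).mul (hadm.cont y hy 1)).mul
        (hcont n y hy).norm).mono huIcc)
    · have hy := mem_range_succ_iff_le.1 hy
      have hr : r ∈ Icc 0 M.T := ⟨hs.trans hr.1, hr.2.trans he⟩
      have hl := M.lam_nonneg r hr
      have hp := (hadm.mem_Icc hr hy 1).1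
      simp only [smul_eq_mul]
      gcongr
      rw [mul_assoc]
      exact (mul_le_of_le_one_left (by positivity) (stateProb_le_one _ _ _ _)).trans
        (hπh n y hy r hr)
  have hNnonneg : ∀ n, ∀ᵐ ω ∂P, 0 ≤ jumpIntegral (fun r => ‖h n r (Function.leftLim
      (queueLength pol (fun r => Narr r ω) (fun r => Nsrv r ω) (fun i => U i ω) s x) r)‖)
      (admitted pol (fun r => Narr r ω) (fun r => Nsrv r ω) (fun i => U i ω) s x) s e := by
    intro n
    filter_upwards [hpath] with ω hω
    obtain ⟨k, τ, a, h1, h2⟩ := hω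
    rw [h2]
    exact Finset.sum_nonneg fun i hi =>
      mul_nonneg (h1 i (Finset.mem_range.1 hi)).1 (norm_nonneg _)
  -- integrability of the limit, by Fatou's lemma
  have hlimN : ∀ᵐ ω ∂P, Tendsto (fun n => jumpIntegral (fun r => ‖h n r (Function.leftLim
      (queueLength pol (fun r => Narr r ω) (fun r => Nsrv r ω) (fun i => U i ω) s x) r)‖)
      (admitted pol (fun r => Narr r ω) (fun r => Nsrv r ω) (fun i => U i ω) s x) s e) atTop
      (𝓝 (jumpIntegral (fun r =>
        ‖(pol r (Function.leftLim (queueLength pol (fun r => Narr r ω) (fun r => Nsrv r ω)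
          (fun i => U i ω) s x) r) 1)⁻¹ • v r (Function.leftLim (queueLength pol
          (fun r => Narr r ω) (fun r => Nsrv r ω) (fun i => U i ω) s x) r)‖)
      (admitted pol (fun r => Narr r ω) (fun r => Nsrv r ω) (fun i => U i ω) s x) s e)) := by
    filter_upwards [hpath] with ω hω
    obtain ⟨k, τ, a, h1, h2⟩ := hω
    simp only [h2]
    refine tendsto_finsetSum _ fun i hi => ?_
    by_cases h0 : a i = 0
    · simp [h0]
    · exact ((hlim _ _ ((h1 i (Finset.mem_range.1 hi)).2 h0).2.2).norm).const_smul (a i)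
  have hlimZ : ∀ᵐ ω ∂P, Tendsto (fun n => jumpIntegral (fun r => h n r (Function.leftLim
      (queueLength pol (fun r => Narr r ω) (fun r => Nsrv r ω) (fun i => U i ω) s x) r))
      (admitted pol (fun r => Narr r ω) (fun r => Nsrv r ω) (fun i => U i ω) s x) s e) atTop
      (𝓝 (jumpIntegral (fun r =>
        (pol r (Function.leftLim (queueLength pol (fun r => Narr r ω) (fun r => Nsrv r ω)
          (fun i => U i ω) s x) r) 1)⁻¹ • v r (Function.leftLim (queueLength pol
          (fun r => Narr r ω) (fun r => Nsrv r ω) (fun i => U i ω) s x) r))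
      (admitted pol (fun r => Narr r ω) (fun r => Nsrv r ω) (fun i => U i ω) s x) s e)) := by
    filter_upwards [hpath] with ω hω
    obtain ⟨k, τ, a, h1, h2⟩ := hω
    simp only [h2]
    refine tendsto_finsetSum _ fun i hi => ?_
    by_cases h0 : a i = 0
    · simp [h0]
    · exact (hlim _ _ ((h1 i (Finset.mem_range.1 hi)).2 h0).2.2).const_smul (a i)
  have hNlim : Integrable (fun ω => jumpIntegral (fun r =>
        ‖(pol r (Function.leftLim (queueLength pol (fun r => Narr r ω) (fun r => Nsrv r ω)
          (fun i => U i ω) s x) r) 1)⁻¹ • v r (Function.leftLim (queueLength pol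
          (fun r => Narr r ω) (fun r => Nsrv r ω) (fun i => U i ω) s x) r)‖)
      (admitted pol (fun r => Narr r ω) (fun r => Nsrv r ω) (fun i => U i ω) s x) s e) P := by
    refine ⟨aestronglyMeasurable_of_tendsto_ae _ (fun n => (hN n).1.aestronglyMeasurable) hlimN, ?_⟩
    refine lt_of_le_of_lt (b := ENNReal.ofReal
      (∫ r in s..e, ∑ _y ∈ Finset.range (M.C + 1), M.lam r * B)) ?_ ENNReal.ofReal_lt_top
    refine (lintegral_congr_ae (hlimN.mono fun ω hω => hω.enorm.liminf_eq)).ge.trans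
      ((lintegral_liminf_le' fun n => (hN n).1.aestronglyMeasurable.enorm).trans
      (liminf_le_of_le (by isBoundedDefault) fun b hb => ?_))
    obtain ⟨n, hn⟩ := hb.exists
    refine hn.trans ?_
    rw [lintegral_congr_ae ((hNnonneg n).mono fun ω hω => Real.enorm_eq_ofReal hω),
      ← ofReal_integral_eq_lintegral_ofReal (hN n).1 (hNnonneg n)]
    exact ENNReal.ofReal_le_ofReal (hNint n)
  have hdom : ∀ n, ∀ᵐ ω ∂P, ‖jumpIntegral (fun r => h n r (Function.leftLim
      (queueLength pol (fun r => Narr r ω) (fun r => Nsrv r ω) (fun i => U i ω) s x) r))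
      (admitted pol (fun r => Narr r ω) (fun r => Nsrv r ω) (fun i => U i ω) s x) s e‖ ≤
      jumpIntegral (fun r =>
        ‖(pol r (Function.leftLim (queueLength pol (fun r => Narr r ω) (fun r => Nsrv r ω)
          (fun i => U i ω) s x) r) 1)⁻¹ • v r (Function.leftLim (queueLength pol
          (fun r => Narr r ω) (fun r => Nsrv r ω) (fun i => U i ω) s x) r)‖)
      (admitted pol (fun r => Narr r ω) (fun r => Nsrv r ω) (fun i => U i ω) s x) s e := by
    intro n
    filter_upwards [hpath] with ω hω
    obtain ⟨k, τ, a, h1, h2⟩ := hω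
    rw [h2, h2]
    refine norm_sum_le_of_le _ fun i hi => ?_
    obtain ⟨h3, h4⟩ := h1 i (Finset.mem_range.1 hi)
    rw [norm_smul, Real.norm_of_nonneg h3, smul_eq_mul]
    rcases eq_or_ne (a i) 0 with h0 | h0
    · simp [h0]
    · exact mul_le_mul_of_nonneg_left (hle n _ _ (h4 h0).2.2) h3
  refine integrable_and_integral_eq_of_subseq strictMono_id
    (fun n => (hZ n).1.aestronglyMeasurable) hNlim hdom hlimZ ?_
  -- convergence of the compensators
  simp only [(hZ _).2]
  refine intervalIntegral.tendsto_integral_filter_of_dominated_convergence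
    (fun r => ∑ _y ∈ Finset.range (M.C + 1), M.lam r * B) (.of_forall fun n => ?_)
    (.of_forall fun n => .of_forall fun r hr => ?_)
    (intervalIntegrable_fun_sum fun y _ => hlamI.mul_const B) (.of_forall fun r hr => ?_)
  · refine (intervalIntegrable_iff.1
      (intervalIntegrable_fun_sum fun y hy => ?_)).aestronglyMeasurable
    have hy := mem_range_succ_iff_le.1 hy
    exact hlamI.smul_continuousOn ((((hq y).mul (hadm.cont y hy 1)).smul
        (hcont n y hy)).mono huIcc)
  · rw [uIoc_of_le hse] at hr
    have hr : r ∈ Icc 0 M.T := ⟨hs.trans hr.1.le, hr.2.trans he⟩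
    refine norm_sum_le_of_le _ fun y hy => ?_
    have hy := mem_range_succ_iff_le.1 hy
    have hl := M.lam_nonneg r hr
    have hp := (hadm.mem_Icc hr hy 1).1
    have hq0 :=
      stateProb_nonneg (P := P) (Narr := Narr) (Nsrv := Nsrv) (U := U) (pol := pol) s x r y
    rw [norm_smul, norm_smul, Real.norm_of_nonneg hl, Real.norm_of_nonneg (mul_nonneg hq0 hp)]
    gcongr
    rw [mul_assoc]
    exact (mul_le_of_le_one_left (by positivity) (stateProb_le_one _ _ _ _)).trans
        (hπh n y hy r hr)
  · rw [uIoc_of_le hse] at hr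
    have hr : r ∈ Icc 0 M.T := ⟨hs.trans hr.1.le, hr.2.trans he⟩
    refine tendsto_finsetSum _ fun y hy => ?_
    rcases (hadm.mem_Icc hr (mem_range_succ_iff_le.1 hy) 1).1.eq_or_lt with h0 | h0
    · simp [← h0]
    · exact ((hlim r y h0).const_smul _).const_smul _

end

/-! ### The gradient of the value function -/

section Family

variable {d : ℕ} {M : Model} {Φ : Set (EuclideanSpace ℝ (Fin d))}
  {pol : EuclideanSpace ℝ (Fin d) → Policy} (hpol : IsSmoothFamily M Φ pol)
  {φ : EuclideanSpace ℝ (Fin d)} {ρ B : ℝ}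

/-- The second derivatives of the policies are bounded by `B` on the ball of radius `ρ` in the
parameter set. -/
structure HasHessianBound (M : Model) (Φ : Set (EuclideanSpace ℝ (Fin d)))
    (pol : EuclideanSpace ℝ (Fin d) → Policy) (φ : EuclideanSpace ℝ (Fin d)) (ρ B : ℝ) : Prop where
  pos : 0 < ρ
  subset : Metric.ball φ ρ ⊆ Φ
  bound : ∀ t ∈ Icc 0 M.T, ∀ x ≤ M.C, ∀ a, ∀ ψ ∈ Metric.ball φ ρ,
    ‖iteratedFDeriv ℝ 2 (fun ψ => pol ψ t x a) ψ‖ ≤ B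

include hpol

theorem IsSmoothFamily.exists_hasHessianBound (hΦ : IsOpen Φ) (hφ : φ ∈ Φ) :
    ∃ ρ B, HasHessianBound M Φ pol φ ρ B := by
  obtain ⟨B, hB⟩ := hpol.hess_bdd φ hφ
  obtain ⟨ρ, hρ, h⟩ := Metric.eventually_nhds_iff_ball.1 (hB.and (hΦ.mem_nhds hφ))
  exact ⟨ρ, B, hρ, fun ψ hψ => (h ψ hψ).2, fun t ht x hx a ψ hψ => (h ψ hψ).1 t ht x hx a⟩

variable (hH : HasHessianBound M Φ pol φ ρ B) {t : ℝ} (ht : t ∈ Icc 0 M.T) {x : ℕ} (hx : x ≤ M.C)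

include hH ht hx

theorem IsSmoothFamily.contDiffOn_ball (a : Fin 2) :
    ContDiffOn ℝ 2 (fun ψ => pol ψ t x a) (Metric.ball φ ρ) :=
  ((hpol.smooth t ht x hx a).of_le (show ((2 : ℕ∞) : WithTop ℕ∞) ≤ _ from
    WithTop.coe_le_coe.2 le_top)).mono hH.subset

theorem IsSmoothFamily.mem_Icc_of_mem_ball (a : Fin 2) :
    ∀ ψ ∈ Metric.ball φ ρ, pol ψ t x a ∈ Icc 0 1 := fun ψ hψ =>
  (hpol.admissible ψ (hH.subset hψ)).mem_Icc ht hx a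

theorem IsSmoothFamily.hasGradientAt_pol (a : Fin 2) :
    HasGradientAt (fun ψ => pol ψ t x a) (gradient (fun ψ => pol ψ t x a) φ) φ :=
  (differentiableAt_of_mem_ball (hpol.contDiffOn_ball hH ht hx a)
    (Metric.mem_ball_self hH.pos)).hasGradientAt

/-- An action of probability zero has a vanishing gradient, as the probability is minimal there. -/
theorem IsSmoothFamily.gradient_eq_zero {a : Fin 2} (h0 : pol φ t x a = 0) :
    gradient (fun ψ => pol ψ t x a) φ = 0 := by
  rw [gradient, (isLocalMin_of_eq_zero (hpol.mem_Icc_of_mem_ball hH ht hx a)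
    (Metric.mem_ball_self hH.pos) h0).fderiv_eq_zero, map_zero]

theorem IsSmoothFamily.hasFDerivAt_entropy :
    HasFDerivAt (fun ψ => entropy M (pol ψ) t x) (∑ a ∈ available M.C x,
      -(1 + Real.log (pol φ t x a)) • fderiv ℝ (fun ψ => pol ψ t x a) φ) φ :=
  HasFDerivAt.fun_sum fun a _ => hasFDerivAt_negMulLog_comp (hpol.contDiffOn_ball hH ht hx a)
    (hH.bound t ht x hx a) (hpol.mem_Icc_of_mem_ball hH ht hx a) (Metric.mem_ball_self hH.pos)

/-- The gradient of the entropy; for an action of probability zero, the junk value `Real.log 0 = 0`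
is multiplied by a vanishing gradient. -/
theorem IsSmoothFamily.gradient_entropy :
    gradient (fun ψ => entropy M (pol ψ) t x) φ = ∑ a ∈ available M.C x,
      -(1 + Real.log (pol φ t x a)) • gradient (fun ψ => pol ψ t x a) φ := by
  rw [gradient, (hpol.hasFDerivAt_entropy hH ht hx).fderiv, map_sum]
  refine Finset.sum_congr rfl fun a _ => ?_
  rw [map_smulₛₗ, conj_trivial]
  rfl

omit hpol hH ht hx in
theorem sum_available_le {b : ℝ} (hb : 0 ≤ b) (C x : ℕ) : ∑ _a ∈ available C x, b ≤ 2 * b := by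
  rw [Finset.sum_const, nsmul_eq_mul]
  gcongr
  exact_mod_cast (Finset.card_le_univ _).trans (by simp)

theorem IsSmoothFamily.norm_gradient_entropy_le :
    ‖gradient (fun ψ => entropy M (pol ψ) t x) φ‖ ≤ 2 * (3 * sqrtConst ρ B) := by
  have hK := sqrtConst_nonneg hH.pos (hH.bound t ht x hx 0)
  rw [hpol.gradient_entropy hH ht hx]
  refine (norm_sum_le_of_le _ fun a _ => ?_).trans (sum_available_le (by positivity) M.C x)
  have := norm_log_smul_fderiv_le hH.pos (hpol.contDiffOn_ball hH ht hx a)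
    (hH.bound t ht x hx a) (hpol.mem_Icc_of_mem_ball hH ht hx a)
    (Metric.mem_ball_self (half_pos hH.pos))
  rwa [norm_smul, ← toDual_gradient, LinearIsometryEquiv.norm_map, ← norm_smul] at this

theorem IsSmoothFamily.abs_pol_sub_le (a : Fin 2) {ψ ψ' : EuclideanSpace ℝ (Fin d)}
    (hψ : ψ ∈ Metric.ball φ (ρ / 2)) (hψ' : ψ' ∈ Metric.ball φ (ρ / 2)) :
    |pol ψ' t x a - pol ψ t x a| ≤ sqrtConst ρ B * ‖ψ' - ψ‖ :=
  abs_sub_le_sqrtConst hH.pos (hpol.contDiffOn_ball hH ht hx a)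
    (hH.bound t ht x hx a) (hpol.mem_Icc_of_mem_ball hH ht hx a) hψ hψ'

theorem IsSmoothFamily.abs_entropy_sub_le {ψ ψ' : EuclideanSpace ℝ (Fin d)}
    (hψ : ψ ∈ Metric.ball φ (ρ / 2)) (hψ' : ψ' ∈ Metric.ball φ (ρ / 2)) :
    |entropy M (pol ψ') t x - entropy M (pol ψ) t x| ≤
      2 * (3 * sqrtConst ρ B) * ‖ψ' - ψ‖ := by
  have hK := sqrtConst_nonneg hH.pos (hH.bound t ht x hx 0)
  rw [entropy, entropy, ← Finset.sum_sub_distrib, mul_assoc, ← Real.norm_eq_abs]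
  refine (norm_sum_le_of_le _ fun a _ => ?_).trans (sum_available_le (by positivity) M.C x)
  exact abs_negMulLog_sub_le hH.pos (hpol.contDiffOn_ball hH ht hx a)
    (hH.bound t ht x hx a) (hpol.mem_Icc_of_mem_ball hH ht hx a) hψ hψ'

omit ht in
theorem IsSmoothFamily.intervalIntegrable_gradient_entropy (hφ : φ ∈ Φ) :
    IntervalIntegrable (fun r => gradient (fun ψ => entropy M (pol ψ) r x) φ) volume 0 M.T := by
  have hT := M.T_pos.le
  have hmeas : AEStronglyMeasurable (fun r => ∑ a ∈ available M.C x,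
      -(1 + Real.log (pol φ r x a)) • gradient (fun ψ => pol ψ r x a) φ)
      (volume.restrict (Ioc 0 M.T)) := by
    refine Finset.aestronglyMeasurable_fun_sum _ fun a _ => AEStronglyMeasurable.fun_smul ?_ ?_
    · have h1 := ((hpol.admissible φ hφ).cont x hx a).mono Ioc_subset_Icc_self
      have h2 := (h1.aestronglyMeasurable (μ := volume) measurableSet_Ioc).aemeasurable
      exact ((Real.measurable_log.comp_aemeasurable h2).const_add 1).neg.aestronglyMeasurable
    · exact ((hpol.grad_cont φ hφ x hx a).mono Ioc_subset_Icc_self).aestronglyMeasurable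
        measurableSet_Ioc
  rw [intervalIntegrable_iff_integrableOn_Ioc_of_le hT]
  refine Integrable.of_bound ?_ (2 * (3 * sqrtConst ρ B)) ?_
  · refine hmeas.congr ?_
    filter_upwards [ae_restrict_mem measurableSet_Ioc] with r hr
    exact (hpol.gradient_entropy hH ⟨hr.1.le, hr.2⟩ hx).symm
  · filter_upwards [ae_restrict_mem measurableSet_Ioc] with r hr
    exact hpol.norm_gradient_entropy_le hH ⟨hr.1.le, hr.2⟩ hx

end Family

section Gradient

variable {d : ℕ} {Ω : Type*} [MeasurableSpace Ω] {P : Measure Ω}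
  [IsProbabilityMeasure P] {M : Model} {Narr Nsrv : ℝ → Ω → ℕ} {U : ℕ → Ω → ℝ}
  (hprim : IsPrimitives M P Narr Nsrv U) {Φ : Set (EuclideanSpace ℝ (Fin d))}
  {pol : EuclideanSpace ℝ (Fin d) → Policy} (hpol : IsSmoothFamily M Φ pol)
  {φ : EuclideanSpace ℝ (Fin d)} (hφ : φ ∈ Φ) {ρ B : ℝ} (hH : HasHessianBound M Φ pol φ ρ B)
  {c : ℕ} (hc : c ≤ M.C)

/-- Density in time of the gradient of the value function. -/
noncomputable def gradientDensity (M : Model) (P : Measure Ω) (Narr Nsrv : ℝ → Ω → ℕ)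
    (U : ℕ → Ω → ℝ) (pol : EuclideanSpace ℝ (Fin d) → Policy) (φ : EuclideanSpace ℝ (Fin d))
    (c : ℕ) (r : ℝ) : EuclideanSpace ℝ (Fin d) :=
  ∑ x ∈ Finset.range (M.C + 1), stateProb P Narr Nsrv U (pol φ) 0 c r x •
    (M.lam r • (admissionGain M P Narr Nsrv U (pol φ) r x • gradient (fun ψ => pol ψ r x 1) φ) +
      M.gam • gradient (fun ψ => entropy M (pol ψ) r x) φ)

include hprim hpol hφ hH

omit hH in
theorem IsPrimitives.intervalIntegrable_admission_term (c : ℕ) {x : ℕ} (hx : x ≤ M.C) :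
    IntervalIntegrable (fun r => stateProb P Narr Nsrv U (pol φ) 0 c r x •
      (M.lam r • (admissionGain M P Narr Nsrv U (pol φ) r x •
        gradient (fun ψ => pol ψ r x 1) φ))) volume 0 M.T := by
  have hu : uIcc 0 M.T = Icc 0 M.T := uIcc_of_le M.T_pos.le
  refine IntervalIntegrable.continuousOn_smul (M.lam_integrable.smul_continuousOn ?_) ?_
  · rw [hu]
    exact (hprim.continuousOn_admissionGain (hpol.admissible φ hφ) x).smul
      (hpol.grad_cont φ hφ x hx 1)
  · rw [hu]; exact hprim.continuousOn_stateProb ⟨le_rfl, M.T_pos.le⟩ c x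

theorem IsPrimitives.intervalIntegrable_entropy_term (c : ℕ) {x : ℕ} (hx : x ≤ M.C) :
    IntervalIntegrable (fun r => stateProb P Narr Nsrv U (pol φ) 0 c r x •
      gradient (fun ψ => entropy M (pol ψ) r x) φ) volume 0 M.T := by
  refine IntervalIntegrable.continuousOn_smul
    (hpol.intervalIntegrable_gradient_entropy hH hx hφ) ?_
  rw [uIcc_of_le M.T_pos.le]
  exact hprim.continuousOn_stateProb ⟨le_rfl, M.T_pos.le⟩ c x

/-- The integral of `gradientDensity`, split into the contribution of the admissions and that of the
entropy. -/
theorem IsPrimitives.integral_gradientDensity (c : ℕ) :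
    IntervalIntegrable (gradientDensity M P Narr Nsrv U pol φ c) volume 0 M.T ∧
    ∫ r in 0..M.T, gradientDensity M P Narr Nsrv U pol φ c r =
      (∫ r in 0..M.T, ∑ x ∈ Finset.range (M.C + 1), stateProb P Narr Nsrv U (pol φ) 0 c r x •
        (M.lam r • (admissionGain M P Narr Nsrv U (pol φ) r x •
          gradient (fun ψ => pol ψ r x 1) φ))) +
      M.gam • ∫ r in 0..M.T, ∑ x ∈ Finset.range (M.C + 1),
        stateProb P Narr Nsrv U (pol φ) 0 c r x •
          gradient (fun ψ => entropy M (pol ψ) r x) φ := by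
  have i1 := intervalIntegrable_fun_sum fun x hx =>
    hprim.intervalIntegrable_admission_term hpol hφ c (mem_range_succ_iff_le.1 hx)
  have i2 := intervalIntegrable_fun_sum fun x hx =>
    hprim.intervalIntegrable_entropy_term hpol hφ hH c (mem_range_succ_iff_le.1 hx)
  have heq : gradientDensity M P Narr Nsrv U pol φ c = fun r =>
      (∑ x ∈ Finset.range (M.C + 1), stateProb P Narr Nsrv U (pol φ) 0 c r x •
        (M.lam r • (admissionGain M P Narr Nsrv U (pol φ) r x •
          gradient (fun ψ => pol ψ r x 1) φ))) +
      M.gam • ∑ x ∈ Finset.range (M.C + 1), stateProb P Narr Nsrv U (pol φ) 0 c r x •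
          gradient (fun ψ => entropy M (pol ψ) r x) φ := by
    funext r
    rw [gradientDensity, Finset.smul_sum, ← Finset.sum_add_distrib]
    refine Finset.sum_congr rfl fun x _ => ?_
    rw [smul_add, smul_comm M.gam]
  rw [heq]
  refine ⟨i1.add (i2.smul M.gam), ?_⟩
  refine (intervalIntegral.integral_add i1 (i2.smul M.gam)).trans (congrArg₂ _ rfl ?_)
  exact intervalIntegral.integral_smul M.gam fun r => ∑ x ∈ Finset.range (M.C + 1),
    stateProb P Narr Nsrv U (pol φ) 0 c r x • gradient (fun ψ => entropy M (pol ψ) r x) φ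

include hc

/-- The value function is differentiable in the parameter: in the performance difference formula,
the law of the queue may be frozen at the base parameter, up to an error of second order. -/
theorem IsPrimitives.hasGradientAt_value :
    HasGradientAt (fun ψ => value M P Narr Nsrv U (pol ψ) 0 c)
      (∫ r in 0..M.T, gradientDensity M P Narr Nsrv U pol φ c r) φ := by
  set S := Finset.range (M.C + 1) with hS
  have hle : ∀ {y}, y ∈ S → y ≤ M.C := mem_range_succ_iff_le.1
  have h0 : (0 : ℝ) ∈ Icc 0 M.T := ⟨le_rfl, M.T_pos.le⟩
  have hu : uIcc 0 M.T = Icc 0 M.T := uIcc_of_le M.T_pos.le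
  have huo : uIoc 0 M.T = Ioc 0 M.T := uIoc_of_le M.T_pos.le
  have hadm := hpol.admissible φ hφ
  set K := sqrtConst ρ B with hKdef
  have hK : 0 ≤ K := sqrtConst_nonneg hH.pos (hH.bound 0 h0 0 (Nat.zero_le _) 0)
  set q : ℝ → ℕ → ℝ := fun r x => stateProb P Narr Nsrv U (pol φ) 0 c r x with hq
  set G : ℝ → ℕ → ℝ := fun r x => admissionGain M P Narr Nsrv U (pol φ) r x with hG
  have hGc : ∀ x, ContinuousOn (fun r => G r x) (Icc 0 M.T) :=
    fun x => hprim.continuousOn_admissionGain hadm x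
  obtain ⟨b, hb0, hb⟩ := exists_forall_norm_le (T := M.T) M.C (h := G) fun y _ => hGc y
  have hqc : ∀ x, ContinuousOn (fun r => q r x) (Icc 0 M.T) := fun x =>
    hprim.continuousOn_stateProb h0 c x
  set g : EuclideanSpace ℝ (Fin d) → ℝ → ℕ → ℝ := fun ψ r x =>
    M.lam r * ((pol ψ r x 1 - pol φ r x 1) * G r x) +
      M.gam * (entropy M (pol ψ) r x - entropy M (pol φ) r x) with hg
  set β : ℝ → ℝ := fun r => M.lam r * (K * b) + M.gam * (2 * (3 * K)) with hβ
  have hβi : IntervalIntegrable β volume 0 M.T :=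
    (M.lam_integrable.mul_const _).add intervalIntegrable_const
  have hφball : φ ∈ Metric.ball φ (ρ / 2) := Metric.mem_ball_self (half_pos hH.pos)
  have hgam := M.gam_nonneg
  have hgsub : ∀ ψ ∈ Metric.ball φ (ρ / 2), ∀ ψ' ∈ Metric.ball φ (ρ / 2), ∀ r ∈ Icc 0 M.T,
      ∀ x ≤ M.C, |g ψ' r x - g ψ r x| ≤ β r * ‖ψ' - ψ‖ := by
    intro ψ hψ ψ' hψ' r hr x hx
    have hl := M.lam_nonneg r hr
    have e : g ψ' r x - g ψ r x = M.lam r * ((pol ψ' r x 1 - pol ψ r x 1) * G r x) +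
        M.gam * (entropy M (pol ψ') r x - entropy M (pol ψ) r x) := by
      simp only [hg]; ring
    have e1 := hpol.abs_pol_sub_le hH hr hx 1 hψ hψ'
    have e2 := hpol.abs_entropy_sub_le hH hr hx hψ hψ'
    have e3 : |G r x| ≤ b := hb x hx r hr
    rw [e]
    calc _ ≤ |M.lam r * ((pol ψ' r x 1 - pol ψ r x 1) * G r x)| +
          |M.gam * (entropy M (pol ψ') r x - entropy M (pol ψ) r x)| := abs_add_le _ _
      _ = M.lam r * (|pol ψ' r x 1 - pol ψ r x 1| * |G r x|) +
          M.gam * |entropy M (pol ψ') r x - entropy M (pol ψ) r x| := by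
          rw [abs_mul, abs_mul, abs_mul, abs_of_nonneg hl, abs_of_nonneg hgam]
      _ ≤ M.lam r * ((K * ‖ψ' - ψ‖) * b) + M.gam * (2 * (3 * K) * ‖ψ' - ψ‖) := by gcongr
      _ = β r * ‖ψ' - ψ‖ := by simp only [hβ]; ring
  have hgφ : ∀ r x, g φ r x = 0 := by intro r x; simp [hg]
  have hgi : ∀ ψ ∈ Metric.ball φ (ρ / 2), ∀ x ∈ S,
      IntervalIntegrable (fun r => g ψ r x) volume 0 M.T := by
    intro ψ hψ x hx
    have hadm' := hpol.admissible ψ (hH.subset (ball_half_subset hH.pos hψ))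
    refine (M.lam_integrable.mul_continuousOn ?_).add (ContinuousOn.intervalIntegrable ?_)
    · rw [hu]
      exact ((hadm'.cont x (hle hx) 1).sub (hadm.cont x (hle hx) 1)).mul (hGc x)
    · rw [hu]
      exact ((hadm'.continuousOn_entropy (hle hx)).sub
        (hadm.continuousOn_entropy (hle hx))).const_smul M.gam
  have hqgi : ∀ ψ ∈ Metric.ball φ (ρ / 2), IntervalIntegrable
      (fun r => ∑ x ∈ S, q r x * g ψ r x) volume 0 M.T := fun ψ hψ =>
    intervalIntegrable_fun_sum fun x hx => (hgi ψ hψ x hx).continuousOn_mul (by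
      rw [hu]; exact hqc x)
  -- derivative of the integral with the frozen law
  have hmain : HasFDerivAt (fun ψ => ∫ r in 0..M.T, ∑ x ∈ S, q r x * g ψ r x)
      (∫ r in 0..M.T, InnerProductSpace.toDual ℝ (EuclideanSpace ℝ (Fin d))
        (gradientDensity M P Narr Nsrv U pol φ c r)) φ := by
    refine (intervalIntegral.hasFDerivAt_integral_of_dominated_loc_of_lip
      (F := fun ψ r => ∑ x ∈ S, q r x * g ψ r x)
      (bound := fun r => ∑ _x ∈ S, β r) (Metric.isOpen_ball.mem_nhds hφball)
      ?_ (hqgi φ hφball) ?_ (.of_forall fun r hr => ?_)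
      (intervalIntegrable_fun_sum fun _ _ => hβi) (.of_forall fun r hr => ?_)).2
    · filter_upwards [Metric.isOpen_ball.mem_nhds hφball] with ψ hψ
      exact (intervalIntegrable_iff.1 (hqgi ψ hψ)).aestronglyMeasurable
    · exact (InnerProductSpace.toDual ℝ
        (EuclideanSpace ℝ (Fin d))).continuous.comp_aestronglyMeasurable
        (intervalIntegrable_iff.1
          (hprim.integral_gradientDensity hpol hφ hH c).1).aestronglyMeasurable
    · rw [huo] at hr
      have hr : r ∈ Icc 0 M.T := ⟨hr.1.le, hr.2⟩
      refine LipschitzOnWith.of_dist_le_mul fun ψ hψ ψ' hψ' => ?_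
      rw [Real.dist_eq, dist_eq_norm, Real.coe_nnabs]
      refine le_trans ?_ (mul_le_mul_of_nonneg_right (le_abs_self _) (norm_nonneg _))
      rw [← Finset.sum_sub_distrib, Finset.sum_mul]
      refine (Finset.abs_sum_le_sum_abs _ _).trans (Finset.sum_le_sum fun x hx => ?_)
      rw [← mul_sub, abs_mul, abs_of_nonneg (stateProb_nonneg _ _ _ _)]
      exact (mul_le_of_le_one_left (abs_nonneg _) (stateProb_le_one _ _ _ _)).trans
        (hgsub ψ' hψ' ψ hψ r hr x (hle hx))
    · rw [huo] at hr
      have hr : r ∈ Icc 0 M.T := ⟨hr.1.le, hr.2⟩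
      have hterm : ∀ x ∈ S, HasFDerivAt (fun ψ => q r x * g ψ r x)
          (InnerProductSpace.toDual ℝ (EuclideanSpace ℝ (Fin d)) (q r x •
            (M.lam r • (G r x • gradient (fun ψ => pol ψ r x 1) φ) +
              M.gam • gradient (fun ψ => entropy M (pol ψ) r x) φ))) φ := by
        intro x hx
        have d1 : HasFDerivAt (fun ψ => pol ψ r x 1) _ φ :=
          (hpol.hasGradientAt_pol hH hr (hle hx) 1).hasFDerivAt
        have d2 : HasFDerivAt (fun ψ => entropy M (pol ψ) r x) _ φ :=
          (hpol.hasFDerivAt_entropy hH hr (hle hx)).differentiableAt.hasGradientAt.hasFDerivAt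
        have := ((((d1.sub_const (pol φ r x 1)).mul_const (G r x)).const_mul (M.lam r)).add
          ((d2.sub_const (entropy M (pol φ) r x)).const_mul M.gam)).const_mul (q r x)
        simp only [map_smulₛₗ, map_add, conj_trivial] at this ⊢
        exact this
      rw [gradientDensity, map_sum]
      exact HasFDerivAt.fun_sum hterm
  have hdual : ∫ r in 0..M.T, InnerProductSpace.toDual ℝ (EuclideanSpace ℝ (Fin d))
        (gradientDensity M P Narr Nsrv U pol φ c r) =
      InnerProductSpace.toDual ℝ (EuclideanSpace ℝ (Fin d))
        (∫ r in 0..M.T, gradientDensity M P Narr Nsrv U pol φ c r) := by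
    have hD := (hprim.integral_gradientDensity hpol hφ hH c).1
    have hD' : IntervalIntegrable (fun r => InnerProductSpace.toDual ℝ (EuclideanSpace ℝ (Fin d))
        (gradientDensity M P Narr Nsrv U pol φ c r)) volume 0 M.T := by
      rw [intervalIntegrable_iff] at hD ⊢
      refine Integrable.mono hD ((InnerProductSpace.toDual ℝ
        (EuclideanSpace ℝ (Fin d))).continuous.comp_aestronglyMeasurable
        (Integrable.aestronglyMeasurable hD)) (.of_forall fun r => ?_)
      rw [LinearIsometryEquiv.norm_map]
    ext v
    rw [ContinuousLinearMap.intervalIntegral_apply hD', InnerProductSpace.toDual_apply_apply,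
      real_inner_comm]
    have := ContinuousLinearMap.intervalIntegral_comp_comm (innerSL ℝ v) hD
    simp only [innerSL_apply_apply] at this
    rw [← this]
    refine intervalIntegral.integral_congr fun r _ => ?_
    simp only [InnerProductSpace.toDual_apply_apply, real_inner_comm]
  -- the error made by freezing the law
  set L := ((M.C : ℝ) + 1) * ((M.C + 1) * ((∫ r in 0..M.T, M.lam r) * K)) with hL
  set R : EuclideanSpace ℝ (Fin d) → ℝ := fun ψ => ∫ r in 0..M.T, ∑ x ∈ S,
    (stateProb P Narr Nsrv U (pol ψ) 0 c r x - q r x) * g ψ r x with hR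
  have hRO : R =O[𝓝 φ] fun ψ => ‖ψ - φ‖ ^ 2 := by
    refine Asymptotics.IsBigO.of_bound (∫ r in 0..M.T, ∑ _x ∈ S, L * β r) ?_
    filter_upwards [Metric.isOpen_ball.mem_nhds hφball] with ψ hψ
    have hadm' := hpol.admissible ψ (hH.subset (ball_half_subset hH.pos hψ))
    rw [norm_pow, norm_norm, ← intervalIntegral.integral_mul_const]
    refine intervalIntegral.norm_integral_le_of_norm_le M.T_pos.le (.of_forall fun r hr => ?_)
      ((intervalIntegrable_fun_sum fun _ _ => hβi.const_mul L).mul_const _)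
    have hr : r ∈ Icc 0 M.T := ⟨hr.1.le, hr.2⟩
    rw [Finset.sum_mul]
    refine norm_sum_le_of_le _ fun x hx => ?_
    have e1 := hprim.abs_stateProb_sub_le_of_policy hadm hadm' hc
      (fun r hr x hx => hpol.abs_pol_sub_le hH hr hx 1 hφball hψ) hr (hle hx)
    have e2 := hgsub φ hφball ψ hψ r hr x (hle hx)
    rw [hgφ, sub_zero] at e2
    rw [norm_mul, Real.norm_eq_abs, Real.norm_eq_abs]
    calc _ ≤ ((M.C + 1) * ((M.C + 1) * ((∫ r in 0..M.T, M.lam r) * (K * ‖ψ - φ‖)))) *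
          (β r * ‖ψ - φ‖) := mul_le_mul e1 e2 (abs_nonneg _) ((abs_nonneg _).trans e1)
      _ = L * β r * ‖ψ - φ‖ ^ 2 := by simp only [hL]; ring
  have hRd : HasFDerivAt R (0 : EuclideanSpace ℝ (Fin d) →L[ℝ] ℝ) φ :=
    hRO.hasFDerivAt one_lt_two
  rw [hasGradientAt_iff_hasFDerivAt, ← hdual]
  have hsum := (hmain.add hRd).const_add (value M P Narr Nsrv U (pol φ) 0 c)
  rw [add_zero] at hsum
  refine hsum.congr_of_eventuallyEq ?_
  filter_upwards [Metric.isOpen_ball.mem_nhds hφball] with ψ hψ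
  have hadm' := hpol.admissible ψ (hH.subset (ball_half_subset hH.pos hψ))
  have hRi : IntervalIntegrable (fun r => ∑ x ∈ S,
      (stateProb P Narr Nsrv U (pol ψ) 0 c r x - q r x) * g ψ r x) volume 0 M.T :=
    intervalIntegrable_fun_sum fun x hx => (hgi ψ hψ x hx).continuousOn_mul (by
      rw [hu]; exact (hprim.continuousOn_stateProb h0 c x).sub (hqc x))
  have hdiff := hprim.value_sub_value hadm hadm' hc
  rw [sub_eq_iff_eq_add'] at hdiff
  simp only [hR, Pi.add_apply]
  rw [hdiff, ← intervalIntegral.integral_add (hqgi ψ hψ) hRi]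
  congr 1
  refine intervalIntegral.integral_congr fun r _ => ?_
  simp only [← Finset.sum_add_distrib]
  refine Finset.sum_congr rfl fun x _ => ?_
  simp only [hg, hG]
  ring

end Gradient

/-! ### The two terms of the policy gradient -/

section

variable {d : ℕ} {Ω : Type*} [MeasurableSpace Ω] {P : Measure Ω}
  [IsProbabilityMeasure P] {M : Model} {Narr Nsrv : ℝ → Ω → ℕ} {U : ℕ → Ω → ℝ}
  (hprim : IsPrimitives M P Narr Nsrv U) {Φ : Set (EuclideanSpace ℝ (Fin d))}
  {pol : EuclideanSpace ℝ (Fin d) → Policy} (hpol : IsSmoothFamily M Φ pol)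
  {φ : EuclideanSpace ℝ (Fin d)} (hφ : φ ∈ Φ) {ρ B : ℝ} (hH : HasHessianBound M Φ pol φ ρ B)
  {c : ℕ} (hc : c ≤ M.C)

theorem gradient_log {f : EuclideanSpace ℝ (Fin d) → ℝ} {φ g : EuclideanSpace ℝ (Fin d)}
    (hf : HasGradientAt f g φ) (h0 : f φ ≠ 0) :
    gradient (fun ψ => Real.log (f ψ)) φ = (f φ)⁻¹ • g := by
  rw [gradient, (hf.hasFDerivAt.log h0).fderiv, map_smulₛₗ, conj_trivial,
    LinearIsometryEquiv.symm_apply_apply]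

include hprim hpol hφ hH hc

/-- At the times of the admissions the probability of an admission is positive and the queue is
not full, so that the score is the gradient of the admission probability, weighted by its inverse
and by the gain of an admission. -/
theorem IsPrimitives.scoreIntegral_ae_eq :
    (fun ω => jumpIntegral (fun r =>
        (pol φ r (Function.leftLim (queueLength (pol φ) (fun r => Narr r ω) (fun r => Nsrv r ω)
          (fun i => U i ω) 0 c) r) 1)⁻¹ •
        (admissionGain M P Narr Nsrv U (pol φ) r (Function.leftLim (queueLength (pol φ)
          (fun r => Narr r ω) (fun r => Nsrv r ω) (fun i => U i ω) 0 c) r) •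
        gradient (fun ψ => pol ψ r (Function.leftLim (queueLength (pol φ)
          (fun r => Narr r ω) (fun r => Nsrv r ω) (fun i => U i ω) 0 c) r) 1) φ))
      (admitted (pol φ) (fun r => Narr r ω) (fun r => Nsrv r ω) (fun i => U i ω) 0 c) 0 M.T)
    =ᵐ[P] fun ω => scoreIntegral M pol φ (value M P Narr Nsrv U (pol φ))
      (fun t => Narr t ω) (fun t => Nsrv t ω) (fun i => U i ω) c := by
  have hadm := hpol.admissible φ hφ
  filter_upwards [hprim.ae_pol_pos_of_jump hadm le_rfl M.T_pos.le le_rfl hc] with ω hω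
  refine finsum_congr fun r => finsum_congr fun hr => ?_
  rcases eq_or_ne ((admitted (pol φ) (fun r => Narr r ω) (fun r => Nsrv r ω)
    (fun i => U i ω) 0 c r : ℝ) - (Function.leftLim (admitted (pol φ) (fun r => Narr r ω)
      (fun r => Nsrv r ω) (fun i => U i ω) 0 c) r : ℕ)) 0 with h0 | h0
  · rw [h0, zero_smul, zero_smul]
  obtain ⟨hle, hpos⟩ := hω r hr h0
  have hr : r ∈ Icc 0 M.T := ⟨hr.1.le, hr.2⟩
  have hlt := hle.lt_of_ne fun h => by rw [h, hadm.unavailable_self hr] at hpos; exact hpos.false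
  beta_reduce
  rw [gradient_log (hpol.hasGradientAt_pol hH hr hle 1) hpos.ne', admissionGain, if_pos hlt,
    smul_comm (_ : ℝ)⁻¹]

/-- The score integral is integrable, and its expectation is the first term of the integral of
`gradientDensity`. -/
theorem IsPrimitives.integral_scoreIntegral :
    Integrable (fun ω => scoreIntegral M pol φ (value M P Narr Nsrv U (pol φ))
      (fun t => Narr t ω) (fun t => Nsrv t ω) (fun i => U i ω) c) P ∧
    ∫ ω, scoreIntegral M pol φ (value M P Narr Nsrv U (pol φ))
      (fun t => Narr t ω) (fun t => Nsrv t ω) (fun i => U i ω) c ∂P =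
    ∫ r in 0..M.T, ∑ x ∈ Finset.range (M.C + 1), stateProb P Narr Nsrv U (pol φ) 0 c r x •
      (M.lam r • (admissionGain M P Narr Nsrv U (pol φ) r x •
        gradient (fun ψ => pol ψ r x 1) φ)) := by
  have hadm := hpol.admissible φ hφ
  have hae := hprim.scoreIntegral_ae_eq hpol hφ hH hc
  obtain ⟨h1, h2⟩ := hprim.integral_jumpIntegral_inv_smul hadm le_rfl M.T_pos.le le_rfl hc
    (v := fun r y => admissionGain M P Narr Nsrv U (pol φ) r y •
      gradient (fun ψ => pol ψ r y 1) φ)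
    fun y hy => (hprim.continuousOn_admissionGain hadm y).smul (hpol.grad_cont φ hφ y hy 1)
  refine ⟨h1.congr hae, (integral_congr_ae hae).symm.trans (h2.trans ?_)⟩
  refine intervalIntegral.integral_congr fun r hr => Finset.sum_congr rfl fun x hx => ?_
  rw [uIcc_of_le M.T_pos.le] at hr
  rcases eq_or_ne (pol φ r x 1) 0 with h0 | h0
  · simp only [hpol.gradient_eq_zero hH hr (mem_range_succ_iff_le.1 hx) h0, smul_zero]
  · rw [smul_comm (stateProb _ _ _ _ _ _ _ _ _), mul_smul, smul_inv_smul₀ h0]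

/-- The entropy gradient is integrable along almost every path, and the expectation of its
integral is the second term of the integral of `gradientDensity`. -/
theorem IsPrimitives.integral_entropyGrad :
    (∀ᵐ ω ∂P, IntervalIntegrable (entropyGrad M pol φ
      (fun t => Narr t ω) (fun t => Nsrv t ω) (fun i => U i ω) c) volume 0 M.T) ∧
    Integrable (fun ω => ∫ t in (0 : ℝ)..M.T, entropyGrad M pol φ
      (fun t => Narr t ω) (fun t => Nsrv t ω) (fun i => U i ω) c t) P ∧
    ∫ ω, (∫ t in (0 : ℝ)..M.T, entropyGrad M pol φ
      (fun t => Narr t ω) (fun t => Nsrv t ω) (fun i => U i ω) c t) ∂P =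
    ∫ r in 0..M.T, ∑ x ∈ Finset.range (M.C + 1), stateProb P Narr Nsrv U (pol φ) 0 c r x •
      gradient (fun ψ => entropy M (pol ψ) r x) φ :=
  hprim.integral_comp_leftLim (hpol.admissible φ hφ) le_rfl M.T_pos.le le_rfl hc
    (g := fun r y => gradient (fun ψ => entropy M (pol ψ) r y) φ)
    (fun _ hy => hpol.intervalIntegrable_gradient_entropy hH hy hφ)
    (fun _ hy _ hr => hpol.norm_gradient_entropy_le hH hr hy)

end

end QueueControl

theorem mainTheorem9 {d : ℕ} {Ω : Type*} [MeasurableSpace Ω] (P : Measure Ω)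
    [IsProbabilityMeasure P] (M : QueueControl.Model) (Narr Nsrv : ℝ → Ω → ℕ) (U : ℕ → Ω → ℝ)
    (hprim : QueueControl.IsPrimitives M P Narr Nsrv U)
    (Φ : Set (EuclideanSpace ℝ (Fin d))) (hΦ : IsOpen Φ)
    (pol : EuclideanSpace ℝ (Fin d) → QueueControl.Policy)
    (hpol : QueueControl.IsSmoothFamily M Φ pol)
    (φ : EuclideanSpace ℝ (Fin d)) (hφ : φ ∈ Φ) (c : ℕ) (hc : c ≤ M.C) :
    -- the value functions are expectations of integrable rewards
    (∀ ψ ∈ Φ, ∀ s ∈ Icc 0 M.T, ∀ x ≤ M.C, Integrable (fun ω => QueueControl.reward M (pol ψ)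
        (fun t => Narr t ω) (fun t => Nsrv t ω) (fun i => U i ω) s x) P) ∧
    -- the entropy is differentiable in the parameter, and the logarithms are those of
    -- positive numbers at the times where a customer is admitted
    (∀ t ∈ Icc 0 M.T, ∀ x ≤ M.C,
      DifferentiableAt ℝ (fun ψ => QueueControl.entropy M (pol ψ) t x) φ) ∧
    (∀ᵐ ω ∂P, ∀ t ∈ Ioc 0 M.T,
      Function.leftLim (QueueControl.admitted (pol φ) (fun t => Narr t ω) (fun t => Nsrv t ω)
          (fun i => U i ω) 0 c) t
        < QueueControl.admitted (pol φ) (fun t => Narr t ω) (fun t => Nsrv t ω)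
          (fun i => U i ω) 0 c t →
      0 < pol φ t (Function.leftLim (QueueControl.queueLength (pol φ) (fun t => Narr t ω)
        (fun t => Nsrv t ω) (fun i => U i ω) 0 c) t) 1) ∧
    -- the two terms are integrable
    Integrable (fun ω => QueueControl.scoreIntegral M pol φ
      (QueueControl.value M P Narr Nsrv U (pol φ))
      (fun t => Narr t ω) (fun t => Nsrv t ω) (fun i => U i ω) c) P ∧
    (∀ᵐ ω ∂P, IntervalIntegrable (QueueControl.entropyGrad M pol φ
      (fun t => Narr t ω) (fun t => Nsrv t ω) (fun i => U i ω) c) volume 0 M.T) ∧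
    Integrable (fun ω => ∫ t in (0 : ℝ)..M.T, QueueControl.entropyGrad M pol φ
      (fun t => Narr t ω) (fun t => Nsrv t ω) (fun i => U i ω) c t) P ∧
    -- the policy gradient formula
    HasGradientAt (fun ψ => QueueControl.value M P Narr Nsrv U (pol ψ) 0 c)
      (∫ ω, (QueueControl.scoreIntegral M pol φ (QueueControl.value M P Narr Nsrv U (pol φ))
            (fun t => Narr t ω) (fun t => Nsrv t ω) (fun i => U i ω) c
          + M.gam • ∫ t in (0 : ℝ)..M.T, QueueControl.entropyGrad M pol φ
              (fun t => Narr t ω) (fun t => Nsrv t ω) (fun i => U i ω) c t) ∂P) φ := by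
  obtain ⟨ρ, B, hH⟩ := hpol.exists_hasHessianBound hΦ hφ
  have hadm := hpol.admissible φ hφ
  obtain ⟨s1, s2⟩ := hprim.integral_scoreIntegral hpol hφ hH hc
  obtain ⟨e1, e2, e3⟩ := hprim.integral_entropyGrad hpol hφ hH hc
  refine ⟨fun ψ hψ s hs x hx =>
      (hprim.integrable_reward_and_value_eq (hpol.admissible ψ hψ) hs hx).1,
    fun t ht x hx => (hpol.hasFDerivAt_entropy hH ht hx).differentiableAt, ?_, s1, e1, e2, ?_⟩
  · filter_upwards [hprim.ae_pol_pos_of_jump hadm le_rfl M.T_pos.le le_rfl hc] with ω hω t ht hlt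
    exact (hω t ht (sub_pos.2 (Nat.cast_lt.2 hlt)).ne').2
  · have h := hprim.hasGradientAt_value hpol hφ hH hc
    rw [(hprim.integral_gradientDensity hpol hφ hH c).2, ← s2, ← e3, ← integral_smul] at h
    convert h using 1
    exact integral_add s1 (e2.smul M.gam)
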